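/- **Setting.** For tempered distributions $f$ on $\mathbb{R}^3$ use the Fourier transform normalised by $\widehat f(\xi)=\int_{\mathbb{R}^3}e^{-i\xi\cdot x}f(x)\,dx$. For $a\ge 0$, $\sigma\ge 1$, $r\in\mathbb{R}$ let $\mathcal{X}^r_{a,\sigma}$ be the space of (scalar- or vector-valued) $f\in\mathcal{S}'(\mathbb{R}^3)$ such that $\widehat f\in L^1_{\rm loc}(\mathbb{R}^3)$ and $$\|f\|_{\mathcal{X}^r_{a,\sigma}}:=\int_{\mathbb{R}^3}|\xi|^r e^{a|\xi|^{1/\sigma}}|\widehat f(\xi)|\,d\xi<\infty ,$$ and put $\|(u,\theta)\|_{\mathcal{X}^r_{a,\sigma}}:=\|u\|_{\mathcal{X}^r_{a,\sigma}}+\|\theta\|_{\mathcal{X}^r_{a,\sigma}}$. Consider the fractional Boussinesq system on $\mathbb{R}^3$ $$u_t+(-\Delta)^\alpha u+u\cdot\nabla u+\nabla p=\theta e_3,\qquad \theta_t+(-\Delta)^\beta\theta+u\cdot\nabla\theta=0,\qquad \operatorname{div}u=0,\qquad (u,\theta)(0)=(u_0,\theta_0),$$ with $u$ real vector-valued, $\theta$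 real-valued, $e_3=(0,0,1)$ and $\operatorname{div}u_0=0$. Let $\mathbb{P}$ be the Leray projector. A *mild solution* on $[0,T)$ with data $(u_0,\theta_0)\in\mathcal{X}^s_{a,\sigma}$ is a pair $(u,\theta)$ of real-valued distributions depending on $t\in[0,T)$, with $\operatorname{div}u=0$ and $$u\in C([0,T);\mathcal{X}^s_{a,\sigma})\cap L^1_{\rm loc}([0,T);\mathcal{X}^{s+2\alpha}_{a,\sigma}),\qquad \theta\in C([0,T);\mathcal{X}^s_{a,\sigma})\cap L^1_{\rm loc}([0,T);\mathcal{X}^{s+2\beta}_{a,\sigma}),$$ (where $L^1_{\rm loc}([0,T);X)$ means integrable on $[0,T']$ for every $T'<T$) such that for all $t\in[0,T)$ $$u(t)=e^{-t(-\Delta)^\alpha}u_0-\int_0^t e^{-(t-\tau)(-\Delta)^\alpha}\mathbb{P}(u\cdot\nabla u)\,d\tau+\int_0^t e^{-(t-\tau)(-\Delta)^\alpha}\mathbb{P}(\theta e_3)\,d\tau,$$ $$\theta(t)=e^{-t(-\Delta)^\beta}\theta_0-\int_0^t e^{-(t-\tau)(-\Delta)^\beta}(u\cdot\nabla\theta)\,d\tau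 .$$ It is *maximal*, with maximal time $T^*$, if it is a mild solution on $[0,T^*)$ that is not the restriction of a mild solution on $[0,T')$ for any $T'>T^*$. **Theorem.** Let $\alpha>\tfrac12$, $\beta>\tfrac12$, $s\in[-1,0]$ and $$s>q_{\alpha,\beta}:=\max\Big\{1-2\alpha,\ \tfrac{\alpha(1-2\beta)}{\beta},\ \tfrac{\beta(1-2\alpha)}{\alpha}\Big\}.$$ There is a constant $C>0$, depending only on $s,\alpha,\beta$, such that the following holds for all $a\ge0$, $\sigma\ge1$ and all data $(u_0,\theta_0)\in\mathcal{X}^s_{a,\sigma}$ with $\operatorname{div}u_0=0$. If $(u,\theta)$ is a maximal mild solution with these data and its maximal time $T^*$ is finite, then, writing $\|\cdot\|$ for $\|\cdot\|_{\mathcal{X}^s_{a,\sigma}}$: 1. $\displaystyle\limsup_{t\nearrow T^*}\|(u,\theta)(t)\|=\infty$; 2. for every $t\in[0,T^*)$, $$\int_t^{T^*}\Big[\|u(\tau)\|^{\frac{2\alpha}{2\alpha+s-1}}+\|u(\tau)\|^{\frac{\beta(s+2\alpha)}{\beta(s+2\alpha)-\alpha}}\|\theta(\tau)\|^{\frac{-s\beta}{\beta(s+2\alpha)-\alpha}}+\|u(\tau)\|^{\frac{-s\alpha}{\alpha(s+2\beta)-\beta}}\|\theta(\tau)\|^{\frac{\alpha(s+2\beta)}{\alpha(s+2\beta)-\beta}}\Big]d\tau=\infty$$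 (with $x^0=1$ for all $x\ge0$ when $s=0$); 3. for every $t\in[0,T^*)$, $$\|(u,\theta)(t)\|^{\frac{2\alpha}{2\alpha+s-1}}+\|(u,\theta)(t)\|^{\frac{2\alpha\beta}{2\alpha\beta+s\beta-\alpha}}+\|(u,\theta)(t)\|^{\frac{2\alpha\beta}{2\alpha\beta+s\alpha-\beta}}\ \ge\ \big[e^{C(T^*-t)}-1\big]^{-1}.$$ -/

import Mathlib

open MeasureTheory Set Filter Topology
open scoped ENNReal SchwartzMap FourierTransform LineDeriv

noncomputable section

namespace Boussinesq

/-- The physical (and frequency) space `ℝ³` with its Euclidean norm. -/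
abbrev E3 := EuclideanSpace ℝ (Fin 3)

/-- `ℂ³` with its Hermitian norm. -/
abbrev C3 := EuclideanSpace ℂ (Fin 3)

variable {F : Type*} [NormedAddCommGroup F] [NormedSpace ℂ F]

/-! ### Fourier transforms that are functions -/

/-- `f̂ = g`, where `f` is a tempered distribution, `g` is a locally integrable function, and
`f̂ ξ = ∫ exp (-i ξ · x) f x dx`. Mathlib's transform `𝓕` has the kernel `exp (-2 π i ω · x)`, so
that `f̂ ξ = (𝓕 f) (ξ / 2π)`: the statement is that `𝓕 f` is the function `ω ↦ g (2 π ω)`. -/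
def HasFourierFn (f : 𝓢'(E3, F)) (g : E3 → F) : Prop :=
  LocallyIntegrable g ∧
    ∀ φ : 𝓢(E3, ℂ), Integrable (fun ω => φ ω • g ((2 * Real.pi) • ω)) ∧
      (𝓕 f) φ = ∫ ω, φ ω • g ((2 * Real.pi) • ω)

/-- A tempered distribution whose Fourier transform is a function is determined by that
function. -/
theorem HasFourierFn.unique {f₁ f₂ : 𝓢'(E3, F)} {g : E3 → F}
    (h₁ : HasFourierFn f₁ g) (h₂ : HasFourierFn f₂ g) : f₁ = f₂ := by
  have h : 𝓕 f₁ = 𝓕 f₂ := by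
    ext φ
    rw [(h₁.2 φ).2, (h₂.2 φ).2]
  have h' : 𝓕⁻ (𝓕 f₁) = 𝓕⁻ (𝓕 f₂) := congrArg (fun f : 𝓢'(E3, F) => (𝓕⁻ f : 𝓢'(E3, F))) h
  simpa using h'

open Classical in
/-- The function `f̂` (unique almost everywhere), and `0` if `f̂` is not a function. -/
def fourierFn (f : 𝓢'(E3, F)) : E3 → F :=
  if h : ∃ g, HasFourierFn f g then h.choose else 0

open Classical in
/-- The tempered distribution with Fourier transform `g`, and `0` if there is none. -/
def ofFourier (g : E3 → F) : 𝓢'(E3, F) :=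
  if h : ∃ f, HasFourierFn f g then h.choose else 0

/-! ### Lei-Lin-Gevrey spaces -/

open Classical in
/-- `‖f‖ = ∫ |ξ|^s exp (a |ξ|^(1/σ)) |f̂ ξ| dξ`, with the value `∞` if `f̂` is not a function. -/
def leiLinNorm (a σ s : ℝ) (f : 𝓢'(E3, F)) : ℝ≥0∞ :=
  if ∃ g, HasFourierFn f g then
    ∫⁻ ξ, ENNReal.ofReal (‖ξ‖ ^ s * Real.exp (a * ‖ξ‖ ^ (1 / σ))) * ‖fourierFn f ξ‖ₑ
  else ⊤

/-- The space of all tempered distributions `f` such that `f̂` is a locally integrable function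
and `∫ |ξ|^s exp (a |ξ|^(1/σ)) |f̂ ξ| dξ < ∞`. -/
def LeiLinGevrey (a σ s : ℝ) : Set 𝓢'(E3, F) :=
  {f | leiLinNorm a σ s f < ⊤}

/-- `f ∈ C([0, T); X)`, where `X` is the space with parameters `a`, `σ`, `s`. -/
def ContinuousInto (a σ s T : ℝ) (f : ℝ → 𝓢'(E3, F)) : Prop :=
  ∀ t ∈ Ico 0 T, f t ∈ LeiLinGevrey a σ s ∧
    Tendsto (fun τ => leiLinNorm a σ s (f τ - f t)) (𝓝[Ico 0 T] t) (𝓝 0)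

/-- `∫₀^T' ‖f t‖ dt < ∞` for every `T' < T`, with the norm with parameters `a`, `σ`, `r`. -/
def LocallyL1Into (a σ r T : ℝ) (f : ℝ → 𝓢'(E3, F)) : Prop :=
  ∀ T' ∈ Ioo 0 T, ∫⁻ t in Icc 0 T', leiLinNorm a σ r (f t) < ⊤

/-! ### The operators of the Boussinesq system -/

/-- The fractional heat semigroup `exp (-t (-Δ)^γ)`, with Fourier symbol `exp (-t |ξ|^(2γ))`. -/
def heat (γ t : ℝ) (f : 𝓢'(E3, F)) : 𝓢'(E3, F) :=
  ofFourier fun ξ => (Real.exp (-(t * ‖ξ‖ ^ (2 * γ))) : ℂ) • fourierFn f ξ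

/-- The Leray projector, with Fourier symbol `I - (ξ ⊗ ξ) / |ξ|²`. -/
def leray (f : 𝓢'(E3, C3)) : 𝓢'(E3, C3) :=
  ofFourier fun ξ => WithLp.toLp 2 fun i =>
    fourierFn f ξ i - (ξ i : ℂ) * (∑ j, (ξ j : ℂ) * fourierFn f ξ j) / ((‖ξ‖ ^ 2 : ℝ) : ℂ)

/-- `u · ∇ f = ∑ⱼ uⱼ ∂ⱼ f`, the products being given by the convolution of the Fourier transforms:
the Fourier transform of `u · ∇ f` is `(2π)⁻³ ∑ⱼ ûⱼ * (i ηⱼ f̂)`. -/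
def transport (u : 𝓢'(E3, C3)) (f : 𝓢'(E3, F)) : 𝓢'(E3, F) :=
  ofFourier fun ξ => (((2 * Real.pi) ^ 3)⁻¹ : ℂ) •
    ∫ η, (∑ j, fourierFn u (ξ - η) j * (Complex.I * (η j : ℂ))) • fourierFn f η

/-- The buoyancy force `θ e₃`. -/
def buoyancy (θ : 𝓢'(E3, ℂ)) : 𝓢'(E3, C3) :=
  PointwiseConvergenceCLM.postcomp 𝓢(E3, ℂ)
    (ContinuousLinearMap.toSpanSingleton ℂ (EuclideanSpace.single (2 : Fin 3) (1 : ℂ))) θ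

/-- `div u = 0` in the sense of distributions. -/
def DivFree (u : 𝓢'(E3, C3)) : Prop :=
  ∀ φ : 𝓢(E3, ℂ), ∑ i, (∂_{EuclideanSpace.single i (1 : ℝ)} u : 𝓢'(E3, C3)) φ i = 0

/-- The scalar distribution `θ` is real-valued. -/
def IsRealScalar (θ : 𝓢'(E3, ℂ)) : Prop :=
  ∀ φ : 𝓢(E3, ℂ), (∀ x, (φ x).im = 0) → (θ φ).im = 0

/-- The vector distribution `u` is real-valued. -/
def IsRealVector (u : 𝓢'(E3, C3)) : Prop :=
  ∀ φ : 𝓢(E3, ℂ), (∀ x, (φ x).im = 0) → ∀ i, (u φ i).im = 0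

/-! ### Mild solutions -/

/-- `(u, θ)` is a mild solution on `[0, T)` of the fractional Boussinesq system with initial data
`(u₀, θ₀)`, in the class
`[C([0,T); X^s) ∩ L¹_loc([0,T); X^(s+2α))] × [C([0,T); X^s) ∩ L¹_loc([0,T); X^(s+2β))]`.
Integrals of distribution-valued functions of time are taken by testing. Only the values of `u`
and `θ` at times in `[0, T)` matter. -/
structure IsMildSolution (a σ s α β : ℝ) (u₀ : 𝓢'(E3, C3)) (θ₀ : 𝓢'(E3, ℂ)) (T : ℝ)
    (u : ℝ → 𝓢'(E3, C3)) (θ : ℝ → 𝓢'(E3, ℂ)) : Prop where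
  real_u : ∀ t ∈ Ico 0 T, IsRealVector (u t)
  real_θ : ∀ t ∈ Ico 0 T, IsRealScalar (θ t)
  div_u : ∀ t ∈ Ico 0 T, DivFree (u t)
  cont_u : ContinuousInto a σ s T u
  cont_θ : ContinuousInto a σ s T θ
  int_u : LocallyL1Into a σ (s + 2 * α) T u
  int_θ : LocallyL1Into a σ (s + 2 * β) T θ
  eq_u : ∀ t ∈ Ico 0 T, ∀ φ : 𝓢(E3, ℂ),
    u t φ = heat α t u₀ φ
      - (∫ τ in (0 : ℝ)..t, heat α (t - τ) (leray (transport (u τ) (u τ))) φ)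
      + ∫ τ in (0 : ℝ)..t, heat α (t - τ) (leray (buoyancy (θ τ))) φ
  eq_θ : ∀ t ∈ Ico 0 T, ∀ φ : 𝓢(E3, ℂ),
    θ t φ = heat β t θ₀ φ - ∫ τ in (0 : ℝ)..t, heat β (t - τ) (transport (u τ) (θ τ)) φ

/-- `(u, θ)` is a mild solution on `[0, T)`, `0 < T < ∞`, that has no extension to a mild solution
(in the same class) on a longer interval: it is a maximal solution, with maximal time `T`. -/
def IsMaximalSolution (a σ s α β : ℝ) (u₀ : 𝓢'(E3, C3)) (θ₀ : 𝓢'(E3, ℂ)) (T : ℝ)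
    (u : ℝ → 𝓢'(E3, C3)) (θ : ℝ → 𝓢'(E3, ℂ)) : Prop :=
  0 < T ∧ IsMildSolution a σ s α β u₀ θ₀ T u θ ∧
    ¬ ∃ T' > T, ∃ (v : ℝ → 𝓢'(E3, C3)) (ψ : ℝ → 𝓢'(E3, ℂ)),
      IsMildSolution a σ s α β u₀ θ₀ T' v ψ ∧ ∀ t ∈ Ico 0 T, v t = u t ∧ ψ t = θ t

/-- `q_{α,β} = max {1 - 2α, α (1 - 2β) / β, β (1 - 2α) / α}`. -/
def q (α β : ℝ) : ℝ :=
  max (1 - 2 * α) (max (α * (1 - 2 * β) / β) (β * (1 - 2 * α) / α))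

/-- The norm `‖(u, θ)‖ = ‖u‖ + ‖θ‖` of a pair. -/
def pairNorm (a σ s : ℝ) (u : 𝓢'(E3, C3)) (θ : 𝓢'(E3, ℂ)) : ℝ≥0∞ :=
  leiLinNorm a σ s u + leiLinNorm a σ s θ

end Boussinesq

end

open MeasureTheory Set Filter Topology
open scoped ENNReal SchwartzMap FourierTransform LineDeriv

set_option linter.unusedSectionVars false

noncomputable section

namespace Boussinesq

variable {F : Type*} [NormedAddCommGroup F] [NormedSpace ℂ F]

/-! ### Dilations of the frequency space -/

theorem quasiMeasurePreserving_dilation {r : ℝ} (hr : r ≠ 0) :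
    Measure.QuasiMeasurePreserving (fun ω : E3 => r • ω) := by
  refine ⟨by fun_prop, ?_⟩
  rw [Measure.map_addHaar_smul volume hr]
  exact Measure.smul_absolutelyContinuous

theorem measurableEmbedding_dilation {r : ℝ} (hr : r ≠ 0) :
    MeasurableEmbedding (fun ω : E3 => r • ω) :=
  (Homeomorph.smulOfNeZero r hr).measurableEmbedding

theorem lintegral_dilation {r : ℝ} (hr : r ≠ 0) (H : E3 → ℝ≥0∞) :
    ∫⁻ ω, H (r • ω) = ENNReal.ofReal |(r ^ 3)⁻¹| * ∫⁻ ξ, H ξ := by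
  rw [← (measurableEmbedding_dilation hr).lintegral_map, Measure.map_addHaar_smul volume hr,
    lintegral_smul_measure]
  simp

theorem two_pi_ne_zero : (2 * Real.pi : ℝ) ≠ 0 := by positivity

theorem ae_dilation_iff {r : ℝ} (hr : r ≠ 0) {p : E3 → Prop} :
    (∀ᵐ ω : E3, p (r • ω)) ↔ ∀ᵐ ξ : E3, p ξ := by
  refine ⟨fun h => ?_, fun h => (quasiMeasurePreserving_dilation hr).ae h⟩
  have := (quasiMeasurePreserving_dilation (inv_ne_zero hr)).ae h
  simpa [smul_smul, hr] using this

theorem LocallyIntegrable.dilation {g : E3 → F} (hg : LocallyIntegrable g) {r : ℝ} (hr : r ≠ 0) :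
    LocallyIntegrable (fun ω => g (r • ω)) := by
  have h := locallyIntegrable_map_homeomorph (Homeomorph.smulOfNeZero r hr) (f := g)
    (μ := (volume : Measure E3))
  refine h.1 ?_
  have : Measure.map (⇑(Homeomorph.smulOfNeZero r hr)) (volume : Measure E3) =
    ENNReal.ofReal |(r ^ Module.finrank ℝ E3)⁻¹| • volume := Measure.map_addHaar_smul volume hr
  rw [this]
  intro x
  obtain ⟨s, hs, hi⟩ := hg x
  refine ⟨s, hs, ?_⟩
  rw [IntegrableOn, Measure.restrict_smul]
  exact hi.smul_measure ENNReal.ofReal_ne_top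

/-! ### Distributions whose Fourier transform is a function -/

theorem HasFourierFn.congr {f : 𝓢'(E3, F)} {g g' : E3 → F} (h : HasFourierFn f g)
    (hg : g =ᵐ[volume] g') : HasFourierFn f g' := by
  refine ⟨(h.1.congr hg), fun φ => ?_⟩
  have h1 : (fun ω => φ ω • g ((2 * Real.pi) • ω)) =ᵐ[volume]
      fun ω => φ ω • g' ((2 * Real.pi) • ω) := by
    filter_upwards [(ae_dilation_iff two_pi_ne_zero).2 hg] with ω hω
    rw [hω]
  exact ⟨(h.2 φ).1.congr h1, by rw [(h.2 φ).2, integral_congr_ae h1]⟩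

theorem HasFourierFn.sub {f f' : 𝓢'(E3, F)} {g g' : E3 → F} (h : HasFourierFn f g)
    (h' : HasFourierFn f' g') : HasFourierFn (f - f') (g - g') := by
  refine ⟨h.1.sub h'.1, fun φ => ⟨?_, ?_⟩⟩
  · simp only [Pi.sub_apply, smul_sub]
    exact (h.2 φ).1.sub (h'.2 φ).1
  · have := integral_sub (h.2 φ).1 (h'.2 φ).1
    simp only [Pi.sub_apply, smul_sub]
    rw [this, ← (h.2 φ).2, ← (h'.2 φ).2]
    rfl

/-- A locally integrable function that annihilates all Schwartz functions vanishes. -/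
theorem ae_eq_zero_of_integral_schwartz_smul_eq_zero [CompleteSpace F] {k : E3 → F}
    (hk : LocallyIntegrable k) (h : ∀ φ : 𝓢(E3, ℂ), ∫ ω, φ ω • k ω = 0) : k =ᵐ[volume] 0 := by
  refine ae_eq_zero_of_integral_contDiff_smul_eq_zero hk fun g hg hc => ?_
  have hg₁ : HasCompactSupport (Complex.ofRealCLM ∘ g) := hc.comp_left rfl
  have hg₂ : ContDiff ℝ (↑(⊤ : ℕ∞)) (Complex.ofRealCLM ∘ g) := by fun_prop
  have := h (hg₁.toSchwartzMap hg₂)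
  simpa using this

theorem HasFourierFn.ae_eq [CompleteSpace F] {f : 𝓢'(E3, F)} {g g' : E3 → F}
    (h : HasFourierFn f g) (h' : HasFourierFn f g') : g =ᵐ[volume] g' := by
  have h0 := h.sub h'
  have hk := ae_eq_zero_of_integral_schwartz_smul_eq_zero
    (LocallyIntegrable.dilation h0.1 two_pi_ne_zero) fun φ => by
      rw [← (h0.2 φ).2]; simp
  filter_upwards [(ae_dilation_iff two_pi_ne_zero (p := fun ξ => (g - g') ξ = 0)).1 hk] with ξ hξ
  simpa [sub_eq_zero] using hξ

theorem hasFourierFn_fourierFn {f : 𝓢'(E3, F)} (h : ∃ g, HasFourierFn f g) :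
    HasFourierFn f (fourierFn f) := by
  rw [fourierFn, dif_pos h]; exact h.choose_spec

theorem HasFourierFn.fourierFn_ae_eq [CompleteSpace F] {f : 𝓢'(E3, F)} {g : E3 → F}
    (h : HasFourierFn f g) : fourierFn f =ᵐ[volume] g :=
  (hasFourierFn_fourierFn ⟨g, h⟩).ae_eq h

theorem hasFourierFn_ofFourier {g : E3 → F} (h : ∃ f, HasFourierFn f g) :
    HasFourierFn (ofFourier g) g := by
  rw [ofFourier, dif_pos h]; exact h.choose_spec

/-! ### Weighted norms on the Fourier side -/

/-- The weight `|ξ|^r exp (a |ξ|^(1/σ))`. -/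
def wt (a σ r : ℝ) (ξ : E3) : ℝ≥0∞ :=
  ENNReal.ofReal (‖ξ‖ ^ r * Real.exp (a * ‖ξ‖ ^ (1 / σ)))

theorem measurable_wt (a σ r : ℝ) : Measurable (wt a σ r) := by
  unfold wt; fun_prop

theorem wt_ne_top (a σ r : ℝ) (ξ : E3) : wt a σ r ξ ≠ ⊤ := ENNReal.ofReal_ne_top

theorem wt_ne_zero (a σ r : ℝ) {ξ : E3} (h : ξ ≠ 0) : wt a σ r ξ ≠ 0 := by
  have : 0 < ‖ξ‖ := norm_pos_iff.2 h
  simp only [wt, ne_eq, ENNReal.ofReal_eq_zero, not_le]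
  positivity

theorem ae_ne_zero : ∀ᵐ ξ : E3, ξ ≠ 0 := by
  simp [ae_iff, measure_singleton]

/-- The norm of `L¹` with the weight `|ξ|^r exp (a |ξ|^(1/σ))`. -/
def fnorm (a σ r : ℝ) (g : E3 → F) : ℝ≥0∞ := ∫⁻ ξ, wt a σ r ξ * ‖g ξ‖ₑ

theorem fnorm_congr {a σ r : ℝ} {g g' : E3 → F} (h : g =ᵐ[volume] g') :
    fnorm a σ r g = fnorm a σ r g' := by
  refine lintegral_congr_ae ?_
  filter_upwards [h] with ξ hξ
  rw [hξ]

theorem HasFourierFn.leiLinNorm_eq [CompleteSpace F] {f : 𝓢'(E3, F)} {g : E3 → F}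
    (h : HasFourierFn f g) (a σ r : ℝ) : leiLinNorm a σ r f = fnorm a σ r g := by
  rw [leiLinNorm, if_pos ⟨g, h⟩]
  exact fnorm_congr (g := fourierFn f) h.fourierFn_ae_eq

theorem exists_of_leiLinNorm_lt_top {f : 𝓢'(E3, F)} {a σ r : ℝ} (h : leiLinNorm a σ r f < ⊤) :
    HasFourierFn f (fourierFn f) := by
  refine hasFourierFn_fourierFn ?_
  by_contra h'
  rw [leiLinNorm, if_neg h'] at h
  exact lt_irrefl _ h

theorem leiLinNorm_eq_fnorm {f : 𝓢'(E3, F)} {a σ r : ℝ} (h : HasFourierFn f (fourierFn f)) :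
    leiLinNorm a σ r f = fnorm a σ r (fourierFn f) := by
  rw [leiLinNorm, if_pos ⟨_, h⟩]; rfl

/-- The weight is bounded below by a tempered weight. -/
theorem ofReal_inv_le_wt {a σ s : ℝ} (ha : 0 ≤ a) (hs : s ∈ Icc (-1 : ℝ) 0) {ω : E3} (hω : ω ≠ 0) :
    ENNReal.ofReal ((1 + ‖ω‖ ^ 2)⁻¹) ≤ wt a σ s ((2 * Real.pi) • ω) * 7 := by
  have h7 : (7 : ℝ≥0∞) = ENNReal.ofReal 7 := by norm_num
  have hpos : 0 < ‖ω‖ := norm_pos_iff.2 hω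
  rw [h7, wt, ← ENNReal.ofReal_mul (by positivity)]
  refine ENNReal.ofReal_le_ofReal ?_
  set x := ‖(2 * Real.pi) • ω‖ with hx
  have hxe : x = 2 * Real.pi * ‖ω‖ := by
    rw [hx, norm_smul, Real.norm_of_nonneg (by positivity)]
  have hx0 : 0 < x := by rw [hxe]; positivity
  have hexp : 1 ≤ Real.exp (a * x ^ (1 / σ)) := Real.one_le_exp (by positivity)
  have hpi := Real.pi_lt_d2
  have key : (1 + ‖ω‖ ^ 2)⁻¹ ≤ x ^ s * 7 := by
    rcases le_total x 1 with h1 | h1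
    · have : 1 ≤ x ^ s := Real.one_le_rpow_of_pos_of_le_one_of_nonpos hx0 h1 hs.2
      have h2 : (1 + ‖ω‖ ^ 2)⁻¹ ≤ 1 := inv_le_one_of_one_le₀ (by nlinarith)
      linarith
    · have h3 : x ^ (-1 : ℝ) ≤ x ^ s := Real.rpow_le_rpow_of_exponent_le h1 hs.1
      rw [Real.rpow_neg_one] at h3
      have h4 : (1 + ‖ω‖ ^ 2)⁻¹ ≤ x⁻¹ * 7 := by
        rw [inv_mul_eq_div, inv_eq_one_div, div_le_div_iff₀ (by positivity) hx0, hxe]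
        nlinarith [sq_nonneg (‖ω‖ - 1)]
      linarith
  calc (1 + ‖ω‖ ^ 2)⁻¹ ≤ x ^ s * 7 := key
    _ ≤ x ^ s * Real.exp (a * x ^ (1 / σ)) * 7 := by
      have : 0 < x ^ s := by positivity
      nlinarith

theorem integrable_of_fnorm {a σ s : ℝ} (ha : 0 ≤ a) (hs : s ∈ Icc (-1 : ℝ) 0) {g : E3 → F}
    (hm : AEStronglyMeasurable g) (hg : fnorm a σ s g < ⊤) :
    Integrable (fun ω : E3 => ((1 + ‖ω‖ ^ 2)⁻¹ : ℝ) • g ((2 * Real.pi) • ω)) := by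
  have hm' : AEStronglyMeasurable (fun ω : E3 => g ((2 * Real.pi) • ω)) :=
    hm.comp_quasiMeasurePreserving (quasiMeasurePreserving_dilation two_pi_ne_zero)
  refine ⟨?_, ?_⟩
  · refine AEStronglyMeasurable.smul ?_ hm'
    exact Measurable.aestronglyMeasurable (by measurability)
  · rw [hasFiniteIntegral_iff_enorm]
    calc ∫⁻ ω : E3, ‖((1 + ‖ω‖ ^ 2)⁻¹ : ℝ) • g ((2 * Real.pi) • ω)‖ₑ
        ≤ ∫⁻ ω : E3, 7 * (wt a σ s ((2 * Real.pi) • ω) * ‖g ((2 * Real.pi) • ω)‖ₑ) := by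
          refine lintegral_mono_ae ?_
          filter_upwards [ae_ne_zero] with ω hω
          rw [enorm_smul, Real.enorm_of_nonneg (by positivity), ← mul_assoc, mul_comm 7]
          gcongr
          exact ofReal_inv_le_wt ha hs hω
      _ = 7 * (ENNReal.ofReal |((2 * Real.pi) ^ 3)⁻¹| * fnorm a σ s g) := by
          rw [lintegral_const_mul' _ _ (by norm_num),
            lintegral_dilation two_pi_ne_zero (fun ξ => wt a σ s ξ * ‖g ξ‖ₑ), fnorm]
      _ < ⊤ := by
          refine ENNReal.mul_lt_top (by norm_num) (ENNReal.mul_lt_top ENNReal.ofReal_lt_top hg)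

/-- The Fourier transform of a tempered distribution may be any function of finite norm. -/
theorem exists_hasFourierFn [CompleteSpace F] {a σ s : ℝ} (ha : 0 ≤ a) (hs : s ∈ Icc (-1 : ℝ) 0)
    {g : E3 → F} (hm : AEStronglyMeasurable g) (hg : fnorm a σ s g < ⊤) :
    ∃ f : 𝓢'(E3, F), HasFourierFn f g := by
  have hi := integrable_of_fnorm ha hs hm hg
  set k : E3 → F := fun ω : E3 => ((1 + ‖ω‖ ^ 2)⁻¹ : ℝ) • g ((2 * Real.pi) • ω) with hk
  set m : E3 → ℂ := fun ω => ((1 + ‖ω‖ ^ 2 : ℝ) : ℂ) with hm_def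
  have htg : m.HasTemperateGrowth := by
    have : (fun ω : E3 => (1 + ‖ω‖ ^ 2 : ℝ)).HasTemperateGrowth := by fun_prop
    exact Complex.ofRealCLM.hasTemperateGrowth.comp this
  have hmk : ∀ ω, g ((2 * Real.pi) • ω) = m ω • k ω := by
    intro ω
    have h0 : (1 + ‖ω‖ ^ 2 : ℝ) ≠ 0 := by positivity
    simp only [hk, hm_def, Complex.coe_smul, smul_smul]
    rw [mul_inv_cancel₀ h0, one_smul]
  have hk1 : MemLp k 1 := memLp_one_iff_integrable.2 hi
  set T : 𝓢'(E3, F) := TemperedDistribution.smulLeftCLM F m (hk1.toLp k : Lp F 1 (volume : Measure E3))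
    with hT
  have hTapp : ∀ φ : 𝓢(E3, ℂ), T φ = ∫ ω, φ ω • g ((2 * Real.pi) • ω) := by
    intro φ
    rw [hT, TemperedDistribution.smulLeftCLM_apply_apply, Lp.toTemperedDistribution_apply]
    refine integral_congr_ae ?_
    filter_upwards [hk1.coeFn_toLp] with ω hω
    rw [hω, hmk, SchwartzMap.smulLeftCLM_apply_apply htg, smul_smul, smul_eq_mul, mul_comm]
  refine ⟨𝓕⁻ T, ?_, fun φ => ⟨?_, ?_⟩⟩
  · have h1 : LocallyIntegrable (fun ω => m ω • k ω) := by
      have := hi.locallyIntegrable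
      refine (this.continuous_smul (g := m) ?_)
      exact htg.1.continuous
    have h2 := LocallyIntegrable.dilation h1 (inv_ne_zero two_pi_ne_zero)
    simp only [← hmk] at h2
    refine (locallyIntegrable_congr ?_).1 h2
    refine Eventually.of_forall fun ξ => ?_
    simp only [smul_smul, mul_inv_cancel₀ two_pi_ne_zero, one_smul]
  · simp only [hmk, smul_smul]
    have hbd : ∃ C : ℝ, ∀ ω, ‖φ ω * m ω‖ ≤ C := by
      refine ⟨SchwartzMap.seminorm ℂ 0 0 (SchwartzMap.smulLeftCLM ℂ m φ), fun ω => ?_⟩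
      have := SchwartzMap.norm_le_seminorm ℂ (SchwartzMap.smulLeftCLM ℂ m φ) ω
      rw [SchwartzMap.smulLeftCLM_apply_apply htg, smul_eq_mul, mul_comm] at this
      exact this
    obtain ⟨C, hC⟩ := hbd
    refine hi.bdd_smul C ?_ (Eventually.of_forall hC)
    exact (φ.continuous.mul htg.1.continuous).aestronglyMeasurable
  · rw [FourierTransform.fourier_fourierInv_eq, hTapp]

/-! ### The operators of the system on the Fourier side -/

/-- The symbol of the heat semigroup. -/
def heatSymbol (γ t : ℝ) (ξ : E3) : ℂ := (Real.exp (-(t * ‖ξ‖ ^ (2 * γ))) : ℂ)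

theorem measurable_heatSymbol (γ : ℝ) :
    Measurable fun p : ℝ × E3 => heatSymbol γ p.1 p.2 := by
  unfold heatSymbol; fun_prop

theorem enorm_heatSymbol (γ t : ℝ) (ξ : E3) :
    ‖heatSymbol γ t ξ‖ₑ = ENNReal.ofReal (Real.exp (-(t * ‖ξ‖ ^ (2 * γ)))) := by
  rw [heatSymbol, ← ofReal_norm, Complex.norm_real, Real.norm_of_nonneg (by positivity)]

theorem enorm_heatSymbol_le_one {γ t : ℝ} (ht : 0 ≤ t) (ξ : E3) : ‖heatSymbol γ t ξ‖ₑ ≤ 1 := by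
  rw [enorm_heatSymbol]
  refine (ENNReal.ofReal_le_ofReal ?_).trans_eq ENNReal.ofReal_one
  exact Real.exp_le_one_iff.2 (neg_nonpos.2 (by positivity))

theorem fnorm_mono {V W : Type*} [NormedAddCommGroup V] [NormedAddCommGroup W] {a σ r : ℝ}
    {g : E3 → V} {h : E3 → W} (c : ℝ≥0∞) (hc : c ≠ ⊤) (H : ∀ᵐ ξ : E3, ‖g ξ‖ₑ ≤ c * ‖h ξ‖ₑ) :
    fnorm a σ r g ≤ c * fnorm a σ r h := by
  rw [fnorm, fnorm, ← lintegral_const_mul' _ _ hc]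
  refine lintegral_mono_ae ?_
  filter_upwards [H] with ξ hξ
  calc wt a σ r ξ * ‖g ξ‖ₑ ≤ wt a σ r ξ * (c * ‖h ξ‖ₑ) := by gcongr
    _ = _ := by ring

theorem fnorm_mono_one {V W : Type*} [NormedAddCommGroup V] [NormedAddCommGroup W] {a σ r : ℝ}
    {g : E3 → V} {h : E3 → W} (H : ∀ᵐ ξ : E3, ‖g ξ‖ₑ ≤ ‖h ξ‖ₑ) :
    fnorm a σ r g ≤ fnorm a σ r h := by
  simpa using fnorm_mono (a := a) (σ := σ) (r := r) 1 (by simp) (by simpa using H)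

theorem HasFourierFn.aestronglyMeasurable {f : 𝓢'(E3, F)} {g : E3 → F} (h : HasFourierFn f g) :
    AEStronglyMeasurable g := h.1.aestronglyMeasurable

theorem HasFourierFn.heat [CompleteSpace F] {f : 𝓢'(E3, F)} {g : E3 → F} (h : HasFourierFn f g)
    {a σ s : ℝ} (ha : 0 ≤ a) (hs : s ∈ Icc (-1 : ℝ) 0) (hg : fnorm a σ s g < ⊤)
    (γ : ℝ) {t : ℝ} (ht : 0 ≤ t) :
    HasFourierFn (heat γ t f) (fun ξ => heatSymbol γ t ξ • g ξ) := by
  have hae := h.fourierFn_ae_eq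
  have key : HasFourierFn (Boussinesq.heat γ t f) (fun ξ => heatSymbol γ t ξ • fourierFn f ξ) := by
    refine hasFourierFn_ofFourier (exists_hasFourierFn (a := a) (σ := σ) ha hs ?_ ?_)
    · refine AEStronglyMeasurable.smul ?_ (hasFourierFn_fourierFn ⟨g, h⟩).aestronglyMeasurable
      exact ((measurable_heatSymbol γ).comp (measurable_const.prodMk measurable_id)).aestronglyMeasurable
    · refine lt_of_le_of_lt (fnorm_mono_one ?_) hg
      filter_upwards [hae] with ξ hξ
      change ‖heatSymbol γ t ξ • fourierFn f ξ‖ₑ ≤ _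
      rw [enorm_smul, hξ]
      exact mul_le_of_le_one_left' (enorm_heatSymbol_le_one ht ξ)
  refine key.congr ?_
  filter_upwards [hae] with ξ hξ
  rw [hξ]

/-- The symbol of the Leray projector. -/
def lerayAt (ξ : E3) (v : C3) : C3 := WithLp.toLp 2 fun i =>
  v i - (ξ i : ℂ) * (∑ j, (ξ j : ℂ) * v j) / ((‖ξ‖ ^ 2 : ℝ) : ℂ)

theorem lerayAt_apply (ξ : E3) (v : C3) (i : Fin 3) :
    lerayAt ξ v i = v i - (ξ i : ℂ) * (∑ j, (ξ j : ℂ) * v j) / ((‖ξ‖ ^ 2 : ℝ) : ℂ) := rfl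

theorem lerayAt_sub (ξ : E3) (v w : C3) : lerayAt ξ (v - w) = lerayAt ξ v - lerayAt ξ w := by
  ext i
  simp only [lerayAt_apply, PiLp.sub_apply, mul_sub, Finset.sum_sub_distrib]
  ring

theorem lerayAt_add (ξ : E3) (v w : C3) : lerayAt ξ (v + w) = lerayAt ξ v + lerayAt ξ w := by
  ext i
  simp only [lerayAt_apply, PiLp.add_apply, mul_add, Finset.sum_add_distrib]
  ring

theorem lerayAt_neg (ξ : E3) (v : C3) : lerayAt ξ (-v) = -lerayAt ξ v := by
  ext i
  simp only [lerayAt_apply, PiLp.neg_apply, mul_neg, Finset.sum_neg_distrib]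
  ring

theorem norm_sq_eq_sum (ξ : E3) : ((‖ξ‖ ^ 2 : ℝ) : ℂ) = ∑ j, (ξ j : ℂ) * (ξ j : ℂ) := by
  rw [EuclideanSpace.norm_sq_eq]
  push_cast
  refine Finset.sum_congr rfl fun j _ => ?_
  rw [Real.norm_eq_abs, ← Complex.ofReal_pow, sq_abs]; push_cast; ring

theorem sum_mul_lerayAt (ξ : E3) (v : C3) : ∑ i, (ξ i : ℂ) * lerayAt ξ v i = 0 := by
  rcases eq_or_ne ξ 0 with rfl | hξ
  · simp
  have h0 : ((‖ξ‖ ^ 2 : ℝ) : ℂ) ≠ 0 := by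
    have : ‖ξ‖ ≠ 0 := norm_ne_zero_iff.2 hξ
    exact_mod_cast pow_ne_zero 2 this
  simp only [lerayAt_apply, mul_sub, Finset.sum_sub_distrib]
  have : ∑ i, (ξ i : ℂ) * ((ξ i : ℂ) * (∑ j, (ξ j : ℂ) * v j) / ((‖ξ‖ ^ 2 : ℝ) : ℂ)) =
      (∑ j, (ξ j : ℂ) * (ξ j : ℂ)) * (∑ j, (ξ j : ℂ) * v j) / ((‖ξ‖ ^ 2 : ℝ) : ℂ) := by
    rw [Finset.sum_mul, Finset.sum_div]
    exact Finset.sum_congr rfl fun i _ => by ring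
  rw [this, ← norm_sq_eq_sum, mul_div_assoc, mul_div_cancel₀ _ h0, sub_self]

theorem norm_sum_mul_le (ξ : E3) (v : C3) : ‖∑ j, (ξ j : ℂ) * v j‖ ≤ ‖ξ‖ * ‖v‖ := by
  have h := norm_inner_le_norm (𝕜 := ℂ) (WithLp.toLp 2 fun j => (ξ j : ℂ) : C3) v
  have h1 : ‖(WithLp.toLp 2 fun j => (ξ j : ℂ) : C3)‖ = ‖ξ‖ := by
    simp [EuclideanSpace.norm_eq]
  rw [h1] at h
  refine le_trans (le_of_eq ?_) h
  congr 1
  simp [PiLp.inner_apply, mul_comm]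

theorem norm_lerayAt_le (ξ : E3) (v : C3) : ‖lerayAt ξ v‖ ≤ 2 * ‖v‖ := by
  have e : lerayAt ξ v = v - ((∑ j, (ξ j : ℂ) * v j) / ((‖ξ‖ ^ 2 : ℝ) : ℂ)) •
      (WithLp.toLp 2 fun j => (ξ j : ℂ) : C3) := by
    ext i
    simp only [lerayAt_apply, PiLp.sub_apply, PiLp.smul_apply, smul_eq_mul]
    ring
  have h1 : ‖(WithLp.toLp 2 fun j => (ξ j : ℂ) : C3)‖ = ‖ξ‖ := by
    simp [EuclideanSpace.norm_eq]
  rw [e]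
  refine (norm_sub_le _ _).trans ?_
  rw [norm_smul, norm_div, h1, Complex.norm_real, Real.norm_of_nonneg (by positivity)]
  rcases eq_or_ne ξ 0 with rfl | hξ
  · simp; linarith [norm_nonneg v]
  have : 0 < ‖ξ‖ := norm_pos_iff.2 hξ
  have h2 := norm_sum_mul_le ξ v
  have : ‖∑ j, (ξ j : ℂ) * v j‖ / ‖ξ‖ ^ 2 * ‖ξ‖ ≤ ‖v‖ := by
    rw [div_mul_eq_mul_div, div_le_iff₀ (by positivity)]
    nlinarith
  linarith

theorem enorm_lerayAt_le (ξ : E3) (v : C3) : ‖lerayAt ξ v‖ₑ ≤ 2 * ‖v‖ₑ := by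
  rw [← ofReal_norm, ← ofReal_norm]
  refine (ENNReal.ofReal_le_ofReal (norm_lerayAt_le ξ v)).trans_eq ?_
  rw [ENNReal.ofReal_mul (by norm_num), ENNReal.ofReal_ofNat]

theorem measurable_lerayAt : Measurable fun p : E3 × C3 => lerayAt p.1 p.2 := by
  unfold lerayAt
  refine (WithLp.measurable_toLp 2 _).comp (measurable_pi_iff.2 fun i => ?_)
  fun_prop

theorem HasFourierFn.leray {f : 𝓢'(E3, C3)} {g : E3 → C3} (h : HasFourierFn f g)
    {a σ s : ℝ} (ha : 0 ≤ a) (hs : s ∈ Icc (-1 : ℝ) 0) (hg : fnorm a σ s g < ⊤) :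
    HasFourierFn (leray f) (fun ξ => lerayAt ξ (g ξ)) := by
  have hae := h.fourierFn_ae_eq
  have key : HasFourierFn (Boussinesq.leray f) (fun ξ => lerayAt ξ (fourierFn f ξ)) := by
    refine hasFourierFn_ofFourier (exists_hasFourierFn (a := a) (σ := σ) ha hs ?_ ?_)
    · have := (hasFourierFn_fourierFn ⟨g, h⟩).aestronglyMeasurable
      exact (measurable_lerayAt.comp_aemeasurable
        (aemeasurable_id.prodMk this.aemeasurable)).aestronglyMeasurable
    · refine lt_of_le_of_lt (fnorm_mono (h := g) 2 (by simp) ?_) (ENNReal.mul_lt_top (by simp) hg)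
      filter_upwards [hae] with ξ hξ
      rw [← hξ]
      exact enorm_lerayAt_le ξ _
  refine key.congr ?_
  filter_upwards [hae] with ξ hξ
  rw [hξ]

/-- The inclusion of scalars into vectors in the direction `e₃`. -/
def vert : ℂ →L[ℂ] C3 :=
  ContinuousLinearMap.toSpanSingleton ℂ (EuclideanSpace.single (2 : Fin 3) (1 : ℂ))

theorem enorm_vert (z : ℂ) : ‖vert z‖ₑ = ‖z‖ₑ := by
  rw [← ofReal_norm, ← ofReal_norm]
  simp [vert, norm_smul]

theorem HasFourierFn.buoyancy {f : 𝓢'(E3, ℂ)} {g : E3 → ℂ} (h : HasFourierFn f g) :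
    HasFourierFn (buoyancy f) (fun ξ => vert (g ξ)) := by
  refine ⟨?_, fun φ => ?_⟩
  · intro x
    obtain ⟨s, hs, hi⟩ := h.1 x
    exact ⟨s, hs, vert.integrable_comp hi⟩
  have e : (fun ω => φ ω • vert (g ((2 * Real.pi) • ω))) =
      fun ω => vert (φ ω • g ((2 * Real.pi) • ω)) := by
    ext1 ω; rw [map_smul]
  rw [e]
  refine ⟨vert.integrable_comp (h.2 φ).1, ?_⟩
  rw [ContinuousLinearMap.integral_comp_comm _ (h.2 φ).1, ← (h.2 φ).2]
  rfl

/-! ### Divergence-free and real distributions -/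

theorem HasFourierFn.apply_eq {f : 𝓢'(E3, F)} {g : E3 → F} (h : HasFourierFn f g)
    (φ : 𝓢(E3, ℂ)) : f φ = ∫ ω, (𝓕⁻ φ) ω • g ((2 * Real.pi) • ω) := by
  rw [← (h.2 (𝓕⁻ φ)).2]
  simp

theorem locallyIntegrable_clm {V W : Type*} [NormedAddCommGroup V] [NormedSpace ℂ V]
    [NormedAddCommGroup W] [NormedSpace ℂ W] (l : V →L[ℂ] W) {g : E3 → V}
    (h : LocallyIntegrable g) : LocallyIntegrable (fun ξ => l (g ξ)) := by
  intro x
  obtain ⟨s, hs, hi⟩ := h x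
  exact ⟨s, hs, l.integrable_comp hi⟩

theorem HasFourierFn.lineDeriv_fourier {f : 𝓢'(E3, F)} {g : E3 → F} (h : HasFourierFn f g)
    (m : E3) (ψ : 𝓢(E3, ℂ)) :
    Integrable (fun ω => ψ ω • ((inner ℝ ω m : ℝ) : ℂ) • g ((2 * Real.pi) • ω)) ∧
    (∂_{m} f : 𝓢'(E3, F)) (𝓕 ψ) = (2 * Real.pi * Complex.I) •
      ∫ ω, ψ ω • ((inner ℝ ω m : ℝ) : ℂ) • g ((2 * Real.pi) • ω) := by
  have htg : (fun ω : E3 => ((inner ℝ ω m : ℝ) : ℂ)).HasTemperateGrowth :=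
    Complex.ofRealCLM.hasTemperateGrowth.comp (Function.hasTemperateGrowth_inner_left m)
  have h1 := h.2 (SchwartzMap.smulLeftCLM ℂ (fun ω : E3 => ((inner ℝ ω m : ℝ) : ℂ)) ψ)
  have e : (fun ω => (SchwartzMap.smulLeftCLM ℂ (fun ω : E3 => ((inner ℝ ω m : ℝ) : ℂ)) ψ) ω •
      g ((2 * Real.pi) • ω)) = fun ω => ψ ω • ((inner ℝ ω m : ℝ) : ℂ) • g ((2 * Real.pi) • ω) := by
    ext1 ω
    rw [SchwartzMap.smulLeftCLM_apply_apply htg, smul_smul, smul_eq_mul, mul_comm]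
  rw [e] at h1
  refine ⟨h1.1, ?_⟩
  rw [← h1.2, ← TemperedDistribution.fourier_apply, TemperedDistribution.fourier_lineDerivOp_eq]
  rfl

theorem HasFourierFn.divFree_iff {u : 𝓢'(E3, C3)} {g : E3 → C3} (h : HasFourierFn u g) :
    DivFree u ↔ ∀ᵐ ξ : E3, ∑ i, (ξ i : ℂ) * g ξ i = 0 := by
  set K : E3 → ℂ := fun ω => ∑ i, (ω i : ℂ) * g ((2 * Real.pi) • ω) i with hK
  have hint : ∀ (ψ : 𝓢(E3, ℂ)) (i : Fin 3),
      Integrable (fun ω : E3 => ψ ω * ((ω i : ℂ) * g ((2 * Real.pi) • ω) i)) := by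
    intro ψ i
    have := (EuclideanSpace.proj (𝕜 := ℂ) i).integrable_comp
      (h.lineDeriv_fourier (EuclideanSpace.single i (1 : ℝ)) ψ).1
    simpa [EuclideanSpace.inner_single_right] using this
  have key : ∀ ψ : 𝓢(E3, ℂ), ∑ i, (∂_{EuclideanSpace.single i (1 : ℝ)} u : 𝓢'(E3, C3)) (𝓕 ψ) i =
      (2 * Real.pi * Complex.I) * ∫ ω, ψ ω • K ω := by
    intro ψ
    have : (fun ω => ψ ω • K ω) = fun ω => ∑ i, ψ ω * ((ω i : ℂ) * g ((2 * Real.pi) • ω) i) := by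
      ext1 ω; rw [hK, smul_eq_mul, Finset.mul_sum]
    rw [this, integral_finsetSum _ fun i _ => hint ψ i, Finset.mul_sum]
    refine Finset.sum_congr rfl fun i _ => ?_
    have h1 := h.lineDeriv_fourier (EuclideanSpace.single i (1 : ℝ)) ψ
    rw [h1.2, PiLp.smul_apply, smul_eq_mul]
    congr 1
    have h2 := (EuclideanSpace.proj (𝕜 := ℂ) i).integral_comp_comm h1.1
    refine h2.symm.trans ?_
    simp [EuclideanSpace.inner_single_right]
  have hc : (2 * Real.pi * Complex.I) ≠ 0 := by simp [Real.pi_ne_zero]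
  have hiff : (∀ᵐ ξ : E3, ∑ i, (ξ i : ℂ) * g ξ i = 0) ↔ K =ᵐ[volume] 0 := by
    rw [← ae_dilation_iff two_pi_ne_zero]
    refine eventually_congr (Eventually.of_forall fun ω => ?_)
    have : ∑ i, (((2 * Real.pi) • ω) i : ℂ) * g ((2 * Real.pi) • ω) i = (2 * Real.pi) * K ω := by
      rw [hK, Finset.mul_sum]
      refine Finset.sum_congr rfl fun i _ => ?_
      simp; ring
    rw [this]; simp [Real.pi_ne_zero]
  rw [hiff]
  constructor
  · intro hd
    refine ae_eq_zero_of_integral_schwartz_smul_eq_zero ?_ fun ψ => ?_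
    · have hg := LocallyIntegrable.dilation h.1 two_pi_ne_zero
      refine locallyIntegrable_finsetSum _ fun i _ => ?_
      have := locallyIntegrable_clm (EuclideanSpace.proj (𝕜 := ℂ) i) hg
      exact this.continuous_mul (by fun_prop)
    · have := hd (𝓕 ψ)
      rw [key] at this
      exact (mul_eq_zero.1 this).resolve_left hc
  · intro h0 φ
    have := key (𝓕⁻ φ)
    rw [FourierTransform.fourier_fourierInv_eq] at this
    rw [this, integral_congr_ae (g := fun _ => 0) (by filter_upwards [h0] with ω hω; simp [hω])]
    simp

open ComplexConjugate in
/-- Complex conjugation of a Schwartz function. -/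
def conjSchwartz (φ : 𝓢(E3, ℂ)) : 𝓢(E3, ℂ) :=
  SchwartzMap.postcompCLM (𝕜 := ℝ) (Complex.conjCLE : ℂ →L[ℝ] ℂ) φ

open ComplexConjugate

theorem conjSchwartz_apply (φ : 𝓢(E3, ℂ)) (x : E3) : conjSchwartz φ x = conj (φ x) := rfl

theorem fourierInv_conjSchwartz (φ : 𝓢(E3, ℂ)) (ω : E3) :
    (𝓕⁻ (conjSchwartz φ)) ω = conj ((𝓕⁻ φ) (-ω)) := by
  rw [SchwartzMap.fourierInv_coe, SchwartzMap.fourierInv_coe, Real.fourierInv_eq',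
    Real.fourierInv_eq', ← integral_conj]
  refine integral_congr_ae (Eventually.of_forall fun x => ?_)
  simp only [conjSchwartz_apply, smul_eq_mul, map_mul, ← Complex.exp_conj, inner_neg_right]
  congr 2
  simp only [Complex.conj_ofReal, Complex.conj_I]
  push_cast
  ring

theorem fourier_conjSchwartz (φ : 𝓢(E3, ℂ)) (ω : E3) :
    (𝓕 (conjSchwartz φ)) ω = conj ((𝓕 φ) (-ω)) := by
  rw [SchwartzMap.fourier_coe, SchwartzMap.fourier_coe, Real.fourier_eq',
    Real.fourier_eq', ← integral_conj]
  refine integral_congr_ae (Eventually.of_forall fun x => ?_)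
  simp only [conjSchwartz_apply, smul_eq_mul, map_mul, ← Complex.exp_conj, inner_neg_right]
  congr 2
  simp only [Complex.conj_ofReal, Complex.conj_I]
  push_cast
  ring

theorem eq_of_forall_schwartz_apply {f : 𝓢'(E3, F)} {l : F →L[ℂ] ℂ}
    (h : ∀ φ : 𝓢(E3, ℂ), (∀ x, (φ x).im = 0) → (l (f φ)).im = 0) (χ : 𝓢(E3, ℂ)) :
    l (f (conjSchwartz χ)) = conj (l (f χ)) := by
  set χ₁ := (1 / 2 : ℂ) • (χ + conjSchwartz χ) with h₁
  set χ₂ := (1 / (2 * Complex.I) : ℂ) • (χ - conjSchwartz χ) with h₂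
  have r₁ : (l (f χ₁)).im = 0 := by
    refine h χ₁ fun x => ?_
    rw [h₁]
    simp [conjSchwartz_apply]
  have r₂ : (l (f χ₂)).im = 0 := by
    refine h χ₂ fun x => ?_
    rw [h₂]
    simp [conjSchwartz_apply]
  have e₁ : χ = χ₁ + Complex.I • χ₂ := by
    ext x
    simp [h₁, h₂, conjSchwartz_apply, ← mul_assoc]
    ring
  have e₂ : conjSchwartz χ = χ₁ - Complex.I • χ₂ := by
    ext x
    simp [h₁, h₂, conjSchwartz_apply, ← mul_assoc]
    ring
  have s₁ : l (f χ) = l (f χ₁) + Complex.I * l (f χ₂) := by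
    conv_lhs => rw [e₁]
    simp
  have s₂ : l (f (conjSchwartz χ)) = l (f χ₁) - Complex.I * l (f χ₂) := by
    rw [e₂]; simp
  rw [s₁, s₂, map_add, map_mul, Complex.conj_I, Complex.conj_eq_iff_im.2 r₁,
    Complex.conj_eq_iff_im.2 r₂]
  ring

/-- A component of a distribution is real if and only if its Fourier transform is Hermitian. -/
theorem HasFourierFn.real_iff [CompleteSpace F] {f : 𝓢'(E3, F)} {g : E3 → F} (h : HasFourierFn f g)
    (l : F →L[ℂ] ℂ) :
    (∀ φ : 𝓢(E3, ℂ), (∀ x, (φ x).im = 0) → (l (f φ)).im = 0) ↔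
      ∀ᵐ ξ : E3, l (g (-ξ)) = conj (l (g ξ)) := by
  have hl : ∀ φ : 𝓢(E3, ℂ), Integrable (fun ω => φ ω • l (g ((2 * Real.pi) • ω))) ∧
      l ((𝓕 f) φ) = ∫ ω, φ ω • l (g ((2 * Real.pi) • ω)) := by
    intro φ
    have h1 := l.integrable_comp (h.2 φ).1
    have h2 := l.integral_comp_comm (h.2 φ).1
    simp only [map_smul] at h1 h2
    exact ⟨h1, by rw [h2, (h.2 φ).2]⟩
  rw [← ae_dilation_iff two_pi_ne_zero]
  constructor
  · intro hr
    have hli : LocallyIntegrable (fun ω => l (g ((2 * Real.pi) • ω))) :=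
      locallyIntegrable_clm l (LocallyIntegrable.dilation h.1 two_pi_ne_zero)
    have hli' : LocallyIntegrable (fun ω : E3 => l (g ((2 * Real.pi) • ((-1 : ℝ) • ω)))) :=
      LocallyIntegrable.dilation hli (by norm_num)
    have hli2 : LocallyIntegrable (fun ω : E3 => conj (l (g ((2 * Real.pi) • ω)))) := by
      intro x
      obtain ⟨s, hs, hi⟩ := hli x
      exact ⟨s, hs, (Complex.conjCLE : ℂ →L[ℝ] ℂ).integrable_comp hi⟩
    have := ae_eq_zero_of_integral_schwartz_smul_eq_zero (hli'.sub hli2) fun ψ => ?_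
    · filter_upwards [this] with ω hω
      simpa [sub_eq_zero] using hω
    · have i1 : Integrable fun ω : E3 => ψ ω • l (g ((2 * Real.pi) • ((-1 : ℝ) • ω))) := by
        have := (hl (SchwartzMap.compCLMOfContinuousLinearEquiv ℂ
          (LinearIsometryEquiv.neg ℝ (E := E3)).toContinuousLinearEquiv ψ)).1.comp_neg
        simpa using this
      have i2 : Integrable fun ω : E3 => conj (conj (ψ ω) • l (g ((2 * Real.pi) • ω))) := by
        exact (Complex.conjCLE : ℂ →L[ℝ] ℂ).integrable_comp (hl (conjSchwartz ψ)).1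
      have e : (fun ω => ψ ω • ((fun ω : E3 => l (g ((2 * Real.pi) • ((-1 : ℝ) • ω)))) -
          fun ω : E3 => conj (l (g ((2 * Real.pi) • ω)))) ω) = fun ω =>
          ψ ω • l (g ((2 * Real.pi) • ((-1 : ℝ) • ω))) -
            conj (conj (ψ ω) • l (g ((2 * Real.pi) • ω))) := by
        ext1 ω
        simp [mul_sub]
      rw [e, integral_sub i1 i2, integral_conj]
      have s1 : ∫ ω : E3, conj (ψ ω) • l (g ((2 * Real.pi) • ω)) =
          l (f (𝓕 (conjSchwartz ψ))) := (hl (conjSchwartz ψ)).2.symm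
      have s2 : ∫ ω : E3, ψ ω • l (g ((2 * Real.pi) • ((-1 : ℝ) • ω))) =
          l (f (conjSchwartz (𝓕 (conjSchwartz ψ)))) := by
        have e3 : conjSchwartz (𝓕 (conjSchwartz ψ)) = 𝓕 (SchwartzMap.compCLMOfContinuousLinearEquiv ℂ
          (LinearIsometryEquiv.neg ℝ (E := E3)).toContinuousLinearEquiv ψ) := by
          ext ω
          rw [conjSchwartz_apply, fourier_conjSchwartz, Complex.conj_conj]
          rw [SchwartzMap.fourier_coe, SchwartzMap.fourier_coe, Real.fourier_eq',
            Real.fourier_eq', ← integral_neg_eq_self]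
          simp
        rw [e3, ← TemperedDistribution.fourier_apply, (hl _).2, ← integral_neg_eq_self]
        simp
      rw [s1, s2, eq_of_forall_schwartz_apply hr, sub_self]
  · intro hs φ hφ
    have hφc : conjSchwartz φ = φ := by
      ext x; rw [conjSchwartz_apply]; exact Complex.conj_eq_iff_im.2 (hφ x)
    have hψ : ∀ ω, (𝓕⁻ φ) (-ω) = conj ((𝓕⁻ φ) ω) := by
      intro ω
      have := fourierInv_conjSchwartz φ ω
      rw [hφc] at this
      rw [this, Complex.conj_conj]
    have e : l (f φ) = ∫ ω, (𝓕⁻ φ) ω • l (g ((2 * Real.pi) • ω)) := by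
      rw [← (hl (𝓕⁻ φ)).2]; simp
    rw [← Complex.conj_eq_iff_im, e, ← integral_conj, ← integral_neg_eq_self]
    refine integral_congr_ae ?_
    filter_upwards [hs] with ω hω
    rw [hψ, smul_neg, hω]
    simp

/-! ### Weights: interpolation and products -/

theorem wt_mul_enorm {a σ s : ℝ} {ξ : E3} (hξ : ξ ≠ 0) :
    wt a σ s ξ * ‖ξ‖ₑ = wt a σ (s + 1) ξ := by
  have h : 0 < ‖ξ‖ := norm_pos_iff.2 hξ
  rw [wt, wt, ← ofReal_norm, ← ENNReal.ofReal_mul (by positivity), Real.rpow_add_one h.ne']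
  congr 1; ring

theorem wt_add_le {a σ r : ℝ} (ha : 0 ≤ a) (hσ : 1 ≤ σ) (hr : r ∈ Icc (0 : ℝ) 1) (x y : E3) :
    wt a σ r (x + y) ≤ wt a σ r x * wt a σ 0 y + wt a σ 0 x * wt a σ r y := by
  have hσ' : 1 / σ ∈ Icc (0 : ℝ) 1 :=
    ⟨by positivity, by rw [div_le_one (by linarith)]; exact hσ⟩
  have e : ∀ {p : ℝ}, p ∈ Icc (0 : ℝ) 1 → ‖x + y‖ ^ p ≤ ‖x‖ ^ p + ‖y‖ ^ p := fun {p} hp =>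
    (Real.rpow_le_rpow (norm_nonneg _) (norm_add_le x y) hp.1).trans
      (Real.rpow_add_le_add_rpow (norm_nonneg _) (norm_nonneg _) hp.1 hp.2)
  simp only [wt]
  rw [← ENNReal.ofReal_mul (by positivity), ← ENNReal.ofReal_mul (by positivity),
    ← ENNReal.ofReal_add (by positivity) (by positivity)]
  refine ENNReal.ofReal_le_ofReal ?_
  have h1 : Real.exp (a * ‖x + y‖ ^ (1 / σ)) ≤
      Real.exp (a * ‖x‖ ^ (1 / σ)) * Real.exp (a * ‖y‖ ^ (1 / σ)) := by
    rw [← Real.exp_add, ← mul_add]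
    exact Real.exp_le_exp.2 (mul_le_mul_of_nonneg_left (e hσ') ha)
  calc ‖x + y‖ ^ r * Real.exp (a * ‖x + y‖ ^ (1 / σ))
      ≤ (‖x‖ ^ r + ‖y‖ ^ r) * (Real.exp (a * ‖x‖ ^ (1 / σ)) * Real.exp (a * ‖y‖ ^ (1 / σ))) := by
        gcongr
        exact e hr
    _ = _ := by rw [Real.rpow_zero, Real.rpow_zero]; ring

theorem wt_interpolate {a σ s d l : ℝ} (hl : l ∈ Icc (0 : ℝ) 1) {ξ : E3} (hξ : ξ ≠ 0) :
    wt a σ (s + l * d) ξ = wt a σ s ξ ^ (1 - l) * wt a σ (s + d) ξ ^ l := by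
  have h : 0 < ‖ξ‖ := norm_pos_iff.2 hξ
  have hl' : 0 ≤ 1 - l := by linarith [hl.2]
  simp only [wt]
  rw [ENNReal.ofReal_rpow_of_nonneg (by positivity) hl',
    ENNReal.ofReal_rpow_of_nonneg (by positivity) hl.1, ← ENNReal.ofReal_mul (by positivity),
    Real.mul_rpow (by positivity) (by positivity), Real.mul_rpow (by positivity) (by positivity),
    ← Real.rpow_mul h.le, ← Real.rpow_mul h.le, ← Real.exp_mul, ← Real.exp_mul]
  congr 1
  have e1 : ‖ξ‖ ^ (s + l * d) = ‖ξ‖ ^ (s * (1 - l)) * ‖ξ‖ ^ ((s + d) * l) := by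
    rw [← Real.rpow_add h]; congr 1; ring
  have e2 : Real.exp (a * ‖ξ‖ ^ (1 / σ)) = Real.exp (a * ‖ξ‖ ^ (1 / σ) * (1 - l)) *
      Real.exp (a * ‖ξ‖ ^ (1 / σ) * l) := by
    rw [← Real.exp_add]; congr 1; ring
  rw [e1, e2]; ring

section

variable {V W : Type*} [NormedAddCommGroup V] [NormedAddCommGroup W]

theorem aemeasurable_wt_mul {a σ r : ℝ} {g : E3 → V} (hg : AEStronglyMeasurable g) :
    AEMeasurable fun ξ => wt a σ r ξ * ‖g ξ‖ₑ :=
  (measurable_wt a σ r).aemeasurable.mul hg.enorm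

/-- Interpolation between the norms of order `s` and `s + d`. -/
theorem fnorm_interpolate {a σ s d l : ℝ} (hl : l ∈ Icc (0 : ℝ) 1) {g : E3 → V}
    (hg : AEStronglyMeasurable g) :
    fnorm a σ (s + l * d) g ≤ fnorm a σ s g ^ (1 - l) * fnorm a σ (s + d) g ^ l := by
  have hl' : 0 ≤ 1 - l := by linarith [hl.2]
  refine le_trans (le_of_eq ?_) (ENNReal.lintegral_mul_norm_pow_le
    (aemeasurable_wt_mul (a := a) (σ := σ) (r := s) hg)
    (aemeasurable_wt_mul (a := a) (σ := σ) (r := s + d) hg) hl' hl.1 (by ring))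
  refine lintegral_congr_ae ?_
  filter_upwards [ae_ne_zero] with ξ hξ
  have : ‖g ξ‖ₑ = ‖g ξ‖ₑ ^ (1 - l) * ‖g ξ‖ₑ ^ l := by
    rw [← ENNReal.rpow_add_of_nonneg _ _ hl' hl.1]; simp
  rw [wt_interpolate hl hξ, ENNReal.mul_rpow_of_nonneg _ _ hl', ENNReal.mul_rpow_of_nonneg _ _ hl.1]
  conv_lhs => rw [this]
  ring

/-- The product estimate behind the bound for the transport term. -/
theorem lintegral_wt_convolution_le {a σ s : ℝ} (ha : 0 ≤ a) (hσ : 1 ≤ σ)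
    (hs : s ∈ Icc (-1 : ℝ) 0) {f : E3 → V} {g : E3 → W}
    (hf : AEStronglyMeasurable f) (hg : AEStronglyMeasurable g) :
    ∫⁻ ξ, wt a σ s ξ * ∫⁻ η, ‖ξ‖ₑ * (‖f (ξ - η)‖ₑ * ‖g η‖ₑ) ≤
      fnorm a σ (s + 1) f * fnorm a σ 0 g + fnorm a σ 0 f * fnorm a σ (s + 1) g := by
  have hs' : s + 1 ∈ Icc (0 : ℝ) 1 := ⟨by linarith [hs.1], by linarith [hs.2]⟩
  have hsub : Measure.QuasiMeasurePreserving (fun p : E3 × E3 => p.1 - p.2)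
      (volume.prod volume) volume := quasiMeasurePreserving_sub volume volume
  have m1 : ∀ r, AEMeasurable (fun p : E3 × E3 => wt a σ r (p.1 - p.2) * ‖f (p.1 - p.2)‖ₑ)
      (volume.prod volume) := fun r =>
    (aemeasurable_wt_mul (a := a) (σ := σ) (r := r) hf).comp_quasiMeasurePreserving hsub
  have m2 : ∀ r, AEMeasurable (fun p : E3 × E3 => wt a σ r p.2 * ‖g p.2‖ₑ)
      (volume.prod volume) := fun r => by
    have := (aemeasurable_wt_mul (a := a) (σ := σ) (r := r) hg).comp_quasiMeasurePreserving
      (Measure.quasiMeasurePreserving_snd (μ := (volume : Measure E3)) (ν := (volume : Measure E3)))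
    exact this
  have m12 : ∀ r r', AEMeasurable (fun p : E3 × E3 =>
      (wt a σ r (p.1 - p.2) * ‖f (p.1 - p.2)‖ₑ) * (wt a σ r' p.2 * ‖g p.2‖ₑ))
      (volume.prod volume) := fun r r' => (m1 r).mul (m2 r')
  have key : ∀ r r', ∫⁻ ξ, ∫⁻ η, (wt a σ r (ξ - η) * ‖f (ξ - η)‖ₑ) * (wt a σ r' η * ‖g η‖ₑ) =
      fnorm a σ r f * fnorm a σ r' g := by
    intro r r'
    rw [lintegral_lintegral_swap (m12 r r')]
    have : ∀ η, ∫⁻ ξ, (wt a σ r (ξ - η) * ‖f (ξ - η)‖ₑ) * (wt a σ r' η * ‖g η‖ₑ) =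
        fnorm a σ r f * (wt a σ r' η * ‖g η‖ₑ) := by
      intro η
      have hm : AEMeasurable (fun ξ => wt a σ r (ξ - η) * ‖f (ξ - η)‖ₑ) :=
        (aemeasurable_wt_mul (a := a) (σ := σ) (r := r) hf).comp_quasiMeasurePreserving
          (measurePreserving_sub_right volume η).quasiMeasurePreserving
      rw [lintegral_mul_const'' _ hm,
        lintegral_sub_right_eq_self (fun ξ => wt a σ r ξ * ‖f ξ‖ₑ) η]
      rfl
    simp only [this]
    rw [lintegral_const_mul'' _ (aemeasurable_wt_mul hg)]
    rfl
  rw [← key, ← key, ← lintegral_add_left' (m12 _ _).lintegral_prod_right']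
  refine lintegral_mono_ae ?_
  filter_upwards [ae_ne_zero] with ξ hξ
  have hm : AEMeasurable (fun η => (wt a σ (s + 1) (ξ - η) * ‖f (ξ - η)‖ₑ) *
      (wt a σ 0 η * ‖g η‖ₑ)) :=
    ((aemeasurable_wt_mul (a := a) (σ := σ) (r := s + 1) hf).comp_quasiMeasurePreserving
      (quasiMeasurePreserving_sub_left volume ξ)).mul (aemeasurable_wt_mul hg)
  rw [← lintegral_add_left' hm, ← lintegral_const_mul' _ _ (wt_ne_top _ _ _ _)]
  refine lintegral_mono fun η => ?_
  have := wt_add_le ha hσ hs' (ξ - η) η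
  rw [sub_add_cancel] at this
  calc wt a σ s ξ * (‖ξ‖ₑ * (‖f (ξ - η)‖ₑ * ‖g η‖ₑ))
      = wt a σ (s + 1) ξ * (‖f (ξ - η)‖ₑ * ‖g η‖ₑ) := by rw [← mul_assoc, wt_mul_enorm hξ]
    _ ≤ (wt a σ (s + 1) (ξ - η) * wt a σ 0 η + wt a σ 0 (ξ - η) * wt a σ (s + 1) η) *
        (‖f (ξ - η)‖ₑ * ‖g η‖ₑ) := by gcongr
    _ = _ := by ring

end

/-! ### Young's inequality -/

theorem young_real {p r ε : ℝ} (hp : 0 ≤ p) (hr : 0 ≤ r) (hpr : p + r < 1) (hε : 0 < ε)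
    {X Y K : ℝ} (hX : 0 ≤ X) (hY : 0 ≤ Y) (hK : 0 ≤ K) :
    K * (X ^ p * Y ^ r) ≤ ε * (X + Y) +
      (ε ^ (-(p + r))) ^ (1 / (1 - p - r)) * K ^ (1 / (1 - p - r)) := by
  have hq : 0 < 1 - p - r := by linarith
  have h := Real.geom_mean_le_arith_mean3_weighted hp hr hq.le
    (p₁ := ε * X) (p₂ := ε * Y) (p₃ := (ε ^ (-(p + r)) * K) ^ (1 / (1 - p - r)))
    (by positivity) (by positivity) (by positivity) (by ring)
  have e : (ε * X) ^ p * (ε * Y) ^ r * ((ε ^ (-(p + r)) * K) ^ (1 / (1 - p - r))) ^ (1 - p - r)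
      = K * (X ^ p * Y ^ r) := by
    rw [← Real.rpow_mul (by positivity), one_div_mul_cancel hq.ne', Real.rpow_one,
      Real.mul_rpow hε.le hX, Real.mul_rpow hε.le hY, Real.rpow_neg hε.le, Real.rpow_add hε]
    field_simp
  rw [e, Real.mul_rpow (by positivity) hK] at h
  refine h.trans ?_
  set Z := (ε ^ (-(p + r))) ^ (1 / (1 - p - r)) * K ^ (1 / (1 - p - r))
  have hZ : 0 ≤ Z := by positivity
  have a1 : p * (ε * X) ≤ ε * X := by
    have : 0 ≤ ε * X := by positivity
    nlinarith
  have a2 : r * (ε * Y) ≤ ε * Y := by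
    have : 0 ≤ ε * Y := by positivity
    nlinarith
  have a3 : (1 - p - r) * Z ≤ Z := by nlinarith
  linarith

/-- Young's inequality with a small parameter for three factors. -/
theorem young_ennreal {p r ε : ℝ} (hp : 0 ≤ p) (hr : 0 ≤ r) (hpr : p + r < 1) (hε : 0 < ε)
    (X Y K : ℝ≥0∞) (hK : K ≠ ⊤) :
    K * (X ^ p * Y ^ r) ≤ ENNReal.ofReal ε * (X + Y) +
      ENNReal.ofReal ((ε ^ (-(p + r))) ^ (1 / (1 - p - r))) * K ^ (1 / (1 - p - r)) := by
  have hε' : ENNReal.ofReal ε ≠ 0 := by simpa using hε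
  have hq : 0 < 1 - p - r := by linarith
  rcases eq_or_ne X ⊤ with rfl | hX
  · simp [ENNReal.mul_top hε']
  rcases eq_or_ne Y ⊤ with rfl | hY
  · simp [ENNReal.mul_top hε']
  lift X to NNReal using hX
  lift Y to NNReal using hY
  lift K to NNReal using hK
  have hX : 0 ≤ (X : ℝ) := X.2
  have hY : 0 ≤ (Y : ℝ) := Y.2
  have hK : 0 ≤ (K : ℝ) := K.2
  have h := young_real hp hr hpr hε hX hY hK
  have h' := ENNReal.ofReal_le_ofReal h
  rw [ENNReal.ofReal_mul (by positivity), ENNReal.ofReal_mul (by positivity),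
    ENNReal.ofReal_add (by positivity) (by positivity), ENNReal.ofReal_mul (by positivity),
    ENNReal.ofReal_mul (by positivity), ENNReal.ofReal_add (by positivity) (by positivity),
    ← ENNReal.ofReal_rpow_of_nonneg (by positivity) hp,
    ← ENNReal.ofReal_rpow_of_nonneg (by positivity) hr,
    ← ENNReal.ofReal_rpow_of_nonneg hK (by positivity)] at h'
  simpa using h'

open ComplexConjugate

/-! ### The transport term on the Fourier side -/

section Transport

variable {V : Type*} [NormedAddCommGroup V] [NormedSpace ℂ V]

/-- The Fourier transform of `u · ∇ f`, with the derivative falling on the product. -/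
def bil (U : E3 → C3) (f : E3 → V) (ξ : E3) : V :=
  (((2 * Real.pi) ^ 3)⁻¹ : ℂ) • ∫ η, (∑ j, U (ξ - η) j * (Complex.I * (ξ j : ℂ))) • f η

theorem bil_congr {U U' : E3 → C3} {f f' : E3 → V} (hU : U =ᵐ[volume] U') (hf : f =ᵐ[volume] f') :
    bil U f = bil U' f' := by
  ext1 ξ
  rw [bil, bil]
  congr 1
  refine integral_congr_ae ?_
  filter_upwards [(quasiMeasurePreserving_sub_left volume ξ).ae hU, hf] with η h1 h2
  rw [h1, h2]

theorem transport_integral_eq_bil {U : E3 → C3} (f : E3 → V)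
    (hU : ∀ᵐ ξ : E3, ∑ i, (ξ i : ℂ) * U ξ i = 0) (ξ : E3) :
    (((2 * Real.pi) ^ 3)⁻¹ : ℂ) • ∫ η, (∑ j, U (ξ - η) j * (Complex.I * (η j : ℂ))) • f η =
      bil U f ξ := by
  rw [bil]
  congr 1
  refine integral_congr_ae ?_
  filter_upwards [(quasiMeasurePreserving_sub_left volume ξ).ae hU] with η h
  congr 1
  have h' : ∑ j, U (ξ - η) j * (Complex.I * (ξ j : ℂ)) -
      ∑ j, U (ξ - η) j * (Complex.I * (η j : ℂ)) =
      Complex.I * ∑ i, (((ξ - η) i : ℝ) : ℂ) * U (ξ - η) i := by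
    rw [← Finset.sum_sub_distrib, Finset.mul_sum]
    refine Finset.sum_congr rfl fun j _ => ?_
    rw [PiLp.sub_apply]; push_cast; ring
  rw [h, mul_zero, sub_eq_zero] at h'
  exact h'.symm

theorem enorm_symbol_le (ξ : E3) (v : C3) :
    ‖∑ j, v j * (Complex.I * (ξ j : ℂ))‖ₑ ≤ ‖ξ‖ₑ * ‖v‖ₑ := by
  have : ∑ j, v j * (Complex.I * (ξ j : ℂ)) = Complex.I * ∑ j, (ξ j : ℂ) * v j := by
    rw [Finset.mul_sum]; exact Finset.sum_congr rfl fun j _ => by ring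
  rw [this, ← ofReal_norm, ← ofReal_norm, ← ofReal_norm, ← ENNReal.ofReal_mul (norm_nonneg _)]
  refine ENNReal.ofReal_le_ofReal ?_
  rw [norm_mul, Complex.norm_I, one_mul]
  exact norm_sum_mul_le ξ v

theorem enorm_two_pi_le_one : ‖(((2 * Real.pi) ^ 3)⁻¹ : ℂ)‖ₑ ≤ 1 := by
  rw [← ofReal_norm, norm_inv, norm_pow]
  refine (ENNReal.ofReal_le_ofReal ?_).trans_eq ENNReal.ofReal_one
  refine inv_le_one_of_one_le₀ (one_le_pow₀ ?_)
  simp only [Complex.norm_mul, Complex.norm_ofNat, Complex.norm_real, Real.norm_eq_abs,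
    abs_of_pos Real.pi_pos]
  linarith [Real.pi_gt_three]

theorem enorm_bil_integrand_le (U : E3 → C3) (f : E3 → V) (ξ η : E3) :
    ‖(∑ j, U (ξ - η) j * (Complex.I * (ξ j : ℂ))) • f η‖ₑ ≤
      ‖ξ‖ₑ * (‖U (ξ - η)‖ₑ * ‖f η‖ₑ) := by
  rw [enorm_smul, ← mul_assoc]
  gcongr
  exact enorm_symbol_le ξ _

theorem enorm_bil_le (U : E3 → C3) (f : E3 → V) (ξ : E3) :
    ‖bil U f ξ‖ₑ ≤ ∫⁻ η, ‖ξ‖ₑ * (‖U (ξ - η)‖ₑ * ‖f η‖ₑ) := by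
  rw [bil, enorm_smul]
  refine (mul_le_of_le_one_left' enorm_two_pi_le_one).trans ?_
  refine (enorm_integral_le_lintegral_enorm _).trans ?_
  exact lintegral_mono fun η => enorm_bil_integrand_le U f ξ η

/-- The product estimate for the transport term. -/
theorem fnorm_bil_le {a σ s : ℝ} (ha : 0 ≤ a) (hσ : 1 ≤ σ) (hs : s ∈ Icc (-1 : ℝ) 0)
    {U : E3 → C3} {f : E3 → V} (hU : AEStronglyMeasurable U) (hf : AEStronglyMeasurable f) :
    fnorm a σ s (bil U f) ≤
      fnorm a σ (s + 1) U * fnorm a σ 0 f + fnorm a σ 0 U * fnorm a σ (s + 1) f := by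
  refine le_trans ?_ (lintegral_wt_convolution_le ha hσ hs hU hf)
  exact lintegral_mono fun ξ => by gcongr; exact enorm_bil_le U f ξ

theorem aestronglyMeasurable_bil_integrand {U : E3 → C3} {f : E3 → V}
    (hU : AEStronglyMeasurable U) (hf : AEStronglyMeasurable f) (ξ : E3) :
    AEStronglyMeasurable fun η => (∑ j, U (ξ - η) j * (Complex.I * (ξ j : ℂ))) • f η := by
  have h := hU.comp_quasiMeasurePreserving (quasiMeasurePreserving_sub_left volume ξ)
  refine AEStronglyMeasurable.smul ?_ hf
  have hc : Continuous fun v : C3 => ∑ j, v j * (Complex.I * (ξ j : ℂ)) := by fun_prop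
  exact hc.comp_aestronglyMeasurable h

theorem ae_integrable_bil {a σ s : ℝ} (ha : 0 ≤ a) (hσ : 1 ≤ σ) (hs : s ∈ Icc (-1 : ℝ) 0)
    {U : E3 → C3} {f : E3 → V} (hU : AEStronglyMeasurable U) (hf : AEStronglyMeasurable f)
    (h : fnorm a σ (s + 1) U * fnorm a σ 0 f + fnorm a σ 0 U * fnorm a σ (s + 1) f < ⊤) :
    ∀ᵐ ξ : E3, Integrable fun η => (∑ j, U (ξ - η) j * (Complex.I * (ξ j : ℂ))) • f η := by
  have h1 := (lintegral_wt_convolution_le ha hσ hs hU hf).trans_lt h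
  have hsub : Measure.QuasiMeasurePreserving (fun p : E3 × E3 => p.1 - p.2)
      (volume.prod volume) volume := quasiMeasurePreserving_sub volume volume
  have m : AEMeasurable (fun p : E3 × E3 => ‖p.1‖ₑ * (‖U (p.1 - p.2)‖ₑ * ‖f p.2‖ₑ))
      (volume.prod volume) := by
    have m1 : AEMeasurable (fun p : E3 × E3 => ‖p.1‖ₑ) (volume.prod volume) :=
      measurable_fst.enorm.aemeasurable
    have m2 : AEMeasurable (fun p : E3 × E3 => ‖U (p.1 - p.2)‖ₑ) (volume.prod volume) :=
      hU.enorm.comp_quasiMeasurePreserving hsub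
    have m3 : AEMeasurable (fun p : E3 × E3 => ‖f p.2‖ₑ) (volume.prod volume) :=
      hf.enorm.comp_quasiMeasurePreserving
        (Measure.quasiMeasurePreserving_snd (μ := (volume : Measure E3)) (ν := (volume : Measure E3)))
    exact m1.mul (m2.mul m3)
  have h2 := ae_lt_top' ((measurable_wt a σ s).aemeasurable.mul m.lintegral_prod_right') h1.ne
  filter_upwards [h2, ae_ne_zero] with ξ hξ h0
  refine ⟨aestronglyMeasurable_bil_integrand hU hf ξ, ?_⟩
  rw [hasFiniteIntegral_iff_enorm]
  refine (lintegral_mono fun η => enorm_bil_integrand_le U f ξ η).trans_lt ?_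
  by_contra hc
  rw [not_lt, top_le_iff] at hc
  simp only [Pi.mul_apply, hc, ENNReal.mul_top (wt_ne_zero a σ s h0)] at hξ
  exact lt_irrefl _ hξ

theorem bil_sub {a σ s : ℝ} (ha : 0 ≤ a) (hσ : 1 ≤ σ) (hs : s ∈ Icc (-1 : ℝ) 0)
    {U U' : E3 → C3} {f f' : E3 → V} (hU : AEStronglyMeasurable U) (hf : AEStronglyMeasurable f)
    (hU' : AEStronglyMeasurable U') (hf' : AEStronglyMeasurable f')
    (hU0 : fnorm a σ 0 U < ⊤) (hU1 : fnorm a σ (s + 1) U < ⊤)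
    (hU0' : fnorm a σ 0 U' < ⊤) (hU1' : fnorm a σ (s + 1) U' < ⊤)
    (hf0 : fnorm a σ 0 f < ⊤) (hf1 : fnorm a σ (s + 1) f < ⊤)
    (hf0' : fnorm a σ 0 f' < ⊤) (hf1' : fnorm a σ (s + 1) f' < ⊤) :
    ∀ᵐ ξ : E3, bil U f ξ - bil U' f' ξ = bil (U - U') f ξ + bil U' (f - f') ξ := by
  have i1 := ae_integrable_bil ha hσ hs hU hf
    (ENNReal.add_lt_top.2 ⟨ENNReal.mul_lt_top hU1 hf0, ENNReal.mul_lt_top hU0 hf1⟩)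
  have i2 := ae_integrable_bil ha hσ hs hU' hf
    (ENNReal.add_lt_top.2 ⟨ENNReal.mul_lt_top hU1' hf0, ENNReal.mul_lt_top hU0' hf1⟩)
  have i3 := ae_integrable_bil ha hσ hs hU' hf'
    (ENNReal.add_lt_top.2 ⟨ENNReal.mul_lt_top hU1' hf0', ENNReal.mul_lt_top hU0' hf1'⟩)
  filter_upwards [i1, i2, i3] with ξ h1 h2 h3
  simp only [bil]
  rw [← smul_sub, ← smul_add]
  congr 1
  have e1 : (fun η => (∑ j, (U - U') (ξ - η) j * (Complex.I * (ξ j : ℂ))) • f η) = fun η =>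
      (∑ j, U (ξ - η) j * (Complex.I * (ξ j : ℂ))) • f η -
        (∑ j, U' (ξ - η) j * (Complex.I * (ξ j : ℂ))) • f η := by
    ext1 η
    rw [← sub_smul, ← Finset.sum_sub_distrib]
    congr 1
    exact Finset.sum_congr rfl fun j _ => by rw [Pi.sub_apply, PiLp.sub_apply]; ring
  have e2 : (fun η => (∑ j, U' (ξ - η) j * (Complex.I * (ξ j : ℂ))) • (f - f') η) = fun η =>
      (∑ j, U' (ξ - η) j * (Complex.I * (ξ j : ℂ))) • f η -
        (∑ j, U' (ξ - η) j * (Complex.I * (ξ j : ℂ))) • f' η := by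
    ext1 η
    rw [← smul_sub]; rfl
  rw [e1, e2, integral_sub h1 h2, integral_sub h2 h3]
  abel

theorem stronglyMeasurable_bil {U : ℝ → E3 → C3} {f : ℝ → E3 → V}
    (hU : StronglyMeasurable (Function.uncurry U)) (hf : StronglyMeasurable (Function.uncurry f)) :
    StronglyMeasurable (Function.uncurry fun t => bil (U t) (f t)) := by
  have hc : Continuous fun p : C3 × E3 => ∑ j, p.1 j * (Complex.I * (p.2 j : ℂ)) := by fun_prop
  have h1 : StronglyMeasurable fun p : (ℝ × E3) × E3 => U p.1.1 (p.1.2 - p.2) :=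
    hU.comp_measurable (g := fun p : (ℝ × E3) × E3 => (p.1.1, p.1.2 - p.2)) (by fun_prop)
  have h2 : StronglyMeasurable fun p : (ℝ × E3) × E3 => f p.1.1 p.2 :=
    hf.comp_measurable (g := fun p : (ℝ × E3) × E3 => (p.1.1, p.2)) (by fun_prop)
  have h3 : StronglyMeasurable fun p : (ℝ × E3) × E3 =>
      (∑ j, U p.1.1 (p.1.2 - p.2) j * (Complex.I * (p.1.2 j : ℂ))) • f p.1.1 p.2 := by
    refine StronglyMeasurable.smul ?_ h2
    exact hc.comp_stronglyMeasurable (h1.prodMk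
      (measurable_snd.comp measurable_fst).stronglyMeasurable)
  exact (h3.integral_prod_right (ν := volume)).const_smul (((2 * Real.pi) ^ 3)⁻¹ : ℂ)

theorem aestronglyMeasurable_bil {U : E3 → C3} {f : E3 → V} (hU : AEStronglyMeasurable U)
    (hf : AEStronglyMeasurable f) : AEStronglyMeasurable (bil U f) := by
  have h := stronglyMeasurable_bil (U := fun _ => hU.mk U) (f := fun _ => hf.mk f)
    (hU.stronglyMeasurable_mk.comp_measurable measurable_snd)
    (hf.stronglyMeasurable_mk.comp_measurable measurable_snd)
  rw [bil_congr hU.ae_eq_mk hf.ae_eq_mk]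
  exact (h.comp_measurable (measurable_const (a := (0 : ℝ)).prodMk measurable_id)).aestronglyMeasurable

theorem HasFourierFn.transport [CompleteSpace V] {u : 𝓢'(E3, C3)} {f : 𝓢'(E3, V)} {U : E3 → C3}
    {g : E3 → V} (hu : HasFourierFn u U) (hf : HasFourierFn f g)
    (hU : ∀ᵐ ξ : E3, ∑ i, (ξ i : ℂ) * U ξ i = 0)
    {a σ s : ℝ} (ha : 0 ≤ a) (hs : s ∈ Icc (-1 : ℝ) 0)
    (h : fnorm a σ s (bil U g) < ⊤) : HasFourierFn (transport u f) (bil U g) := by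
  have h1 := hu.fourierFn_ae_eq
  have h2 := hf.fourierFn_ae_eq
  have e : (fun ξ => (((2 * Real.pi) ^ 3)⁻¹ : ℂ) •
      ∫ η, (∑ j, fourierFn u (ξ - η) j * (Complex.I * (η j : ℂ))) • fourierFn f η) = bil U g := by
    rw [← bil_congr h1 h2]
    ext1 ξ
    refine transport_integral_eq_bil _ ?_ ξ
    filter_upwards [h1, hU] with ξ e1 e2
    rw [e1, e2]
  rw [Boussinesq.transport, e]
  exact hasFourierFn_ofFourier (exists_hasFourierFn ha hs
    (aestronglyMeasurable_bil hu.aestronglyMeasurable hf.aestronglyMeasurable) h)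

end Transport

/-! ### Hermitian symmetry -/

/-- Complex conjugation on the space of values. -/
class HasConj (V : Type*) [NormedAddCommGroup V] [NormedSpace ℂ V] where
  /-- The conjugation. -/
  cj : V → V
  cj_add : ∀ v w, cj (v + w) = cj v + cj w
  cj_smul : ∀ (z : ℂ) v, cj (z • v) = conj z • cj v
  cj_cj : ∀ v, cj (cj v) = v
  norm_cj : ∀ v, ‖cj v‖ = ‖v‖


instance : HasConj ℂ where
  cj := conj
  cj_add := map_add _
  cj_smul z v := by simp
  cj_cj := Complex.conj_conj
  norm_cj := Complex.norm_conj

instance : HasConj C3 where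
  cj v := WithLp.toLp 2 fun i => conj (v i)
  cj_add v w := by ext i; simp
  cj_smul z v := by ext i; simp
  cj_cj v := by ext i; simp
  norm_cj v := by simp [EuclideanSpace.norm_eq]

section Conj

variable {V : Type*} [NormedAddCommGroup V] [NormedSpace ℂ V] [HasConj V]

/-- Complex conjugation as a real-linear isometry. -/
def cjLIE : V ≃ₗᵢ[ℝ] V where
  toFun := HasConj.cj
  map_add' := HasConj.cj_add
  map_smul' r v := by
    have := HasConj.cj_smul (r : ℂ) v
    simpa using this
  invFun := HasConj.cj
  left_inv := HasConj.cj_cj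
  right_inv := HasConj.cj_cj
  norm_map' := HasConj.norm_cj

/-- `f (-ξ)` is the complex conjugate of `f ξ`. -/
def Herm (f : E3 → V) : Prop := ∀ ξ, f (-ξ) = HasConj.cj (f ξ)

theorem integral_cj {α : Type*} [MeasurableSpace α] (μ : Measure α) [CompleteSpace V] (f : α → V) :
    ∫ x, HasConj.cj (f x) ∂μ = HasConj.cj (∫ x, f x ∂μ) :=
  (cjLIE (V := V)).toContinuousLinearEquiv.integral_comp_comm f

theorem cj_neg (v : V) : HasConj.cj (-v) = -HasConj.cj v := map_neg (cjLIE (V := V)) v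

theorem Herm.bil [CompleteSpace V] {U : E3 → C3} {f : E3 → V} (hU : Herm U) (hf : Herm f) :
    Herm (bil U f) := by
  intro ξ
  rw [Boussinesq.bil, Boussinesq.bil, HasConj.cj_smul, ← integral_cj, ← integral_neg_eq_self]
  congr 1
  · have h2 : conj (2 : ℂ) = 2 := map_ofNat _ 2
    simp [h2]
  refine integral_congr_ae (Eventually.of_forall fun η => ?_)
  simp only
  rw [HasConj.cj_smul, hf η, map_sum]
  congr 1
  refine Finset.sum_congr rfl fun j _ => ?_
  have : U (-ξ - -η) = HasConj.cj (U (ξ - η)) := by rw [← hU]; congr 1; abel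
  rw [this]
  have e : (HasConj.cj (U (ξ - η)) : C3) j = conj (U (ξ - η) j) := rfl
  rw [e]
  simp

theorem Herm.leray {U : E3 → C3} (hU : Herm U) : Herm (fun ξ => lerayAt ξ (U ξ)) := by
  intro ξ
  ext i
  have e : ∀ (v : C3) j, (HasConj.cj v : C3) j = conj (v j) := fun _ _ => rfl
  change lerayAt (-ξ) (U (-ξ)) i = (HasConj.cj (lerayAt ξ (U ξ)) : C3) i
  have e2 := e (lerayAt ξ (U ξ)) i
  rw [hU ξ, e2, lerayAt_apply, lerayAt_apply]
  simp [e]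

theorem Herm.vert {f : E3 → ℂ} (hf : Herm f) : Herm (fun ξ => vert (f ξ)) := by
  intro ξ
  ext i
  have e : ∀ (v : C3) j, (HasConj.cj v : C3) j = conj (v j) := fun _ _ => rfl
  have e' : ∀ z : ℂ, (HasConj.cj z : ℂ) = conj z := fun _ => rfl
  change Boussinesq.vert (f (-ξ)) i = (HasConj.cj (Boussinesq.vert (f ξ)) : C3) i
  rw [hf ξ, e, e']
  fin_cases i <;> simp [Boussinesq.vert]

/-- The Hermitian part of a function. -/
def hermPart (f : E3 → V) (ξ : E3) : V := (2⁻¹ : ℂ) • (f ξ + HasConj.cj (f (-ξ)))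

theorem herm_hermPart (f : E3 → V) : Herm (hermPart f) := by
  intro ξ
  simp only [hermPart, HasConj.cj_smul, HasConj.cj_add, HasConj.cj_cj, neg_neg]
  have h2 : conj (2 : ℂ) = 2 := map_ofNat _ 2
  simp [h2, add_comm]

theorem hermPart_ae_eq {f : E3 → V} (h : ∀ᵐ ξ : E3, f (-ξ) = HasConj.cj (f ξ)) :
    hermPart f =ᵐ[volume] f := by
  filter_upwards [h] with ξ hξ
  rw [hermPart, hξ, HasConj.cj_cj, ← two_smul ℂ, smul_smul]
  norm_num

theorem Herm.hermPart_eq {f : E3 → V} (h : Herm f) : hermPart f = f := by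
  ext1 ξ
  rw [hermPart, h ξ, HasConj.cj_cj, ← two_smul ℂ, smul_smul]
  norm_num

theorem hermPart_sub (f g : E3 → V) : hermPart (f - g) = hermPart f - hermPart g := by
  ext1 ξ
  have := map_sub (cjLIE (V := V)) (f (-ξ)) (g (-ξ))
  change HasConj.cj _ = HasConj.cj _ - HasConj.cj _ at this
  simp only [hermPart, Pi.sub_apply, this]
  rw [← smul_sub]; congr 1; abel

theorem stronglyMeasurable_hermPart {f : ℝ → E3 → V}
    (hf : StronglyMeasurable (Function.uncurry f)) :
    StronglyMeasurable (Function.uncurry fun t => hermPart (f t)) := by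
  have h1 : StronglyMeasurable fun p : ℝ × E3 => f p.1 (-p.2) :=
    hf.comp_measurable (g := fun p : ℝ × E3 => (p.1, -p.2)) (by fun_prop)
  exact (hf.add ((cjLIE (V := V)).continuous.comp_stronglyMeasurable h1)).const_smul (2⁻¹ : ℂ)

theorem fnorm_hermPart_le {a σ r : ℝ} {f : E3 → V} (hf : AEStronglyMeasurable f) :
    fnorm a σ r (hermPart f) ≤ fnorm a σ r f := by
  have h2 : ∀ v : V, ‖HasConj.cj v‖ₑ = ‖v‖ₑ := fun v => by
    rw [← ofReal_norm, HasConj.norm_cj, ofReal_norm]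
  have e : ∫⁻ ξ, wt a σ r ξ * ‖f (-ξ)‖ₑ = fnorm a σ r f := by
    rw [← lintegral_neg_eq_self, fnorm]
    simp [wt]
  have h : ∀ ξ, wt a σ r ξ * ‖hermPart f ξ‖ₑ ≤
      2⁻¹ * (wt a σ r ξ * ‖f ξ‖ₑ + wt a σ r ξ * ‖f (-ξ)‖ₑ) := by
    intro ξ
    rw [hermPart, enorm_smul]
    have : ‖(2⁻¹ : ℂ)‖ₑ = 2⁻¹ := by
      rw [enorm_inv (by norm_num)]
      congr 1
      rw [← ofReal_norm]; simp
    rw [this]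
    calc wt a σ r ξ * (2⁻¹ * ‖f ξ + HasConj.cj (f (-ξ))‖ₑ)
        ≤ wt a σ r ξ * (2⁻¹ * (‖f ξ‖ₑ + ‖f (-ξ)‖ₑ)) := by
          gcongr; exact (enorm_add_le _ _).trans_eq (by rw [h2])
      _ = _ := by ring
  refine (lintegral_mono h).trans ?_
  rw [lintegral_const_mul' _ _ (by simp), lintegral_add_left' (aemeasurable_wt_mul hf), e]
  change 2⁻¹ * (fnorm a σ r f + fnorm a σ r f) ≤ fnorm a σ r f
  rw [
    ← two_mul, ← mul_assoc, ENNReal.inv_mul_cancel (by simp) (by simp), one_mul]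

end Conj

/-! ### Duhamel's formula on the Fourier side -/

section Duhamel

variable {V : Type*} [NormedAddCommGroup V] [NormedSpace ℂ V]

theorem heatSymbol_zero (γ : ℝ) (ξ : E3) : heatSymbol γ 0 ξ = 1 := by simp [heatSymbol]

theorem heatSymbol_add (γ r t : ℝ) (ξ : E3) :
    heatSymbol γ (r + t) ξ = heatSymbol γ r ξ * heatSymbol γ t ξ := by
  simp only [heatSymbol]
  rw [← Complex.ofReal_mul, ← Real.exp_add]
  congr 2; ring

theorem continuous_heatSymbol (γ : ℝ) (ξ : E3) : Continuous fun t => heatSymbol γ t ξ := by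
  unfold heatSymbol; fun_prop

/-- The forcing term of Duhamel's formula. -/
def duhInt (γ : ℝ) (G : ℝ → E3 → V) (t : ℝ) (ξ : E3) : V :=
  ∫ τ in Ioc 0 t, heatSymbol γ (t - τ) ξ • G τ ξ

/-- The solution of the fractional heat equation with initial value `w` and forcing `G`. -/
def duh (γ : ℝ) (w : E3 → V) (G : ℝ → E3 → V) (t : ℝ) (ξ : E3) : V :=
  heatSymbol γ t ξ • w ξ + duhInt γ G t ξ

theorem duh_zero (γ : ℝ) (w : E3 → V) (G : ℝ → E3 → V) : duh γ w G 0 = w := by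
  ext1 ξ; simp [duh, duhInt, heatSymbol_zero]

theorem stronglyMeasurable_duhInt (γ : ℝ) {G : ℝ → E3 → V}
    (hG : StronglyMeasurable (Function.uncurry G)) :
    StronglyMeasurable (Function.uncurry (duhInt γ G)) := by
  have h1 : StronglyMeasurable fun p : (ℝ × E3) × ℝ =>
      {p : (ℝ × E3) × ℝ | p.2 ∈ Ioc 0 p.1.1}.indicator
        (fun p => heatSymbol γ (p.1.1 - p.2) p.1.2 • G p.2 p.1.2) p := by
    refine StronglyMeasurable.indicator (StronglyMeasurable.smul ?_ ?_) ?_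
    · exact ((measurable_heatSymbol γ).comp (g := fun p : ℝ × E3 => heatSymbol γ p.1 p.2)
        (f := fun p : (ℝ × E3) × ℝ => (p.1.1 - p.2, p.1.2)) (by fun_prop)).stronglyMeasurable
    · exact hG.comp_measurable (g := fun p : (ℝ × E3) × ℝ => (p.2, p.1.2)) (by fun_prop)
    · exact (measurableSet_lt measurable_const measurable_snd).inter
        (measurableSet_le measurable_snd (measurable_fst.comp measurable_fst))
  have h2 := h1.integral_prod_right' (ν := (volume : Measure ℝ))
  refine (iff_of_eq (congrArg _ ?_)).1 h2
  ext ⟨t, ξ⟩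
  simp only [Function.uncurry, duhInt]
  rw [← integral_indicator measurableSet_Ioc]
  rfl

theorem stronglyMeasurable_duh (γ : ℝ) {w : E3 → V} {G : ℝ → E3 → V} (hw : StronglyMeasurable w)
    (hG : StronglyMeasurable (Function.uncurry G)) :
    StronglyMeasurable (Function.uncurry (duh γ w G)) :=
  ((measurable_heatSymbol γ).stronglyMeasurable.smul (hw.comp_measurable measurable_snd)).add
    (stronglyMeasurable_duhInt γ hG)

theorem StronglyMeasurable.slice {G : ℝ → E3 → V} (hG : StronglyMeasurable (Function.uncurry G))
    (t : ℝ) : StronglyMeasurable (G t) :=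
  hG.comp_measurable (measurable_const.prodMk measurable_id)

theorem StronglyMeasurable.slice' {G : ℝ → E3 → V} (hG : StronglyMeasurable (Function.uncurry G))
    (ξ : E3) : StronglyMeasurable fun t => G t ξ :=
  hG.comp_measurable (measurable_id.prodMk measurable_const)

theorem integrableOn_duhamel {γ t : ℝ} {G : ℝ → E3 → V} {ξ : E3} {A : Set ℝ} (hA : A ⊆ Iic t)
    (hAm : MeasurableSet A) (h : IntegrableOn (fun τ => G τ ξ) A) :
    IntegrableOn (fun τ => heatSymbol γ (t - τ) ξ • G τ ξ) A := by
  refine Integrable.bdd_smul h 1 ?_ ?_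
  · exact ((continuous_heatSymbol γ ξ).comp (by fun_prop)).aestronglyMeasurable
  · filter_upwards [ae_restrict_mem hAm] with τ hτ
    have h1 := enorm_heatSymbol_le_one (γ := γ) (sub_nonneg.2 (hA hτ)) ξ
    have : ‖heatSymbol γ (t - τ) ξ‖ₑ ≤ ENNReal.ofReal 1 := by simpa using h1
    rwa [← ofReal_norm, ENNReal.ofReal_le_ofReal_iff zero_le_one] at this

theorem duh_semigroup {γ t₀ t : ℝ} (h0 : 0 ≤ t₀) (ht : t₀ ≤ t) {w : E3 → V} {G : ℝ → E3 → V}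
    {ξ : E3} (h : IntegrableOn (fun τ => G τ ξ) (Ioc 0 t)) :
    duh γ w G t ξ = heatSymbol γ (t - t₀) ξ • duh γ w G t₀ ξ +
      ∫ τ in Ioc t₀ t, heatSymbol γ (t - τ) ξ • G τ ξ := by
  have i := integrableOn_duhamel (γ := γ) (t := t) Ioc_subset_Iic_self measurableSet_Ioc h
  have u : Ioc 0 t₀ ∪ Ioc t₀ t = Ioc 0 t := Ioc_union_Ioc_eq_Ioc h0 ht
  rw [duh, duh, duhInt, duhInt, ← u, setIntegral_union _ measurableSet_Ioc
    (i.mono_set (u ▸ subset_union_left)) (i.mono_set (u ▸ subset_union_right)), smul_add, smul_smul,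
    ← heatSymbol_add, sub_add_cancel, ← integral_smul, add_assoc]
  · congr 2
    refine integral_congr_ae (Eventually.of_forall fun τ => ?_)
    simp only
    rw [smul_smul, ← heatSymbol_add, sub_add_sub_cancel]
  · rw [Set.disjoint_left]
    intro x hx hx'
    exact absurd hx.2 (not_le.2 hx'.1)

/-- The heat semigroup and its dissipation balance. -/
theorem heat_balance {l τ t : ℝ} (hl : 0 ≤ l) (h : τ ≤ t) :
    ENNReal.ofReal (Real.exp (-((t - τ) * l))) +
      ENNReal.ofReal l * ∫⁻ r in Ioc τ t, ENNReal.ofReal (Real.exp (-((r - τ) * l))) = 1 := by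
  have hc : Continuous fun r => Real.exp (-((r - τ) * l)) := by fun_prop
  rw [← ofReal_integral_eq_lintegral_ofReal, ← ENNReal.ofReal_mul hl, ← ENNReal.ofReal_add
    (by positivity) (mul_nonneg hl (integral_nonneg fun _ => by positivity)),
    ← intervalIntegral.integral_of_le h, ← intervalIntegral.integral_const_mul]
  · have hd : ∀ r ∈ uIcc τ t, HasDerivAt (fun r => -Real.exp (-((r - τ) * l)))
        (l * Real.exp (-((r - τ) * l))) r := by
      intro r _
      have h1 : HasDerivAt (fun r => -((r - τ) * l)) (-(1 * l)) r :=
        (((hasDerivAt_id r).sub_const τ).mul_const l).neg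
      have := h1.exp.neg
      exact this.congr_deriv (by ring)
    rw [intervalIntegral.integral_eq_sub_of_hasDerivAt hd
      (Continuous.intervalIntegrable (by fun_prop) _ _)]
    simp
  · exact (hc.integrableOn_Icc).mono_set Ioc_subset_Icc_self
  · exact Eventually.of_forall fun _ => by positivity

/-- The pointwise energy inequality for majorants. -/
theorem majorant_energy {l t₀ t : ℝ} (hl : 0 ≤ l) (ht : t₀ ≤ t) {φ w : ℝ → ℝ≥0∞}
    (hφ : Measurable φ)
    (hw : ∀ r ∈ Icc t₀ t, w r ≤ ENNReal.ofReal (Real.exp (-((r - t₀) * l))) * w t₀ +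
      ∫⁻ τ in Ioc t₀ r, ENNReal.ofReal (Real.exp (-((r - τ) * l))) * φ τ) :
    w t + ENNReal.ofReal l * ∫⁻ r in Ioc t₀ t, w r ≤ w t₀ + ∫⁻ τ in Ioc t₀ t, φ τ := by
  have hE : Measurable fun p : ℝ × ℝ => ENNReal.ofReal (Real.exp (-((p.1 - p.2) * l))) := by
    fun_prop
  have h1 : ∫⁻ r in Ioc t₀ t, w r ≤
      (∫⁻ r in Ioc t₀ t, ENNReal.ofReal (Real.exp (-((r - t₀) * l)))) * w t₀ +
      ∫⁻ τ in Ioc t₀ t, (∫⁻ r in Ioc τ t, ENNReal.ofReal (Real.exp (-((r - τ) * l)))) * φ τ := by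
    calc ∫⁻ r in Ioc t₀ t, w r ≤ ∫⁻ r in Ioc t₀ t,
          (ENNReal.ofReal (Real.exp (-((r - t₀) * l))) * w t₀ +
            ∫⁻ τ in Ioc t₀ t, (Ici τ).indicator
              (fun r => ENNReal.ofReal (Real.exp (-((r - τ) * l))) * φ τ) r) := by
          refine setLIntegral_mono' measurableSet_Ioc fun r hr => ?_
          refine (hw r (Ioc_subset_Icc_self hr)).trans (add_le_add le_rfl ?_)
          rw [← lintegral_indicator measurableSet_Ioc, ← lintegral_indicator measurableSet_Ioc]
          refine lintegral_mono fun τ => ?_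
          by_cases hτ : τ ∈ Ioc t₀ r
          · have h2 : τ ∈ Ioc t₀ t := ⟨hτ.1, hτ.2.trans hr.2⟩
            rw [indicator_of_mem hτ, indicator_of_mem h2, indicator_of_mem (mem_Ici.2 hτ.2)]
          · rw [indicator_of_notMem hτ]; exact zero_le
      _ = _ := by
          rw [lintegral_add_left (by fun_prop), lintegral_mul_const _ (by fun_prop)]
          congr 1
          rw [lintegral_lintegral_swap]
          · refine setLIntegral_congr_fun measurableSet_Ioc fun τ hτ => ?_
            rw [lintegral_indicator measurableSet_Ici, Measure.restrict_restrict measurableSet_Ici,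
              lintegral_mul_const _ (by fun_prop)]
            congr 1
            have : (Ici τ ∩ Ioc t₀ t : Set ℝ) = Icc τ t := by
              ext x
              simp only [mem_inter_iff, mem_Ici, mem_Ioc, mem_Icc]
              exact ⟨fun h => ⟨h.1, h.2.2⟩, fun h => ⟨h.1, hτ.1.trans_le h.1, h.2⟩⟩
            rw [this]
            exact setLIntegral_congr Ioc_ae_eq_Icc.symm
          · refine Measurable.aemeasurable ?_
            have : (Function.uncurry fun r τ => (Ici τ).indicator
                (fun r => ENNReal.ofReal (Real.exp (-((r - τ) * l))) * φ τ) r) =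
                {p : ℝ × ℝ | p.2 ≤ p.1}.indicator
                  (fun p => ENNReal.ofReal (Real.exp (-((p.1 - p.2) * l))) * φ p.2) := by
              ext ⟨r, τ⟩
              simp [Function.uncurry, indicator]
            rw [this]
            exact (hE.mul (hφ.comp measurable_snd)).indicator
              (measurableSet_le measurable_snd measurable_fst)
  have hm : Measurable fun τ => ENNReal.ofReal (Real.exp (-((t - τ) * l))) * φ τ := by
    have : Measurable fun τ => ENNReal.ofReal (Real.exp (-((t - τ) * l))) := by fun_prop
    exact this.mul hφ
  calc w t + ENNReal.ofReal l * ∫⁻ r in Ioc t₀ t, w r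
      ≤ (ENNReal.ofReal (Real.exp (-((t - t₀) * l))) * w t₀ +
          ∫⁻ τ in Ioc t₀ t, ENNReal.ofReal (Real.exp (-((t - τ) * l))) * φ τ) +
        ENNReal.ofReal l *
          ((∫⁻ r in Ioc t₀ t, ENNReal.ofReal (Real.exp (-((r - t₀) * l)))) * w t₀ +
      ∫⁻ τ in Ioc t₀ t, (∫⁻ r in Ioc τ t, ENNReal.ofReal (Real.exp (-((r - τ) * l)))) * φ τ) := by
        gcongr
        exact hw t (right_mem_Icc.2 ht)
    _ = (ENNReal.ofReal (Real.exp (-((t - t₀) * l))) +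
          ENNReal.ofReal l * ∫⁻ r in Ioc t₀ t, ENNReal.ofReal (Real.exp (-((r - t₀) * l)))) * w t₀ +
        ∫⁻ τ in Ioc t₀ t, (ENNReal.ofReal (Real.exp (-((t - τ) * l))) * φ τ +
          ENNReal.ofReal l *
            ((∫⁻ r in Ioc τ t, ENNReal.ofReal (Real.exp (-((r - τ) * l)))) * φ τ)) := by
        rw [lintegral_add_left hm, lintegral_const_mul' _ _ ENNReal.ofReal_ne_top]
        ring
    _ = w t₀ + ∫⁻ τ in Ioc t₀ t, φ τ := by
        rw [heat_balance hl ht, one_mul]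
        congr 1
        refine setLIntegral_congr_fun measurableSet_Ioc fun τ hτ => ?_
        rw [← mul_assoc, ← add_mul, heat_balance hl hτ.2, one_mul]

theorem measurable_enorm_wt {a σ r : ℝ} {G : ℝ → E3 → V}
    (hG : StronglyMeasurable (Function.uncurry G)) :
    Measurable fun p : ℝ × E3 => wt a σ r p.2 * ‖G p.1 p.2‖ₑ :=
  ((measurable_wt a σ r).comp measurable_snd).mul hG.enorm

theorem measurable_fnorm {a σ r : ℝ} {G : ℝ → E3 → V}
    (hG : StronglyMeasurable (Function.uncurry G)) : Measurable fun t => fnorm a σ r (G t) :=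
  (measurable_enorm_wt hG).lintegral_prod_right'

theorem lintegral_fnorm {a σ r : ℝ} {G : ℝ → E3 → V}
    (hG : StronglyMeasurable (Function.uncurry G)) (A : Set ℝ) :
    ∫⁻ t in A, fnorm a σ r (G t) = ∫⁻ ξ, wt a σ r ξ * ∫⁻ t in A, ‖G t ξ‖ₑ := by
  simp only [fnorm]
  rw [lintegral_lintegral_swap (measurable_enorm_wt hG).aemeasurable]
  refine lintegral_congr fun ξ => ?_
  rw [lintegral_const_mul' _ _ (wt_ne_top _ _ _ _)]

theorem ae_integrableOn_of_fnorm {a σ r : ℝ} {G : ℝ → E3 → V}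
    (hG : StronglyMeasurable (Function.uncurry G)) {A : Set ℝ}
    (h : ∫⁻ t in A, fnorm a σ r (G t) < ⊤) : ∀ᵐ ξ : E3, IntegrableOn (fun t => G t ξ) A := by
  rw [lintegral_fnorm hG] at h
  have hm : Measurable fun ξ => ∫⁻ t in A, ‖G t ξ‖ₑ :=
    Measurable.lintegral_prod_left' (f := fun p : ℝ × E3 => ‖G p.1 p.2‖ₑ) hG.enorm
  filter_upwards [ae_lt_top ((measurable_wt a σ r).mul hm) h.ne, ae_ne_zero] with ξ hξ h0
  refine ⟨(StronglyMeasurable.slice' hG ξ).aestronglyMeasurable, ?_⟩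
  rw [hasFiniteIntegral_iff_enorm]
  by_contra hc
  rw [not_lt, top_le_iff] at hc
  simp only [Pi.mul_apply, hc, ENNReal.mul_top (wt_ne_zero a σ r h0)] at hξ
  exact lt_irrefl _ hξ

theorem wt_mul_dissipation {a σ s γ : ℝ} {ξ : E3} (hξ : ξ ≠ 0) :
    wt a σ s ξ * ENNReal.ofReal (‖ξ‖ ^ (2 * γ)) = wt a σ (s + 2 * γ) ξ := by
  have h : 0 < ‖ξ‖ := norm_pos_iff.2 hξ
  rw [wt, wt, ← ENNReal.ofReal_mul (by positivity), Real.rpow_add h]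
  congr 1; ring

/-- The energy inequality for the fractional heat equation. -/
theorem duh_energy {a σ s γ t₀ t : ℝ} (h0 : 0 ≤ t₀) (ht : t₀ ≤ t) {w : E3 → V} {G : ℝ → E3 → V}
    (hw : StronglyMeasurable w) (hG : StronglyMeasurable (Function.uncurry G))
    (h : ∫⁻ τ in Ioc 0 t, fnorm a σ s (G τ) < ⊤) :
    fnorm a σ s (duh γ w G t) + ∫⁻ r in Ioc t₀ t, fnorm a σ (s + 2 * γ) (duh γ w G r) ≤
      fnorm a σ s (duh γ w G t₀) + ∫⁻ τ in Ioc t₀ t, fnorm a σ s (G τ) := by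
  have hD := stronglyMeasurable_duh γ hw hG
  have hDt : Measurable fun ξ => wt a σ s ξ * ‖duh γ w G t ξ‖ₑ :=
    (measurable_wt a σ s).mul (StronglyMeasurable.slice hD t).enorm
  have hDt₀ : Measurable fun ξ => wt a σ s ξ * ‖duh γ w G t₀ ξ‖ₑ :=
    (measurable_wt a σ s).mul (StronglyMeasurable.slice hD t₀).enorm
  rw [lintegral_fnorm hD, lintegral_fnorm hG, fnorm, fnorm, ← lintegral_add_left hDt,
    ← lintegral_add_left hDt₀]
  refine lintegral_mono_ae ?_
  filter_upwards [ae_ne_zero, ae_integrableOn_of_fnorm hG h] with ξ hξ hi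
  rw [← wt_mul_dissipation hξ, mul_assoc, ← mul_add, ← mul_add]
  refine mul_le_mul' le_rfl ?_
  refine majorant_energy (l := ‖ξ‖ ^ (2 * γ)) (w := fun r => ‖duh γ w G r ξ‖ₑ)
    (φ := fun τ => ‖G τ ξ‖ₑ) (by positivity) ht (StronglyMeasurable.slice' hG ξ).enorm
    fun r hr => ?_
  rw [duh_semigroup h0 hr.1 (hi.mono_set (Ioc_subset_Ioc_right hr.2))]
  refine (enorm_add_le _ _).trans (add_le_add ?_ ?_)
  · rw [enorm_smul, enorm_heatSymbol]
  · refine (enorm_integral_le_lintegral_enorm _).trans (lintegral_mono fun τ => ?_)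
    rw [enorm_smul, enorm_heatSymbol]

theorem enorm_duh_le {γ t t' : ℝ} (ht : 0 ≤ t) (htt : t ≤ t') (w : E3 → V) (G : ℝ → E3 → V)
    (ξ : E3) : ‖duh γ w G t ξ‖ₑ ≤ ‖w ξ‖ₑ + ∫⁻ τ in Ioc 0 t', ‖G τ ξ‖ₑ := by
  refine (enorm_add_le _ _).trans (add_le_add ?_ ?_)
  · rw [enorm_smul]
    exact mul_le_of_le_one_left' (enorm_heatSymbol_le_one ht ξ)
  · refine (enorm_integral_le_lintegral_enorm _).trans ?_
    refine le_trans ?_ (lintegral_mono_set (Ioc_subset_Ioc_right htt))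
    refine setLIntegral_mono' measurableSet_Ioc fun τ hτ => ?_
    rw [enorm_smul]
    exact mul_le_of_le_one_left' (enorm_heatSymbol_le_one (sub_nonneg.2 hτ.2) ξ)

theorem continuousOn_duh {γ T : ℝ} {w : E3 → V} {G : ℝ → E3 → V} {ξ : E3}
    (h : IntegrableOn (fun τ => G τ ξ) (Ioc 0 T)) :
    ContinuousOn (fun t => duh γ w G t ξ) (Icc 0 T) := by
  have e : ∀ t, duhInt γ G t ξ =
      heatSymbol γ t ξ • ∫ τ in Ioc 0 t, heatSymbol γ (-τ) ξ • G τ ξ := by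
    intro t
    rw [duhInt, ← integral_smul]
    refine integral_congr_ae (Eventually.of_forall fun τ => ?_)
    simp only
    rw [smul_smul, ← heatSymbol_add, sub_eq_add_neg]
  have hi : IntegrableOn (fun τ => heatSymbol γ (-τ) ξ • G τ ξ) (Icc 0 T) := by
    rw [integrableOn_Icc_iff_integrableOn_Ioc]
    have h' : IntegrableOn (fun τ => G τ ξ) (Icc 0 T) := by
      rwa [integrableOn_Icc_iff_integrableOn_Ioc]
    have := h'.continuousOn_smul (f := fun τ => heatSymbol γ (-τ) ξ)
      ((continuous_heatSymbol γ ξ).comp continuous_neg).continuousOn isCompact_Icc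
    exact this.mono_set Ioc_subset_Icc_self
  simp only [duh, e]
  have hc := (continuous_heatSymbol γ ξ).continuousOn (s := Icc 0 T)
  exact (hc.smul continuousOn_const).add (hc.smul (intervalIntegral.continuousOn_primitive hi))

/-- Solutions of the fractional heat equation with integrable forcing are continuous in time. -/
theorem tendsto_fnorm_duh_sub {a σ s γ T t : ℝ} (ht : t ∈ Ico 0 T) {w : E3 → V} {G : ℝ → E3 → V}
    (hw : StronglyMeasurable w) (hG : StronglyMeasurable (Function.uncurry G))
    (hw0 : fnorm a σ s w < ⊤)
    (h : ∀ T' ∈ Ioo 0 T, ∫⁻ τ in Ioc 0 T', fnorm a σ s (G τ) < ⊤) :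
    Tendsto (fun τ => fnorm a σ s (duh γ w G τ - duh γ w G t)) (𝓝[Ico 0 T] t) (𝓝 0) := by
  obtain ⟨T', hT'⟩ := exists_between ht.2
  have hT0 : T' ∈ Ioo 0 T := ⟨ht.1.trans_lt hT'.1, hT'.2⟩
  have hev : ∀ᶠ τ in 𝓝[Ico 0 T] t, τ ∈ Icc 0 T' := by
    have h1 : ∀ᶠ τ in 𝓝[Ico 0 T] t, τ < T' := mem_nhdsWithin_of_mem_nhds (Iio_mem_nhds hT'.1)
    filter_upwards [h1, self_mem_nhdsWithin] with τ h1 h2 using ⟨h2.1, h1.le⟩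
  have hD := stronglyMeasurable_duh γ hw hG
  have hlim := tendsto_lintegral_filter_of_dominated_convergence (μ := (volume : Measure E3))
    (l := 𝓝[Ico 0 T] t) (F := fun τ ξ => wt a σ s ξ * ‖(duh γ w G τ - duh γ w G t) ξ‖ₑ)
    (f := fun _ => 0)
    (fun ξ => 2 * (wt a σ s ξ * (‖w ξ‖ₑ + ∫⁻ τ in Ioc 0 T', ‖G τ ξ‖ₑ))) ?_ ?_ ?_ ?_
  · simp only [lintegral_zero] at hlim
    exact hlim
  · refine Eventually.of_forall fun τ => (measurable_wt a σ s).mul ?_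
    exact ((StronglyMeasurable.slice hD τ).sub (StronglyMeasurable.slice hD t)).enorm
  · filter_upwards [hev] with τ hτ
    refine Eventually.of_forall fun ξ => ?_
    rw [mul_left_comm]
    gcongr
    rw [Pi.sub_apply, two_mul]
    refine enorm_sub_le.trans (add_le_add ?_ ?_)
    · exact enorm_duh_le hτ.1 hτ.2 w G ξ
    · exact enorm_duh_le ht.1 hT'.1.le w G ξ
  · rw [lintegral_const_mul' _ _ (by simp)]
    refine ENNReal.mul_ne_top (by simp) ?_
    have hwm : Measurable fun ξ => wt a σ s ξ * ‖w ξ‖ₑ := (measurable_wt a σ s).mul hw.enorm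
    simp only [mul_add]
    rw [lintegral_add_left hwm, ← lintegral_fnorm hG]
    exact (ENNReal.add_lt_top.2 ⟨hw0, h T' hT0⟩).ne
  · filter_upwards [ae_integrableOn_of_fnorm hG (h T' hT0)] with ξ hξ
    have hc := (continuousOn_duh (γ := γ) (w := w) hξ) t ⟨ht.1, hT'.1.le⟩
    have hc' : Tendsto (fun τ => duh γ w G τ ξ) (𝓝[Ico 0 T] t) (𝓝 (duh γ w G t ξ)) :=
      hc.mono_left (nhdsWithin_le_of_mem hev)
    have h2 := (hc'.sub_const (duh γ w G t ξ)).enorm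
    rw [sub_self, enorm_zero] at h2
    have h3 := ENNReal.Tendsto.const_mul (a := wt a σ s ξ) h2 (Or.inr (wt_ne_top _ _ _ _))
    rw [mul_zero] at h3
    exact h3

end Duhamel

/-! ### Duhamel's formula for distributions -/

theorem exists_lintegral_schwartz_le {a σ s : ℝ} (ha : 0 ≤ a) (hs : s ∈ Icc (-1 : ℝ) 0)
    (φ : 𝓢(E3, ℂ)) : ∃ C : ℝ≥0∞, C < ⊤ ∧ ∀ g : E3 → F,
      ∫⁻ ω, ‖φ ω • g ((2 * Real.pi) • ω)‖ₑ ≤ C * fnorm a σ s g := by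
  set m : E3 → ℂ := fun ω => ((1 + ‖ω‖ ^ 2 : ℝ) : ℂ) with hm_def
  have htg : m.HasTemperateGrowth := by
    have : (fun ω : E3 => (1 + ‖ω‖ ^ 2 : ℝ)).HasTemperateGrowth := by fun_prop
    exact Complex.ofRealCLM.hasTemperateGrowth.comp this
  set K := SchwartzMap.seminorm ℂ 0 0 (SchwartzMap.smulLeftCLM ℂ m φ)
  have hK : ∀ ω : E3, ‖φ ω‖ ≤ K * (1 + ‖ω‖ ^ 2)⁻¹ := by
    intro ω
    have h0 : (0 : ℝ) < 1 + ‖ω‖ ^ 2 := by positivity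
    have := SchwartzMap.norm_le_seminorm ℂ (SchwartzMap.smulLeftCLM ℂ m φ) ω
    rw [SchwartzMap.smulLeftCLM_apply_apply htg, smul_eq_mul, norm_mul, hm_def, Complex.norm_real,
      Real.norm_of_nonneg h0.le] at this
    rw [← div_eq_mul_inv, le_div_iff₀ h0, mul_comm]
    exact this
  have hK0 : 0 ≤ K := apply_nonneg _ _
  refine ⟨ENNReal.ofReal K * 7 * ENNReal.ofReal |((2 * Real.pi) ^ 3)⁻¹|, ?_, fun g => ?_⟩
  · exact ENNReal.mul_lt_top (ENNReal.mul_lt_top ENNReal.ofReal_lt_top (by norm_num))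
      ENNReal.ofReal_lt_top
  calc ∫⁻ ω, ‖φ ω • g ((2 * Real.pi) • ω)‖ₑ
      ≤ ∫⁻ ω : E3, ENNReal.ofReal K * 7 *
          (wt a σ s ((2 * Real.pi) • ω) * ‖g ((2 * Real.pi) • ω)‖ₑ) := by
        refine lintegral_mono_ae ?_
        filter_upwards [ae_ne_zero] with ω hω
        rw [enorm_smul]
        calc ‖φ ω‖ₑ * ‖g ((2 * Real.pi) • ω)‖ₑ
            ≤ ENNReal.ofReal K * (wt a σ s ((2 * Real.pi) • ω) * 7) *
              ‖g ((2 * Real.pi) • ω)‖ₑ := by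
              gcongr
              rw [← ofReal_norm]
              refine (ENNReal.ofReal_le_ofReal (hK ω)).trans ?_
              rw [ENNReal.ofReal_mul hK0]
              gcongr
              exact ofReal_inv_le_wt ha hs hω
          _ = _ := by ring
    _ = _ := by
        rw [lintegral_const_mul' _ _ (ENNReal.mul_ne_top ENNReal.ofReal_ne_top (by norm_num)),
          lintegral_dilation two_pi_ne_zero (fun ξ => wt a σ s ξ * ‖g ξ‖ₑ), fnorm]
        ring

theorem fnorm_duhInt_le {V : Type*} [NormedAddCommGroup V] [NormedSpace ℂ V] {a σ s γ t : ℝ}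
    (ht : 0 ≤ t) {G : ℝ → E3 → V} (hG : StronglyMeasurable (Function.uncurry G)) :
    fnorm a σ s (duhInt γ G t) ≤ ∫⁻ τ in Ioc 0 t, fnorm a σ s (G τ) := by
  rw [lintegral_fnorm hG]
  refine lintegral_mono fun ξ => ?_
  gcongr
  have := enorm_duh_le (γ := γ) ht le_rfl (fun _ => (0 : V)) G ξ
  simpa [duh] using this

/-- The distribution whose Fourier transform is the forcing term in Duhamel's formula is the
integral of the heat flows of the forcing. -/
theorem HasFourierFn.duhInt_apply [CompleteSpace F] {a σ s γ t : ℝ} (ha : 0 ≤ a)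
    (hs : s ∈ Icc (-1 : ℝ) 0) (ht : 0 ≤ t) {G : ℝ → E3 → F}
    (hG : StronglyMeasurable (Function.uncurry G))
    (hfin : ∫⁻ τ in Ioc 0 t, fnorm a σ s (G τ) < ⊤) {f : ℝ → 𝓢'(E3, F)}
    (hf : ∀ᵐ τ ∂(volume.restrict (Ioc 0 t)), HasFourierFn (f τ) (G τ)) {d : 𝓢'(E3, F)}
    (hd : HasFourierFn d (duhInt γ G t)) (φ : 𝓢(E3, ℂ)) :
    d φ = ∫ τ in (0 : ℝ)..t, Boussinesq.heat γ (t - τ) (f τ) φ := by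
  obtain ⟨C, hC, hCg⟩ := exists_lintegral_schwartz_le (F := F) (σ := σ) ha hs (𝓕⁻ φ)
  rw [hd.apply_eq, intervalIntegral.integral_of_le ht]
  set k : ℝ → E3 → F := fun τ ω => (𝓕⁻ φ) ω •
    (heatSymbol γ (t - τ) ((2 * Real.pi) • ω) • G τ ((2 * Real.pi) • ω)) with hk
  have hkm : StronglyMeasurable (Function.uncurry k) := by
    refine StronglyMeasurable.smul ?_ (StronglyMeasurable.smul ?_ ?_)
    · exact ((𝓕⁻ φ).continuous.comp continuous_snd).stronglyMeasurable
    · exact ((measurable_heatSymbol γ).comp (g := fun p : ℝ × E3 => heatSymbol γ p.1 p.2)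
        (f := fun p : ℝ × E3 => (t - p.1, (2 * Real.pi) • p.2)) (by fun_prop)).stronglyMeasurable
    · exact hG.comp_measurable (g := fun p : ℝ × E3 => (p.1, (2 * Real.pi) • p.2)) (by fun_prop)
  have hki : Integrable (Function.uncurry k) ((volume.restrict (Ioc 0 t)).prod volume) := by
    refine ⟨hkm.aestronglyMeasurable, ?_⟩
    rw [hasFiniteIntegral_iff_enorm, lintegral_prod _ hkm.enorm.aemeasurable]
    calc ∫⁻ τ in Ioc 0 t, ∫⁻ ω, ‖Function.uncurry k (τ, ω)‖ₑ
        ≤ ∫⁻ τ in Ioc 0 t, C * fnorm a σ s (G τ) := by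
          refine setLIntegral_mono' measurableSet_Ioc fun τ hτ => ?_
          refine le_trans (lintegral_mono fun ω => ?_) (hCg (G τ))
          simp only [Function.uncurry, hk, enorm_smul]
          gcongr
          exact mul_le_of_le_one_left' (enorm_heatSymbol_le_one (sub_nonneg.2 hτ.2) _)
      _ < ⊤ := by
          rw [lintegral_const_mul' _ _ hC.ne]
          exact ENNReal.mul_lt_top hC hfin
  have h1 : ∀ ω, (𝓕⁻ φ) ω • duhInt γ G t ((2 * Real.pi) • ω) = ∫ τ in Ioc 0 t, k τ ω := by
    intro ω
    rw [duhInt, ← integral_smul]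
  simp only [h1]
  rw [← integral_integral_swap hki]
  have hae : ∀ᵐ τ ∂(volume.restrict (Ioc 0 t)), fnorm a σ s (G τ) < ⊤ :=
    ae_lt_top (measurable_fnorm hG) hfin.ne
  refine integral_congr_ae ?_
  filter_upwards [hf, hae, ae_restrict_mem measurableSet_Ioc] with τ h2 h3 h4
  exact ((h2.heat ha hs h3 γ (sub_nonneg.2 h4.2)).apply_eq φ).symm

/-! ### Jointly measurable versions -/

section Version

variable {V : Type*} [NormedAddCommGroup V] [NormedSpace ℂ V] [CompleteSpace V]
  [SecondCountableTopology V]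

/-- A measurable function with values in `L¹` has a jointly measurable version. -/
theorem exists_version_of_measurable_L1 [MeasurableSpace (Lp V 1 (volume : Measure E3))]
    [BorelSpace (Lp V 1 (volume : Measure E3))] {L : ℝ → Lp V 1 (volume : Measure E3)}
    (hL : Measurable L) :
    ∃ G : ℝ → E3 → V, StronglyMeasurable (Function.uncurry G) ∧ ∀ t, G t =ᵐ[volume] L t := by
  classical
  borelize V
  have : Fact ((1 : ℝ≥0∞) ≠ ⊤) := ⟨ENNReal.one_ne_top⟩
  set d := TopologicalSpace.denseSeq (Lp V 1 (volume : Measure E3)) with hd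
  have hex : ∀ (k : ℕ) (t : ℝ), ∃ m, edist (d m) (L t) < (2⁻¹ : ℝ≥0∞) ^ k := by
    intro k t
    have := (TopologicalSpace.denseRange_denseSeq (Lp V 1 (volume : Measure E3))).exists_mem_open
      (Metric.isOpen_eball (x := L t) (ε := (2⁻¹ : ℝ≥0∞) ^ k))
      ⟨L t, Metric.mem_eball_self (ENNReal.pow_pos (by simp) k)⟩
    obtain ⟨m, hm⟩ := this
    exact ⟨m, hm⟩
  set n : ℕ → ℝ → ℕ := fun k t => Nat.find (hex k t) with hn
  have hnm : ∀ k, Measurable (n k) := fun k =>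
    measurable_find (hex k) fun m =>
      measurableSet_lt (measurable_const.edist hL) measurable_const
  set h : ℕ → ℝ × E3 → V := fun k p => d (n k p.1) p.2 with hh
  have hhm : ∀ k, StronglyMeasurable (h k) := by
    intro k
    have h1 : Measurable fun p : ℕ × E3 => d p.1 p.2 :=
      measurable_from_prod_countable_right fun m => (Lp.stronglyMeasurable (d m)).measurable
    exact (h1.comp ((hnm k).prodMap measurable_id)).stronglyMeasurable
  have hlm : StronglyMeasurable (Function.uncurry fun (t : ℝ) (ξ : E3) =>
      limUnder atTop fun k => h k (t, ξ)) := StronglyMeasurable.limUnder hhm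
  refine ⟨_, hlm, fun t => ?_⟩
  have hem : ∀ k, AEMeasurable fun ξ => edist (h k (t, ξ)) (L t ξ) := fun k =>
    (((hhm k).comp_measurable (measurable_const.prodMk measurable_id)).edist
      (Lp.stronglyMeasurable _)).aemeasurable
  have hsum : ∫⁻ ξ, ∑' k, edist (h k (t, ξ)) (L t ξ) ≠ ⊤ := by
    rw [lintegral_tsum hem]
    have : ∀ k, ∫⁻ ξ, edist (h k (t, ξ)) (L t ξ) ≤ (2⁻¹ : ℝ≥0∞) ^ k := by
      intro k
      have h2 := Nat.find_spec (hex k t)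
      rw [L1.edist_def] at h2
      exact h2.le
    refine ne_top_of_le_ne_top ?_ (ENNReal.tsum_le_tsum this)
    rw [ENNReal.tsum_geometric]
    simp
  have hm : AEMeasurable fun ξ => ∑' k, edist (h k (t, ξ)) (L t ξ) :=
    AEMeasurable.tsum hem
  filter_upwards [ae_lt_top' hm hsum] with ξ hξ
  refine Tendsto.limUnder_eq ?_
  rw [tendsto_iff_edist_tendsto_0]
  exact ENNReal.tendsto_atTop_zero_of_tsum_ne_top hξ.ne

theorem enorm_wt_smul {W : Type*} [NormedAddCommGroup W] [NormedSpace ℝ W] (a σ r : ℝ) (ξ : E3)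
    (v : W) :
    ‖(wt a σ r ξ).toReal • v‖ₑ = wt a σ r ξ * ‖v‖ₑ := by
  rw [enorm_smul, Real.enorm_of_nonneg ENNReal.toReal_nonneg,
    ENNReal.ofReal_toReal (wt_ne_top _ _ _ _)]

/-- A continuous function with values in a weighted `L¹` space has a jointly measurable version. -/
theorem exists_version {a σ s T : ℝ} {g : ℝ → E3 → V}
    (hm : ∀ t ∈ Ico 0 T, AEStronglyMeasurable (g t))
    (hfin : ∀ t ∈ Ico 0 T, fnorm a σ s (g t) < ⊤)
    (hc : ∀ t ∈ Ico 0 T, Tendsto (fun τ => fnorm a σ s (g τ - g t)) (𝓝[Ico 0 T] t) (𝓝 0)) :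
    ∃ G : ℝ → E3 → V, StronglyMeasurable (Function.uncurry G) ∧
      ∀ t ∈ Ico 0 T, G t =ᵐ[volume] g t := by
  classical
  let : MeasurableSpace (Lp V 1 (volume : Measure E3)) := borel _
  have : BorelSpace (Lp V 1 (volume : Measure E3)) := ⟨rfl⟩
  have hi : ∀ t ∈ Ico 0 T, Integrable fun ξ => (wt a σ s ξ).toReal • g t ξ := by
    intro t ht
    refine ⟨(measurable_wt a σ s).ennreal_toReal.aestronglyMeasurable.smul (hm t ht), ?_⟩
    rw [hasFiniteIntegral_iff_enorm]
    simp only [enorm_wt_smul]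
    exact hfin t ht
  set L : ℝ → Lp V 1 (volume : Measure E3) := fun t =>
    if h : t ∈ Ico 0 T then (hi t h).toL1 _ else 0 with hL
  have hLe : ∀ t ∈ Ico 0 T, L t =ᵐ[volume] fun ξ => (wt a σ s ξ).toReal • g t ξ := by
    intro t ht
    simp only [hL, dif_pos ht]
    exact (hi t ht).coeFn_toL1
  have hLc : ContinuousOn L (Ico 0 T) := by
    intro t ht
    rw [ContinuousWithinAt, tendsto_iff_edist_tendsto_0]
    refine (hc t ht).congr' ?_
    filter_upwards [self_mem_nhdsWithin] with τ hτ
    rw [L1.edist_def, fnorm]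
    refine lintegral_congr_ae ?_
    filter_upwards [hLe t ht, hLe τ hτ] with ξ h1 h2
    rw [h1, h2, edist_eq_enorm_sub, ← smul_sub, enorm_wt_smul]
    rfl
  have hLm : Measurable L := by
    have h1 := ContinuousOn.measurable_piecewise (s := Ico 0 T) hLc
      (g := fun _ => (0 : Lp V 1 (volume : Measure E3))) continuousOn_const measurableSet_Ico
    convert h1 using 1
    ext1 t
    by_cases ht : t ∈ Ico 0 T
    · rw [piecewise_eq_of_mem _ _ _ ht]
    · rw [piecewise_eq_of_notMem _ _ _ ht]; simp only [hL, dif_neg ht]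
  obtain ⟨G, hG, hGL⟩ := exists_version_of_measurable_L1 hLm
  refine ⟨fun t ξ => (wt a σ s ξ).toReal⁻¹ • G t ξ, ?_, fun t ht => ?_⟩
  · refine StronglyMeasurable.smul (f := fun p : ℝ × E3 => (wt a σ s p.2).toReal⁻¹) ?_ hG
    exact ((measurable_wt a σ s).ennreal_toReal.inv.comp measurable_snd).stronglyMeasurable
  · filter_upwards [hGL t, hLe t ht, ae_ne_zero] with ξ h1 h2 h3
    have : (wt a σ s ξ).toReal ≠ 0 :=
      ENNReal.toReal_ne_zero.2 ⟨wt_ne_zero a σ s h3, wt_ne_top _ _ _ _⟩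
    rw [h1, h2, smul_smul, inv_mul_cancel₀ this, one_smul]

end Version

/-! ### A fixed point theorem in `L¹` -/

theorem exists_fixedPoint {X E : Type*} [MeasurableSpace X] {ν : Measure X} [NormedAddCommGroup E]
    [CompleteSpace E] (Φ : (X → E) → X → E) (Q : (X → E) → Prop) (hQ : ∀ f, Q f → Q (Φ f))
    (hQi : ∀ f, Q f → Integrable f ν) {f₀ : X → E} (h0 : Q f₀)
    (hΦ : ∀ f g, Q f → Q g → ∫⁻ x, ‖Φ f x - Φ g x‖ₑ ∂ν ≤ 2⁻¹ * ∫⁻ x, ‖f x - g x‖ₑ ∂ν)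
    (hcl : ∀ (u : ℕ → X → E) (f : X → E), (∀ n, Q (u n)) → Integrable f ν →
      Tendsto (fun n => ∫⁻ x, ‖u n x - f x‖ₑ ∂ν) atTop (𝓝 0) → ∃ f', Q f' ∧ f' =ᵐ[ν] f) :
    ∃ f, Q f ∧ Φ f =ᵐ[ν] f := by
  set u : ℕ → X → E := fun n => Φ^[n] f₀ with hu
  have hus : ∀ n, u (n + 1) = Φ (u n) := fun n => Function.iterate_succ_apply' Φ n f₀
  have huQ : ∀ n, Q (u n) := by
    intro n
    induction n with
    | zero => exact h0
    | succ n ih => rw [hus]; exact hQ _ ih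
  have hdist : ∀ {f g : X → E} (hf : Integrable f ν) (hg : Integrable g ν),
      edist (hf.toL1 f) (hg.toL1 g) = ∫⁻ x, ‖f x - g x‖ₑ ∂ν := by
    intro f g hf hg
    rw [L1.edist_def]
    refine lintegral_congr_ae ?_
    filter_upwards [hf.coeFn_toL1, hg.coeFn_toL1] with x h1 h2
    rw [h1, h2, edist_eq_enorm_sub]
  set v : ℕ → Lp E 1 ν := fun n => (hQi _ (huQ n)).toL1 (u n) with hv
  have hgeo : ∀ n, edist (v n) (v (n + 1)) ≤ edist (v 0) (v 1) * 2⁻¹ ^ n := by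
    intro n
    induction n with
    | zero => simp
    | succ n ih =>
      have h1 : edist (v (n + 1)) (v (n + 2)) ≤ 2⁻¹ * edist (v n) (v (n + 1)) := by
        rw [hdist, hdist]
        have h2 := hΦ (u n) (u (n + 1)) (huQ n) (huQ (n + 1))
        rw [← hus, ← hus] at h2
        exact h2
      refine h1.trans ((mul_le_mul' le_rfl ih).trans_eq ?_)
      rw [pow_succ]; ring
  have hcau : CauchySeq v := cauchySeq_of_edist_le_geometric 2⁻¹ (edist (v 0) (v 1)) (by simp)
    (edist_ne_top _ _) hgeo
  obtain ⟨L, hL⟩ := cauchySeq_tendsto_of_complete hcau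
  have hLi : Integrable (L : X → E) ν := L1.integrable_coeFn L
  have hlim : Tendsto (fun n => ∫⁻ x, ‖u n x - L x‖ₑ ∂ν) atTop (𝓝 0) := by
    rw [tendsto_iff_edist_tendsto_0] at hL
    refine hL.congr fun n => ?_
    rw [← Integrable.toL1_coeFn L hLi, hdist]
    simp
  obtain ⟨f, hf, hfL⟩ := hcl u L huQ hLi hlim
  have hlim' : Tendsto (fun n => ∫⁻ x, ‖u n x - f x‖ₑ ∂ν) atTop (𝓝 0) := by
    refine hlim.congr fun n => lintegral_congr_ae ?_
    filter_upwards [hfL] with x hx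
    rw [hx]
  refine ⟨f, hf, ?_⟩
  have hz : ∫⁻ x, ‖Φ f x - f x‖ₑ ∂ν = 0 := by
    have hb : ∀ n, ∫⁻ x, ‖Φ f x - f x‖ₑ ∂ν ≤
        2⁻¹ * ∫⁻ x, ‖u n x - f x‖ₑ ∂ν + ∫⁻ x, ‖u (n + 1) x - f x‖ₑ ∂ν := by
      intro n
      have h1 := hΦ f (u n) hf (huQ n)
      rw [← hus] at h1
      have h2 : ∫⁻ x, ‖f x - u n x‖ₑ ∂ν = ∫⁻ x, ‖u n x - f x‖ₑ ∂ν :=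
        lintegral_congr fun x => enorm_sub_rev _ _
      rw [h2] at h1
      refine le_trans ?_ (add_le_add h1 le_rfl)
      have hmeas : AEMeasurable (fun x => ‖Φ f x - u (n + 1) x‖ₑ) ν :=
        ((hQi _ (hQ f hf)).1.sub (hQi _ (huQ (n + 1))).1).enorm
      rw [← lintegral_add_left' hmeas]
      refine lintegral_mono fun x => ?_
      have : Φ f x - f x = (Φ f x - u (n + 1) x) + (u (n + 1) x - f x) := by abel
      rw [this]
      exact enorm_add_le _ _
    have ht := (ENNReal.Tendsto.const_mul (a := 2⁻¹) hlim' (Or.inr (by simp))).add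
      (hlim'.comp (tendsto_add_atTop_nat 1))
    rw [mul_zero, add_zero] at ht
    exact le_antisymm (ge_of_tendsto' ht hb) zero_le
  have hfm : AEMeasurable (fun x => ‖Φ f x - f x‖ₑ) ν :=
    ((hQi _ (hQ f hf)).1.sub (hQi _ hf).1).enorm
  filter_upwards [(lintegral_eq_zero_iff' hfm).1 hz] with x hx
  simpa [sub_eq_zero] using hx

/-! ### Estimates for the nonlinear terms -/

/-- The inequalities between the parameters under which the problem is subcritical. -/
structure Subcritical (α β s : ℝ) : Prop where
  hα : 1 / 2 < α
  hβ : 1 / 2 < β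
  hs : s ∈ Icc (-1 : ℝ) 0
  h₁ : 1 / (2 * α) + -s / (2 * α) < 1
  h₂ : 1 / (2 * α) + -s / (2 * β) < 1
  h₃ : 1 / (2 * β) + -s / (2 * α) < 1

theorem Subcritical.of_q_lt {α β s : ℝ} (hα : 1 / 2 < α) (hβ : 1 / 2 < β)
    (hs : s ∈ Icc (-1 : ℝ) 0) (hq : q α β < s) : Subcritical α β s := by
  have ha : 0 < α := by linarith
  have hb : 0 < β := by linarith
  simp only [q, max_lt_iff] at hq
  obtain ⟨h1, h2, h3⟩ := hq
  rw [div_lt_iff₀ hb] at h2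
  rw [div_lt_iff₀ ha] at h3
  refine ⟨hα, hβ, hs, ?_, ?_, ?_⟩
  · rw [← add_div, div_lt_one (by positivity)]; linarith
  · rw [div_add_div _ _ (by positivity) (by positivity), div_lt_one (by positivity)]; nlinarith
  · rw [div_add_div _ _ (by positivity) (by positivity), div_lt_one (by positivity)]; nlinarith

section Estimates

variable {V W : Type*} [NormedAddCommGroup V] [NormedSpace ℂ V]
  [NormedAddCommGroup W] [NormedSpace ℂ W]

theorem fnorm_add_one_le {a σ s γ : ℝ} (hγ : 1 / 2 < γ) {f : E3 → V} (hf : AEStronglyMeasurable f) :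
    fnorm a σ (s + 1) f ≤
      fnorm a σ s f ^ (1 - 1 / (2 * γ)) * fnorm a σ (s + 2 * γ) f ^ (1 / (2 * γ)) := by
  have h := fnorm_interpolate (a := a) (σ := σ) (s := s) (d := 2 * γ) (l := 1 / (2 * γ))
    ⟨by positivity, by rw [div_le_one (by linarith)]; linarith⟩ hf
  rwa [one_div_mul_cancel (by linarith)] at h

theorem fnorm_zero_le {a σ s γ : ℝ} (hs : s ≤ 0) (hγ : 1 / 2 < γ) (h : -s / (2 * γ) ≤ 1)
    {f : E3 → V} (hf : AEStronglyMeasurable f) :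
    fnorm a σ 0 f ≤
      fnorm a σ s f ^ (1 - -s / (2 * γ)) * fnorm a σ (s + 2 * γ) f ^ (-s / (2 * γ)) := by
  have h := fnorm_interpolate (a := a) (σ := σ) (s := s) (d := 2 * γ) (l := -s / (2 * γ))
    ⟨div_nonneg (by linarith) (by linarith), h⟩ hf
  rwa [div_mul_cancel₀ _ (by linarith), add_neg_cancel] at h

theorem fnorm_add_one_lt_top {a σ s γ : ℝ} (hγ : 1 / 2 < γ) {f : E3 → V}
    (hf : AEStronglyMeasurable f) (h0 : fnorm a σ s f < ⊤) (h1 : fnorm a σ (s + 2 * γ) f < ⊤) :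
    fnorm a σ (s + 1) f < ⊤ := by
  refine (fnorm_add_one_le hγ hf).trans_lt (ENNReal.mul_lt_top ?_ ?_)
  · refine ENNReal.rpow_lt_top_of_nonneg ?_ h0.ne
    rw [sub_nonneg, div_le_one (by linarith)]; linarith
  · exact ENNReal.rpow_lt_top_of_nonneg (by positivity) h1.ne

theorem fnorm_zero_lt_top {a σ s γ : ℝ} (hs : s ≤ 0) (hγ : 1 / 2 < γ) (h : -s / (2 * γ) ≤ 1)
    {f : E3 → V} (hf : AEStronglyMeasurable f) (h0 : fnorm a σ s f < ⊤)
    (h1 : fnorm a σ (s + 2 * γ) f < ⊤) : fnorm a σ 0 f < ⊤ := by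
  refine (fnorm_zero_le hs hγ h hf).trans_lt (ENNReal.mul_lt_top ?_ ?_)
  · exact ENNReal.rpow_lt_top_of_nonneg (by linarith) h0.ne
  · exact ENNReal.rpow_lt_top_of_nonneg (div_nonneg (by linarith) (by linarith)) h1.ne

/-- The transport term in terms of the norms that are bounded and integrable in time. -/
theorem fnorm_bil_le_interpolated {a σ s α γ : ℝ} (ha : 0 ≤ a) (hσ : 1 ≤ σ)
    (hs : s ∈ Icc (-1 : ℝ) 0) (hα : 1 / 2 < α) (hγ : 1 / 2 < γ) (h1 : -s / (2 * γ) ≤ 1)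
    (h2 : -s / (2 * α) ≤ 1) {U : E3 → C3} {f : E3 → V} (hU : AEStronglyMeasurable U)
    (hf : AEStronglyMeasurable f) :
    fnorm a σ s (bil U f) ≤
      fnorm a σ s U ^ (1 - 1 / (2 * α)) * fnorm a σ s f ^ (1 - -s / (2 * γ)) *
        (fnorm a σ (s + 2 * α) U ^ (1 / (2 * α)) * fnorm a σ (s + 2 * γ) f ^ (-s / (2 * γ))) +
      fnorm a σ s f ^ (1 - 1 / (2 * γ)) * fnorm a σ s U ^ (1 - -s / (2 * α)) *
        (fnorm a σ (s + 2 * γ) f ^ (1 / (2 * γ)) * fnorm a σ (s + 2 * α) U ^ (-s / (2 * α))) := by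
  refine (fnorm_bil_le ha hσ hs hU hf).trans (add_le_add ?_ ?_)
  · refine (mul_le_mul' (fnorm_add_one_le hα hU) (fnorm_zero_le hs.2 hγ h1 hf)).trans_eq ?_
    ring
  · refine (mul_le_mul' (fnorm_zero_le hs.2 hα h2 hU) (fnorm_add_one_le hγ hf)).trans_eq ?_
    ring

/-- The norms of `U` that are controlled by the energy inequality are bounded by `A` on `I`. -/
def Bnd (a σ s γ : ℝ) (I : Set ℝ) (A : ℝ≥0∞) (U : ℝ → E3 → V) : Prop :=
  (∀ t ∈ I, fnorm a σ s (U t) ≤ A) ∧ ∫⁻ t in I, fnorm a σ (s + 2 * γ) (U t) ≤ A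

theorem lintegral_young {I : Set ℝ} {δ κ p r : ℝ} (hδ : δ ∈ Ioc (0 : ℝ) 1)
    (hI : volume I ≤ ENNReal.ofReal δ) (hp : 0 ≤ p) (hr : 0 ≤ r) (hκ : 0 < κ) (hpr : κ ≤ 1 - p - r)
    {X Y : ℝ → ℝ≥0∞} (hX : Measurable X) (hY : Measurable Y) {A B : ℝ≥0∞}
    (hA : ∫⁻ t in I, X t ≤ A) (hB : ∫⁻ t in I, Y t ≤ B) :
    ∫⁻ t in I, A ^ (1 - p) * B ^ (1 - r) * (X t ^ p * Y t ^ r) ≤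
      ENNReal.ofReal (δ ^ κ) * A * B := by
  have h1 : ∫⁻ t in I, X t ^ p * Y t ^ r ≤ A ^ p * B ^ r * ENNReal.ofReal (δ ^ κ) := by
    have h := ENNReal.lintegral_prod_norm_pow_le (μ := volume.restrict I) Finset.univ
      (f := ![X, Y, fun _ => 1]) (p := ![p, r, 1 - p - r]) ?_ ?_ ?_
    · simp only [Fin.prod_univ_three, Matrix.cons_val_zero, Matrix.cons_val_one, Matrix.cons_val,
        ENNReal.one_rpow, mul_one, lintegral_one, Measure.restrict_apply_univ] at h
      refine h.trans ?_
      gcongr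
      refine (ENNReal.rpow_le_rpow hI (by linarith)).trans ?_
      rw [ENNReal.ofReal_rpow_of_pos hδ.1]
      exact ENNReal.ofReal_le_ofReal (Real.rpow_le_rpow_of_exponent_ge hδ.1 hδ.2 hpr)
    · intro i _
      fin_cases i
      · exact hX.aemeasurable
      · exact hY.aemeasurable
      · exact aemeasurable_const
    · simp [Fin.sum_univ_three]
    · intro i _
      fin_cases i
      · exact hp
      · exact hr
      · change 0 ≤ 1 - p - r; linarith
  have hm : Measurable fun t => X t ^ p * Y t ^ r := (hX.pow_const p).mul (hY.pow_const r)
  rw [lintegral_const_mul _ hm]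
  refine (mul_le_mul' le_rfl h1).trans_eq ?_
  have eA : A = A ^ (1 - p) * A ^ p := by
    rw [← ENNReal.rpow_add_of_nonneg _ _ (by linarith) hp]; simp
  have eB : B = B ^ (1 - r) * B ^ r := by
    rw [← ENNReal.rpow_add_of_nonneg _ _ (by linarith) hr]; simp
  conv_rhs => rw [eA, eB]
  ring

/-- The transport term is small on short time intervals. -/
theorem lintegral_fnorm_bil_le {a σ s α γ κ δ : ℝ} (ha : 0 ≤ a) (hσ : 1 ≤ σ)
    (hs : s ∈ Icc (-1 : ℝ) 0) (hα : 1 / 2 < α) (hγ : 1 / 2 < γ) (hκ : 0 < κ)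
    (h1 : κ ≤ 1 - 1 / (2 * α) - -s / (2 * γ)) (h2 : κ ≤ 1 - 1 / (2 * γ) - -s / (2 * α))
    (hδ : δ ∈ Ioc (0 : ℝ) 1) {I : Set ℝ} (hI : volume I ≤ ENNReal.ofReal δ)
    (hIm : MeasurableSet I) {A B : ℝ≥0∞}
    {U : ℝ → E3 → C3} {f : ℝ → E3 → V} (hU : StronglyMeasurable (Function.uncurry U))
    (hf : StronglyMeasurable (Function.uncurry f)) (hUA : Bnd a σ s α I A U)
    (hfB : Bnd a σ s γ I B f) :
    ∫⁻ t in I, fnorm a σ s (bil (U t) (f t)) ≤ 2 * ENNReal.ofReal (δ ^ κ) * A * B := by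
  have hp : 0 ≤ 1 / (2 * α) := by positivity
  have hp' : 0 ≤ 1 / (2 * γ) := by positivity
  have hr : 0 ≤ -s / (2 * γ) := div_nonneg (by linarith [hs.2]) (by linarith)
  have hr' : 0 ≤ -s / (2 * α) := div_nonneg (by linarith [hs.2]) (by linarith)
  have mX := measurable_fnorm (a := a) (σ := σ) (r := s + 2 * α) hU
  have mY := measurable_fnorm (a := a) (σ := σ) (r := s + 2 * γ) hf
  have e : 2 * ENNReal.ofReal (δ ^ κ) * A * B =
      ENNReal.ofReal (δ ^ κ) * A * B + ENNReal.ofReal (δ ^ κ) * B * A := by ring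
  have m1 : Measurable fun t => A ^ (1 - 1 / (2 * α)) * B ^ (1 - -s / (2 * γ)) *
      (fnorm a σ (s + 2 * α) (U t) ^ (1 / (2 * α)) *
        fnorm a σ (s + 2 * γ) (f t) ^ (-s / (2 * γ))) :=
    ((mX.pow_const _).mul (mY.pow_const _)).const_mul _
  rw [e]
  refine le_trans ?_ (add_le_add
    (lintegral_young hδ hI hp hr hκ h1 mX mY hUA.2 hfB.2)
    (lintegral_young hδ hI hp' hr' hκ h2 mY mX hfB.2 hUA.2))
  rw [← lintegral_add_left m1]
  refine setLIntegral_mono' hIm fun t ht => ?_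
  refine (fnorm_bil_le_interpolated ha hσ hs hα hγ (by linarith) (by linarith)
    (StronglyMeasurable.slice hU t).aestronglyMeasurable
    (StronglyMeasurable.slice hf t).aestronglyMeasurable).trans ?_
  have e1 := hUA.1 t ht
  have e2 := hfB.1 t ht
  have q1 : 0 ≤ 1 - 1 / (2 * α) := by linarith
  have q2 : 0 ≤ 1 - -s / (2 * γ) := by linarith
  have q3 : 0 ≤ 1 - 1 / (2 * γ) := by linarith
  have q4 : 0 ≤ 1 - -s / (2 * α) := by linarith
  gcongr

theorem fnorm_add_le {a σ r : ℝ} {f g : E3 → V} (hf : AEStronglyMeasurable f) :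
    fnorm a σ r (f + g) ≤ fnorm a σ r f + fnorm a σ r g := by
  rw [fnorm, fnorm, fnorm, ← lintegral_add_left' (aemeasurable_wt_mul hf)]
  refine lintegral_mono fun ξ => ?_
  rw [← mul_add]
  gcongr
  exact enorm_add_le _ _

theorem Bnd.add {a σ s γ : ℝ} {I : Set ℝ} {A B : ℝ≥0∞} {U U' : ℝ → E3 → V}
    (hU : StronglyMeasurable (Function.uncurry U)) (h : Bnd a σ s γ I A U)
    (h' : Bnd a σ s γ I B U') : Bnd a σ s γ I (A + B) (U + U') := by
  refine ⟨fun t ht => ?_, ?_⟩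
  · exact (fnorm_add_le (StronglyMeasurable.slice hU t).aestronglyMeasurable).trans
      (add_le_add (h.1 t ht) (h'.1 t ht))
  · refine le_trans ?_ (add_le_add h.2 h'.2)
    rw [← lintegral_add_left (measurable_fnorm hU)]
    exact lintegral_mono fun t =>
      fnorm_add_le (StronglyMeasurable.slice hU t).aestronglyMeasurable

theorem Bnd.mono {a σ s γ : ℝ} {I J : Set ℝ} {A B : ℝ≥0∞} {U : ℝ → E3 → V}
    (h : Bnd a σ s γ I A U) (hJ : J ⊆ I) (hAB : A ≤ B) : Bnd a σ s γ J B U :=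
  ⟨fun t ht => (h.1 t (hJ ht)).trans hAB, (lintegral_mono_set hJ).trans (h.2.trans hAB)⟩

theorem Bnd.congr {a σ s γ : ℝ} {I : Set ℝ} {A : ℝ≥0∞} {U U' : ℝ → E3 → V}
    (h : Bnd a σ s γ I A U) (hI : MeasurableSet I) (he : ∀ t ∈ I, U t =ᵐ[volume] U' t) :
    Bnd a σ s γ I A U' := by
  refine ⟨fun t ht => ?_, ?_⟩
  · rw [← fnorm_congr (he t ht)]; exact h.1 t ht
  · rw [← setLIntegral_congr_fun hI fun t ht => fnorm_congr (he t ht)]; exact h.2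

theorem bnd_zero (a σ s γ : ℝ) (I : Set ℝ) (A : ℝ≥0∞) : Bnd a σ s γ I A (0 : ℝ → E3 → V) := by
  have h : ∀ r, fnorm a σ r (0 : E3 → V) = 0 := fun r => by simp [fnorm]
  refine ⟨fun t _ => ?_, ?_⟩ <;> simp [h]

theorem lintegral_Ioc_of_support {a σ s T T' t : ℝ} {G : ℝ → E3 → V}
    (hsupp : ∀ t ∉ Ioc T T', ∀ ξ, G t ξ = 0) :
    ∫⁻ τ in Ioc 0 t, fnorm a σ s (G τ) ≤ ∫⁻ τ in Ioc T T', fnorm a σ s (G τ) := by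
  rw [← lintegral_indicator measurableSet_Ioc, ← lintegral_indicator measurableSet_Ioc]
  refine lintegral_mono fun τ => ?_
  by_cases h : τ ∈ Ioc T T'
  · rw [indicator_of_mem h]
    exact indicator_le_self _ _ τ
  · have : fnorm a σ s (G τ) = 0 := by simp [fnorm, hsupp τ h]
    rw [indicator_of_notMem h, indicator_apply, this]
    simp

theorem bnd_duhInt {a σ s γ T T' : ℝ} (hT : 0 ≤ T) (hTT : T ≤ T') {G : ℝ → E3 → V}
    (hG : StronglyMeasurable (Function.uncurry G)) (hsupp : ∀ t ∉ Ioc T T', ∀ ξ, G t ξ = 0)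
    (hfin : ∫⁻ τ in Ioc T T', fnorm a σ s (G τ) < ⊤) :
    Bnd a σ s γ (Ioc T T') (∫⁻ τ in Ioc T T', fnorm a σ s (G τ)) (duhInt γ G) := by
  have e : ∀ t, duh γ (fun _ => (0 : V)) G t = duhInt γ G t := fun t => by
    ext1 ξ; simp [duh]
  have hz : fnorm a σ s (duhInt γ G T) = 0 := by
    refine le_antisymm ((fnorm_duhInt_le hT hG).trans ?_) zero_le
    rw [setLIntegral_congr_fun (g := fun _ => 0) measurableSet_Ioc fun τ hτ => ?_]
    · simp
    · have : τ ∉ Ioc T T' := fun h => absurd hτ.2 (not_le.2 h.1)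
      simp [fnorm, hsupp τ this]
  have key : ∀ t, T ≤ t → fnorm a σ s (duhInt γ G t) +
      ∫⁻ r in Ioc T t, fnorm a σ (s + 2 * γ) (duhInt γ G r) ≤
        ∫⁻ τ in Ioc T t, fnorm a σ s (G τ) := by
    intro t ht
    have := duh_energy (a := a) (σ := σ) (s := s) (γ := γ) hT ht (w := fun _ => (0 : V))
      stronglyMeasurable_const hG ((lintegral_Ioc_of_support hsupp).trans_lt hfin)
    simp only [e] at this
    rwa [hz, zero_add] at this
  refine ⟨fun t ht => ?_, ?_⟩
  · exact (le_self_add.trans (key t ht.1.le)).trans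
      (lintegral_mono_set (Ioc_subset_Ioc_right ht.2))
  · exact le_add_self.trans (key T' hTT)

theorem duhInt_sub {a σ s γ t : ℝ} {G G' : ℝ → E3 → V}
    (hG : StronglyMeasurable (Function.uncurry G)) (hG' : StronglyMeasurable (Function.uncurry G'))
    (h : ∫⁻ τ in Ioc 0 t, fnorm a σ s (G τ) < ⊤) (h' : ∫⁻ τ in Ioc 0 t, fnorm a σ s (G' τ) < ⊤) :
    duhInt γ G t - duhInt γ G' t =ᵐ[volume] duhInt γ (G - G') t := by
  filter_upwards [ae_integrableOn_of_fnorm hG h, ae_integrableOn_of_fnorm hG' h'] with ξ i1 i2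
  have j1 := integrableOn_duhamel (γ := γ) (t := t) Ioc_subset_Iic_self measurableSet_Ioc i1
  have j2 := integrableOn_duhamel (γ := γ) (t := t) Ioc_subset_Iic_self measurableSet_Ioc i2
  rw [Pi.sub_apply, duhInt, duhInt, duhInt, ← integral_sub j1 j2]
  refine integral_congr_ae (Eventually.of_forall fun τ => ?_)
  simp only [Pi.sub_apply, smul_sub]

end Estimates

/-! ### Local existence -/

section Local

instance {V W : Type*} [NormedAddCommGroup V] [NormedSpace ℂ V] [NormedAddCommGroup W]
    [NormedSpace ℂ W] [HasConj V] [HasConj W] : HasConj (V × W) where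
  cj p := (HasConj.cj p.1, HasConj.cj p.2)
  cj_add p q := Prod.ext (HasConj.cj_add _ _) (HasConj.cj_add _ _)
  cj_smul z p := Prod.ext (HasConj.cj_smul _ _) (HasConj.cj_smul _ _)
  cj_cj p := Prod.ext (HasConj.cj_cj _) (HasConj.cj_cj _)
  norm_cj p := by simp only [Prod.norm_def, HasConj.norm_cj]

theorem conj_heatSymbol (γ t : ℝ) (ξ : E3) :
    (starRingEnd ℂ) (heatSymbol γ t ξ) = heatSymbol γ t ξ :=
  Complex.conj_ofReal _

theorem heatSymbol_neg (γ t : ℝ) (ξ : E3) : heatSymbol γ t (-ξ) = heatSymbol γ t ξ := by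
  simp [heatSymbol]

theorem Herm.duhInt {V : Type*} [NormedAddCommGroup V] [NormedSpace ℂ V] [CompleteSpace V]
    [HasConj V] {γ : ℝ} {G : ℝ → E3 → V} (h : ∀ t, Herm (G t)) (t : ℝ) :
    Herm (duhInt γ G t) := by
  intro ξ
  rw [Boussinesq.duhInt, Boussinesq.duhInt, ← integral_cj]
  refine integral_congr_ae (Eventually.of_forall fun τ => ?_)
  simp only
  rw [HasConj.cj_smul, h τ ξ, conj_heatSymbol, heatSymbol_neg]

theorem Herm.add {V : Type*} [NormedAddCommGroup V] [NormedSpace ℂ V] [HasConj V]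
    {f g : E3 → V} (hf : Herm f) (hg : Herm g) : Herm (f + g) := by
  intro ξ
  rw [Pi.add_apply, Pi.add_apply, HasConj.cj_add, hf, hg]

theorem Herm.heat {V : Type*} [NormedAddCommGroup V] [NormedSpace ℂ V] [HasConj V]
    {f : E3 → V} (hf : Herm f) (γ t : ℝ) : Herm (fun ξ => heatSymbol γ t ξ • f ξ) := by
  intro ξ
  simp only
  rw [HasConj.cj_smul, hf ξ, conj_heatSymbol, heatSymbol_neg]

/-- The nonlinear and buoyancy terms of the system on the Fourier side. -/
def force (U : E3 → C3) (Θ : E3 → ℂ) (ξ : E3) : C3 × ℂ :=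
  (-lerayAt ξ (bil U U ξ) + lerayAt ξ (vert (Θ ξ)), -bil U Θ ξ)

theorem Herm.force {U : E3 → C3} {Θ : E3 → ℂ} (hU : Herm U) (hΘ : Herm Θ) : Herm (force U Θ) := by
  intro ξ
  refine Prod.ext ?_ ?_
  · change -lerayAt (-ξ) (Boussinesq.bil U U (-ξ)) + lerayAt (-ξ) (Boussinesq.vert (Θ (-ξ))) =
      HasConj.cj (-lerayAt ξ (Boussinesq.bil U U ξ) + lerayAt ξ (Boussinesq.vert (Θ ξ)))
    rw [HasConj.cj_add, cj_neg, ← (hU.bil hU).leray ξ, ← hΘ.vert.leray ξ]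
  · change -Boussinesq.bil U Θ (-ξ) = HasConj.cj (-Boussinesq.bil U Θ ξ)
    rw [cj_neg, hU.bil hΘ ξ]

theorem force_congr {U U' : E3 → C3} {Θ Θ' : E3 → ℂ} (hU : U =ᵐ[volume] U')
    (hΘ : Θ =ᵐ[volume] Θ') : force U Θ =ᵐ[volume] force U' Θ' := by
  filter_upwards [hΘ] with ξ h
  rw [force, force, bil_congr hU hU, bil_congr hU hΘ, h]

theorem stronglyMeasurable_leray {U : ℝ → E3 → C3} (hU : StronglyMeasurable (Function.uncurry U)) :
    StronglyMeasurable (Function.uncurry fun t ξ => lerayAt ξ (U t ξ)) :=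
  (measurable_lerayAt.comp (measurable_snd.prodMk hU.measurable)).stronglyMeasurable

theorem stronglyMeasurable_force {U : ℝ → E3 → C3} {Θ : ℝ → E3 → ℂ}
    (hU : StronglyMeasurable (Function.uncurry U)) (hΘ : StronglyMeasurable (Function.uncurry Θ)) :
    StronglyMeasurable (Function.uncurry fun t => force (U t) (Θ t)) := by
  have h1 := stronglyMeasurable_leray (stronglyMeasurable_bil hU hU)
  have h2 := stronglyMeasurable_leray (U := fun t ξ => vert (Θ t ξ))
    (vert.continuous.comp_stronglyMeasurable hΘ)
  exact (h1.neg.add h2).prodMk (stronglyMeasurable_bil hU hΘ).neg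

theorem fnorm_prod_le {V W : Type*} [NormedAddCommGroup V] [NormedAddCommGroup W] {a σ r : ℝ}
    {f : E3 → V × W} (hf : AEStronglyMeasurable f) :
    fnorm a σ r f ≤ fnorm a σ r (fun ξ => (f ξ).1) + fnorm a σ r (fun ξ => (f ξ).2) := by
  rw [fnorm, fnorm, fnorm, ← lintegral_add_left' (aemeasurable_wt_mul hf.fst)]
  refine lintegral_mono fun ξ => ?_
  rw [← mul_add]
  gcongr
  rw [← ofReal_norm, ← ofReal_norm, ← ofReal_norm, ← ENNReal.ofReal_add (norm_nonneg _)
    (norm_nonneg _)]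
  refine ENNReal.ofReal_le_ofReal (max_le ?_ ?_)
  · exact le_add_of_nonneg_right (norm_nonneg _)
  · exact le_add_of_nonneg_left (norm_nonneg _)

theorem fnorm_fst_le {V W : Type*} [NormedAddCommGroup V] [NormedAddCommGroup W] {a σ r : ℝ}
    (f : E3 → V × W) : fnorm a σ r (fun ξ => (f ξ).1) ≤ fnorm a σ r f :=
  fnorm_mono_one (Eventually.of_forall fun ξ => by
    rw [← ofReal_norm, ← ofReal_norm]
    exact ENNReal.ofReal_le_ofReal (norm_fst_le _))

theorem fnorm_snd_le {V W : Type*} [NormedAddCommGroup V] [NormedAddCommGroup W] {a σ r : ℝ}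
    (f : E3 → V × W) : fnorm a σ r (fun ξ => (f ξ).2) ≤ fnorm a σ r f :=
  fnorm_mono_one (Eventually.of_forall fun ξ => by
    rw [← ofReal_norm, ← ofReal_norm]
    exact ENNReal.ofReal_le_ofReal (norm_snd_le _))

theorem ae_fnorm_lt_top {V : Type*} [NormedAddCommGroup V] [NormedSpace ℂ V] {a σ s γ : ℝ}
    {I : Set ℝ} {A : ℝ≥0∞} (hA : A < ⊤) {U : ℝ → E3 → V}
    (hU : StronglyMeasurable (Function.uncurry U)) (h : Bnd a σ s γ I A U) :
    ∀ᵐ t ∂(volume.restrict I), fnorm a σ (s + 2 * γ) (U t) < ⊤ :=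
  ae_lt_top (measurable_fnorm hU) (h.2.trans_lt hA).ne

/-- The forcing depends on the solution in a Lipschitz way, with a small constant on short time
intervals. -/
theorem lintegral_fnorm_force_sub_le {a σ s α β κ δ : ℝ} (ha : 0 ≤ a) (hσ : 1 ≤ σ)
    (hP : Subcritical α β s) (hκ : 0 < κ) (h1 : κ ≤ 1 - 1 / (2 * α) - -s / (2 * α))
    (h2 : κ ≤ 1 - 1 / (2 * α) - -s / (2 * β)) (h3 : κ ≤ 1 - 1 / (2 * β) - -s / (2 * α))
    (hδ : δ ∈ Ioc (0 : ℝ) 1) {I : Set ℝ} (hI : volume I ≤ ENNReal.ofReal δ)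
    (hIm : MeasurableSet I) {R d : ℝ≥0∞} (hR : R < ⊤)
    {U U' : ℝ → E3 → C3} {Θ Θ' : ℝ → E3 → ℂ} (hU : StronglyMeasurable (Function.uncurry U))
    (hΘ : StronglyMeasurable (Function.uncurry Θ)) (hU' : StronglyMeasurable (Function.uncurry U'))
    (hΘ' : StronglyMeasurable (Function.uncurry Θ')) (bU : Bnd a σ s α I R U)
    (bΘ : Bnd a σ s β I R Θ) (bU' : Bnd a σ s α I R U') (bΘ' : Bnd a σ s β I R Θ')
    (dU : Bnd a σ s α I d (U - U')) (dΘ : Bnd a σ s β I d (Θ - Θ')) :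
    ∫⁻ t in I, fnorm a σ s (force (U t) (Θ t) - force (U' t) (Θ' t)) ≤
      (12 * ENNReal.ofReal (δ ^ κ) * R + 2 * ENNReal.ofReal δ) * d := by
  have hs := hP.hs
  have hα := hP.hα
  have hβ := hP.hβ
  have hp : 0 < 1 / (2 * α) := by positivity
  have hp' : 0 < 1 / (2 * β) := by positivity
  have r1 : -s / (2 * α) ≤ 1 := by linarith
  have r2 : -s / (2 * β) ≤ 1 := by linarith
  have mdU : StronglyMeasurable (Function.uncurry (U - U')) := hU.sub hU'
  have mdΘ : StronglyMeasurable (Function.uncurry (Θ - Θ')) := hΘ.sub hΘ'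
  set c := ENNReal.ofReal (δ ^ κ) with hc
  have b1 : ∫⁻ t in I, fnorm a σ s (bil ((U - U') t) (U t)) ≤ 2 * c * d * R :=
    lintegral_fnorm_bil_le ha hσ hs hα hα hκ h1 h1 hδ hI hIm mdU hU dU bU
  have b2 : ∫⁻ t in I, fnorm a σ s (bil (U' t) ((U - U') t)) ≤ 2 * c * R * d :=
    lintegral_fnorm_bil_le ha hσ hs hα hα hκ h1 h1 hδ hI hIm hU' mdU bU' dU
  have b3 : ∫⁻ t in I, fnorm a σ s (bil ((U - U') t) (Θ t)) ≤ 2 * c * d * R :=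
    lintegral_fnorm_bil_le ha hσ hs hα hβ hκ h2 h3 hδ hI hIm mdU hΘ dU bΘ
  have b4 : ∫⁻ t in I, fnorm a σ s (bil (U' t) ((Θ - Θ') t)) ≤ 2 * c * R * d :=
    lintegral_fnorm_bil_le ha hσ hs hα hβ hκ h2 h3 hδ hI hIm hU' mdΘ bU' dΘ
  have b5 : ∫⁻ t in I, fnorm a σ s ((Θ - Θ') t) ≤ ENNReal.ofReal δ * d := by
    calc ∫⁻ t in I, fnorm a σ s ((Θ - Θ') t) ≤ ∫⁻ _ in I, d := setLIntegral_mono' hIm dΘ.1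
      _ = d * volume I := by simp
      _ ≤ _ := by rw [mul_comm]; gcongr
  have m1 := measurable_fnorm (a := a) (σ := σ) (r := s) (stronglyMeasurable_bil mdU hU)
  have m2 := measurable_fnorm (a := a) (σ := σ) (r := s) (stronglyMeasurable_bil hU' mdU)
  have m3 := measurable_fnorm (a := a) (σ := σ) (r := s) (stronglyMeasurable_bil mdU hΘ)
  have m4 := measurable_fnorm (a := a) (σ := σ) (r := s) (stronglyMeasurable_bil hU' mdΘ)
  have m5 := measurable_fnorm (a := a) (σ := σ) (r := s) mdΘ
  have hpt : ∀ᵐ t ∂(volume.restrict I), fnorm a σ s (force (U t) (Θ t) - force (U' t) (Θ' t)) ≤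
      2 * (fnorm a σ s (bil ((U - U') t) (U t)) + fnorm a σ s (bil (U' t) ((U - U') t)) +
        fnorm a σ s ((Θ - Θ') t)) +
      (fnorm a σ s (bil ((U - U') t) (Θ t)) + fnorm a σ s (bil (U' t) ((Θ - Θ') t))) := by
    filter_upwards [ae_restrict_mem hIm, ae_fnorm_lt_top hR hU bU, ae_fnorm_lt_top hR hΘ bΘ,
      ae_fnorm_lt_top hR hU' bU', ae_fnorm_lt_top hR hΘ' bΘ'] with t ht t1 t2 t3 t4
    have f1 := (bU.1 t ht).trans_lt hR
    have f2 := (bΘ.1 t ht).trans_lt hR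
    have f3 := (bU'.1 t ht).trans_lt hR
    have f4 := (bΘ'.1 t ht).trans_lt hR
    have n1 := (StronglyMeasurable.slice hU t).aestronglyMeasurable (μ := volume)
    have n2 := (StronglyMeasurable.slice hΘ t).aestronglyMeasurable (μ := volume)
    have n3 := (StronglyMeasurable.slice hU' t).aestronglyMeasurable (μ := volume)
    have n4 := (StronglyMeasurable.slice hΘ' t).aestronglyMeasurable (μ := volume)
    have e1 := bil_sub ha hσ hs n1 n1 n3 n3 (fnorm_zero_lt_top hs.2 hα r1 n1 f1 t1)
      (fnorm_add_one_lt_top hα n1 f1 t1) (fnorm_zero_lt_top hs.2 hα r1 n3 f3 t3)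
      (fnorm_add_one_lt_top hα n3 f3 t3) (fnorm_zero_lt_top hs.2 hα r1 n1 f1 t1)
      (fnorm_add_one_lt_top hα n1 f1 t1) (fnorm_zero_lt_top hs.2 hα r1 n3 f3 t3)
      (fnorm_add_one_lt_top hα n3 f3 t3)
    have e2 := bil_sub ha hσ hs n1 n2 n3 n4 (fnorm_zero_lt_top hs.2 hα r1 n1 f1 t1)
      (fnorm_add_one_lt_top hα n1 f1 t1) (fnorm_zero_lt_top hs.2 hα r1 n3 f3 t3)
      (fnorm_add_one_lt_top hα n3 f3 t3) (fnorm_zero_lt_top hs.2 hβ r2 n2 f2 t2)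
      (fnorm_add_one_lt_top hβ n2 f2 t2) (fnorm_zero_lt_top hs.2 hβ r2 n4 f4 t4)
      (fnorm_add_one_lt_top hβ n4 f4 t4)
    have k1 := aestronglyMeasurable_bil (n1.sub n3) n1
    have k2 := aestronglyMeasurable_bil n3 (n1.sub n3)
    have k3 := aestronglyMeasurable_bil (n1.sub n3) n2
    have hfm : AEStronglyMeasurable (force (U t) (Θ t) - force (U' t) (Θ' t)) :=
      ((StronglyMeasurable.slice (stronglyMeasurable_force hU hΘ) t).sub
        (StronglyMeasurable.slice (stronglyMeasurable_force hU' hΘ') t)).aestronglyMeasurable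
    refine (fnorm_prod_le hfm).trans (add_le_add ?_ ?_)
    · have g1 : fnorm a σ s (fun ξ => ((force (U t) (Θ t) - force (U' t) (Θ' t)) ξ).1) ≤
          2 * fnorm a σ s (bil (U t - U' t) (U t) + bil (U' t) (U t - U' t) +
            fun ξ => vert ((Θ' t - Θ t) ξ)) := by
        refine fnorm_mono 2 (by simp) ?_
        filter_upwards [e1] with ξ hξ
        have : ((force (U t) (Θ t) - force (U' t) (Θ' t)) ξ).1 =
            -lerayAt ξ ((bil (U t - U' t) (U t) + bil (U' t) (U t - U' t) +
              fun ξ => vert ((Θ' t - Θ t) ξ)) ξ) := by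
          change (-lerayAt ξ (bil (U t) (U t) ξ) + lerayAt ξ (vert (Θ t ξ))) -
            (-lerayAt ξ (bil (U' t) (U' t) ξ) + lerayAt ξ (vert (Θ' t ξ))) =
            -lerayAt ξ (bil (U t - U' t) (U t) ξ + bil (U' t) (U t - U' t) ξ +
              vert (Θ' t ξ - Θ t ξ))
          rw [← hξ, map_sub, lerayAt_add, lerayAt_sub, lerayAt_sub]
          abel
        rw [this, enorm_neg]
        exact enorm_lerayAt_le _ _
      refine g1.trans (mul_le_mul' le_rfl ?_)
      refine (fnorm_add_le (k1.add k2)).trans (add_le_add (fnorm_add_le k1) ?_)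
      refine fnorm_mono_one (Eventually.of_forall fun ξ => ?_)
      rw [enorm_vert, Pi.sub_apply, enorm_sub_rev]
      rfl
    · refine le_trans (fnorm_mono_one (h := bil (U t - U' t) (Θ t) + bil (U' t) (Θ t - Θ' t)) ?_)
        (fnorm_add_le k3)
      filter_upwards [e2] with ξ hξ
      change ‖-bil (U t) (Θ t) ξ - -bil (U' t) (Θ' t) ξ‖ₑ ≤
        ‖bil (U t - U' t) (Θ t) ξ + bil (U' t) (Θ t - Θ' t) ξ‖ₑ
      rw [← hξ, ← enorm_neg]
      refine le_of_eq (congrArg _ ?_)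
      abel
  refine (lintegral_mono_ae hpt).trans ?_
  have m12 : Measurable fun t => fnorm a σ s (bil ((U - U') t) (U t)) +
      fnorm a σ s (bil (U' t) ((U - U') t)) := m1.add m2
  have m125 : Measurable fun t => fnorm a σ s (bil ((U - U') t) (U t)) +
      fnorm a σ s (bil (U' t) ((U - U') t)) + fnorm a σ s ((Θ - Θ') t) := m12.add m5
  rw [lintegral_add_left (m125.const_mul 2), lintegral_const_mul _ m125, lintegral_add_left m12,
    lintegral_add_left m1, lintegral_add_left m3]
  calc _ ≤ 2 * (2 * c * d * R + 2 * c * R * d + ENNReal.ofReal δ * d) +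
        (2 * c * d * R + 2 * c * R * d) := by gcongr
    _ = _ := by ring

end Local

section Existence

theorem exists_time_step {κ : ℝ} (h0 : 0 < κ) (h1 : κ ≤ 1) {R : ℝ≥0∞} (hR : 1 ≤ R) (hRt : R < ⊤) :
    ∃ δ ∈ Ioc (0 : ℝ) 1, (12 * ENNReal.ofReal (δ ^ κ) * R + 2 * ENNReal.ofReal δ) * R ≤ 2⁻¹ := by
  set r := R.toReal with hr
  have hRr : R = ENNReal.ofReal r := (ENNReal.ofReal_toReal hRt.ne).symm
  have hr1 : 1 ≤ r := by
    rw [hr, ← ENNReal.toReal_one]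
    exact ENNReal.toReal_mono hRt.ne hR
  set x : ℝ := 1 / (28 * r ^ 2) with hx
  have hx0 : 0 < x := by positivity
  have hx1 : x ≤ 1 := by
    rw [hx, div_le_one (by positivity)]
    nlinarith
  have hδ0 : 0 < x ^ (1 / κ) := Real.rpow_pos_of_pos hx0 _
  have hδ1 : x ^ (1 / κ) ≤ 1 := Real.rpow_le_one hx0.le hx1 (by positivity)
  have hδx : (x ^ (1 / κ)) ^ κ = x := by
    rw [← Real.rpow_mul hx0.le, one_div_mul_cancel h0.ne', Real.rpow_one]
  have hδle : x ^ (1 / κ) ≤ x := by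
    conv_rhs => rw [← hδx]
    conv_lhs => rw [← Real.rpow_one (x ^ (1 / κ))]
    exact Real.rpow_le_rpow_of_exponent_ge hδ0 hδ1 h1
  refine ⟨x ^ (1 / κ), ⟨hδ0, hδ1⟩, ?_⟩
  rw [hδx, hRr]
  calc (12 * ENNReal.ofReal x * ENNReal.ofReal r + 2 * ENNReal.ofReal (x ^ (1 / κ))) *
        ENNReal.ofReal r
      ≤ (12 * ENNReal.ofReal x * ENNReal.ofReal r + 2 * ENNReal.ofReal x) *
        ENNReal.ofReal r := by gcongr
    _ = ENNReal.ofReal ((12 * x * r + 2 * x) * r) := by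
        rw [ENNReal.ofReal_mul (by positivity), ENNReal.ofReal_add (by positivity) (by positivity),
          ENNReal.ofReal_mul (by positivity), ENNReal.ofReal_mul (by positivity),
          ENNReal.ofReal_mul (by positivity)]
        simp
    _ ≤ ENNReal.ofReal (2⁻¹ : ℝ) := by
        refine ENNReal.ofReal_le_ofReal ?_
        have : x * r ^ 2 = 1 / 28 := by rw [hx]; field_simp
        nlinarith [mul_le_mul_of_nonneg_left hr1 (mul_nonneg hx0.le (zero_le_one.trans hr1))]
    _ = 2⁻¹ := by rw [ENNReal.ofReal_inv_of_pos (by norm_num)]; simp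

/-- Lebesgue measure on the product of a set of times and the frequency space, with a weight. -/
def spaceTime (a σ s : ℝ) (I : Set ℝ) : Measure (ℝ × E3) :=
  ((volume.restrict I).prod volume).withDensity fun p => wt a σ s p.2

theorem lintegral_spaceTime {a σ s : ℝ} {I : Set ℝ} {H : ℝ × E3 → ℝ≥0∞} (hH : Measurable H) :
    ∫⁻ p, H p ∂(spaceTime a σ s I) = ∫⁻ t in I, ∫⁻ ξ, wt a σ s ξ * H (t, ξ) := by
  have hw : Measurable fun p : ℝ × E3 => wt a σ s p.2 := (measurable_wt a σ s).comp measurable_snd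
  rw [spaceTime, lintegral_withDensity_eq_lintegral_mul _ hw hH,
    lintegral_prod _ (hw.mul hH).aemeasurable]
  rfl

theorem lintegral_enorm_spaceTime {V : Type*} [NormedAddCommGroup V] [NormedSpace ℂ V]
    {a σ s : ℝ} {I : Set ℝ} {H : ℝ × E3 → V} (hH : StronglyMeasurable H) :
    ∫⁻ p, ‖H p‖ₑ ∂(spaceTime a σ s I) = ∫⁻ t in I, fnorm a σ s (Function.curry H t) :=
  lintegral_spaceTime hH.enorm

theorem ae_ae_of_ae_spaceTime {a σ s : ℝ} {I : Set ℝ} {p : ℝ × E3 → Prop}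
    (h : ∀ᵐ x ∂(spaceTime a σ s I), p x) :
    ∀ᵐ t ∂(volume.restrict I), ∀ᵐ ξ : E3, p (t, ξ) := by
  refine Measure.ae_ae_of_ae_prod ?_
  have hw : Measurable fun p : ℝ × E3 => wt a σ s p.2 := (measurable_wt a σ s).comp measurable_snd
  refine (withDensity_absolutelyContinuous' hw.aemeasurable ?_).ae_le h
  have : ∀ᵐ x ∂((volume.restrict I).prod (volume : Measure E3)), x.2 ≠ 0 :=
    Measure.quasiMeasurePreserving_snd.ae ae_ne_zero
  filter_upwards [this] with x hx using wt_ne_zero a σ s hx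

theorem ae_mem_spaceTime (a σ s : ℝ) {I : Set ℝ} (hI : MeasurableSet I) :
    ∀ᵐ x ∂(spaceTime a σ s I), x.1 ∈ I := by
  refine (withDensity_absolutelyContinuous _ _).ae_le ?_
  exact Measure.quasiMeasurePreserving_fst.ae (ae_restrict_mem hI)

theorem bnd_duhInt_sub {V : Type*} [NormedAddCommGroup V] [NormedSpace ℂ V]
    {a σ s γ T T' : ℝ} (hT : 0 ≤ T) (hTT : T ≤ T') {G G' : ℝ → E3 → V}
    (hG : StronglyMeasurable (Function.uncurry G)) (hG' : StronglyMeasurable (Function.uncurry G'))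
    (hsupp : ∀ t ∉ Ioc T T', ∀ ξ, G t ξ = 0) (hsupp' : ∀ t ∉ Ioc T T', ∀ ξ, G' t ξ = 0)
    (hfin : ∫⁻ τ in Ioc T T', fnorm a σ s (G τ) < ⊤)
    (hfin' : ∫⁻ τ in Ioc T T', fnorm a σ s (G' τ) < ⊤) :
    Bnd a σ s γ (Ioc T T') (∫⁻ τ in Ioc T T', fnorm a σ s ((G - G') τ))
      (duhInt γ G - duhInt γ G') := by
  have hm : StronglyMeasurable (Function.uncurry (G - G')) := hG.sub hG'
  have hle : ∫⁻ τ in Ioc T T', fnorm a σ s ((G - G') τ) < ⊤ := by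
    refine lt_of_le_of_lt ?_ (ENNReal.add_lt_top.2 ⟨hfin, hfin'⟩)
    rw [← lintegral_add_left (measurable_fnorm hG)]
    refine lintegral_mono fun τ => ?_
    rw [Pi.sub_apply, sub_eq_add_neg]
    refine (fnorm_add_le (StronglyMeasurable.slice hG τ).aestronglyMeasurable).trans ?_
    refine add_le_add le_rfl (fnorm_mono_one (Eventually.of_forall fun ξ => ?_))
    rw [Pi.neg_apply, enorm_neg]
  refine (bnd_duhInt (γ := γ) hT hTT hm (fun t ht ξ => ?_) hle).congr measurableSet_Ioc
    fun t _ => ?_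
  · rw [Pi.sub_apply, Pi.sub_apply, hsupp t ht, hsupp' t ht, sub_zero]
  · exact (duhInt_sub hG hG' ((lintegral_Ioc_of_support hsupp).trans_lt hfin)
      ((lintegral_Ioc_of_support hsupp').trans_lt hfin')).symm

theorem force_zero : force 0 0 = 0 := by
  funext ξ
  have h : ∀ {W : Type} [NormedAddCommGroup W] [NormedSpace ℂ W], bil 0 (0 : E3 → W) ξ = 0 := by
    intro W _ _
    simp [bil]
  have h0 : lerayAt ξ 0 = 0 := by simpa using lerayAt_sub ξ 0 0
  refine Prod.ext ?_ ?_
  · change -lerayAt ξ (bil 0 0 ξ) + lerayAt ξ (vert 0) = 0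
    rw [h, map_zero, h0, neg_zero, add_zero]
  · change -bil 0 0 ξ = 0
    rw [h, neg_zero]

end Existence

section LocalForcing

/-- The Picard iteration for the forcing on the time interval `I`, the solution being the sum of a
given part `(W, Z)` and of the response to the forcing. -/
def picard (α β : ℝ) (I : Set ℝ) (W : ℝ → E3 → C3) (Z : ℝ → E3 → ℂ) (H : ℝ × E3 → C3 × ℂ) :
    ℝ × E3 → C3 × ℂ :=
  {p : ℝ × E3 | p.1 ∈ I}.indicator fun p =>
    force (W p.1 + duhInt α (fun t ξ => (H (t, ξ)).1) p.1)
      (Z p.1 + duhInt β (fun t ξ => (H (t, ξ)).2) p.1) p.2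

/-- The class in which the Picard iteration takes place. -/
structure PicardClass (a σ s : ℝ) (I : Set ℝ) (H : ℝ × E3 → C3 × ℂ) : Prop where
  meas : StronglyMeasurable H
  supp : ∀ t ∉ I, ∀ ξ, H (t, ξ) = 0
  herm : ∀ t, Herm fun ξ => H (t, ξ)
  le_one : ∫⁻ p, ‖H p‖ₑ ∂(spaceTime a σ s I) ≤ 1

theorem herm_zero {V : Type*} [NormedAddCommGroup V] [NormedSpace ℂ V] [HasConj V] :
    Herm (fun _ => (0 : V)) := fun _ => (map_zero (cjLIE (V := V))).symm

theorem Herm.fst {V W : Type*} [NormedAddCommGroup V] [NormedSpace ℂ V] [HasConj V]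
    [NormedAddCommGroup W] [NormedSpace ℂ W] [HasConj W] {f : E3 → V × W} (h : Herm f) :
    Herm fun ξ => (f ξ).1 := fun ξ => congrArg Prod.fst (h ξ)

theorem Herm.snd {V W : Type*} [NormedAddCommGroup V] [NormedSpace ℂ V] [HasConj V]
    [NormedAddCommGroup W] [NormedSpace ℂ W] [HasConj W] {f : E3 → V × W} (h : Herm f) :
    Herm fun ξ => (f ξ).2 := fun ξ => congrArg Prod.snd (h ξ)

theorem PicardClass.exists_of_tendsto {a σ s : ℝ} {I : Set ℝ} (hI : MeasurableSet I)
    {u : ℕ → ℝ × E3 → C3 × ℂ} {f : ℝ × E3 → C3 × ℂ} (hu : ∀ n, PicardClass a σ s I (u n))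
    (hf : Integrable f (spaceTime a σ s I))
    (h : Tendsto (fun n => ∫⁻ x, ‖u n x - f x‖ₑ ∂(spaceTime a σ s I)) atTop (𝓝 0)) :
    ∃ f', PicardClass a σ s I f' ∧ f' =ᵐ[spaceTime a σ s I] f := by
  set ν := spaceTime a σ s I with hν
  set S : Set (ℝ × E3) := {p | p.1 ∈ I} with hS
  have hSm : MeasurableSet S := measurable_fst hI
  set g : ℝ × E3 → C3 × ℂ := S.indicator (hf.aestronglyMeasurable.mk f) with hg
  have hgm : StronglyMeasurable g := hf.aestronglyMeasurable.stronglyMeasurable_mk.indicator hSm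
  have hgf : g =ᵐ[ν] f := by
    filter_upwards [ae_mem_spaceTime a σ s hI, hf.aestronglyMeasurable.ae_eq_mk] with x h1 h2
    rw [hg, indicator_of_mem (show x ∈ S from h1), ← h2]
  set k : ℝ × E3 → C3 × ℂ := fun p => hermPart (fun ξ => g (p.1, ξ)) p.2 with hk
  have hkm : StronglyMeasurable k :=
    stronglyMeasurable_hermPart (f := Function.curry g) hgm
  have hukm : ∀ n, StronglyMeasurable fun x => u n x - k x := fun n => (hu n).meas.sub hkm
  have hugm : ∀ n, StronglyMeasurable fun x => u n x - g x := fun n => (hu n).meas.sub hgm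
  have hlim : Tendsto (fun n => ∫⁻ x, ‖u n x - k x‖ₑ ∂ν) atTop (𝓝 0) := by
    refine tendsto_of_tendsto_of_tendsto_of_le_of_le tendsto_const_nhds h (fun _ => zero_le)
      fun n => ?_
    calc ∫⁻ x, ‖u n x - k x‖ₑ ∂ν
        = ∫⁻ t in I, fnorm a σ s (hermPart (fun ξ => u n (t, ξ) - g (t, ξ))) := by
          rw [lintegral_enorm_spaceTime (hukm n)]
          refine lintegral_congr fun t => congrArg _ ?_
          change (fun ξ => u n (t, ξ) - hermPart (fun ξ => g (t, ξ)) ξ) = _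
          have := hermPart_sub (fun ξ => u n (t, ξ)) (fun ξ => g (t, ξ))
          rw [((hu n).herm t).hermPart_eq] at this
          exact this.symm
      _ ≤ ∫⁻ t in I, fnorm a σ s (fun ξ => u n (t, ξ) - g (t, ξ)) := by
          refine lintegral_mono fun t => fnorm_hermPart_le ?_
          exact (StronglyMeasurable.slice (G := Function.curry fun p => u n p - g p)
            (hugm n) t).aestronglyMeasurable
      _ = ∫⁻ x, ‖u n x - g x‖ₑ ∂ν := (lintegral_enorm_spaceTime (hugm n)).symm
      _ = ∫⁻ x, ‖u n x - f x‖ₑ ∂ν := by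
          refine lintegral_congr_ae ?_
          filter_upwards [hgf] with x hx
          rw [hx]
  refine ⟨k, ⟨hkm, fun t ht ξ => ?_, fun t => herm_hermPart _, ?_⟩, ?_⟩
  · have : (fun ξ => g (t, ξ)) = fun _ => 0 := by
      funext η
      rw [hg, indicator_of_notMem (show (t, η) ∉ S from ht)]
    rw [hk]
    simp only
    rw [this, herm_zero.hermPart_eq]
  · refine ge_of_tendsto' (x := atTop) (f := fun n => 1 + ∫⁻ x, ‖u n x - k x‖ₑ ∂ν) ?_
      fun n => ?_
    · simpa using hlim.const_add 1
    · refine le_trans ?_ (add_le_add_left (hu n).le_one _)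
      rw [← lintegral_add_left (hu n).meas.enorm]
      refine lintegral_mono fun x => ?_
      have := enorm_sub_le (a := u n x) (b := u n x - k x)
      simpa using this
  · have h0 : ∫⁻ x, ‖k x - f x‖ₑ ∂ν = 0 := by
      refine le_antisymm ?_ zero_le
      refine ge_of_tendsto' (x := atTop)
        (f := fun n => (∫⁻ x, ‖u n x - k x‖ₑ ∂ν) + ∫⁻ x, ‖u n x - f x‖ₑ ∂ν) ?_ fun n => ?_
      · simpa using hlim.add h
      · rw [← lintegral_add_left (hukm n).enorm]
        refine lintegral_mono fun x => ?_
        have := enorm_sub_le (a := u n x - f x) (b := u n x - k x)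
        rw [add_comm]
        simpa using this
    have hm : AEMeasurable (fun x => ‖k x - f x‖ₑ) ν :=
      (hkm.aestronglyMeasurable.sub hf.aestronglyMeasurable).enorm
    filter_upwards [(lintegral_eq_zero_iff' hm).1 h0] with x hx
    simpa [sub_eq_zero] using hx

variable {a σ s α β κ δ T : ℝ}

set_option maxHeartbeats 600000 in
theorem exists_local_forcing (ha : 0 ≤ a) (hσ : 1 ≤ σ) (hP : Subcritical α β s) (hT : 0 ≤ T)
    {W : ℝ → E3 → C3} {Z : ℝ → E3 → ℂ} (hW : StronglyMeasurable (Function.uncurry W))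
    (hZ : StronglyMeasurable (Function.uncurry Z)) (hWh : ∀ t, Herm (W t)) (hZh : ∀ t, Herm (Z t))
    {M : ℝ≥0∞} (hM : M < ⊤) (bW : Bnd a σ s α (Ioc T (T + 1)) M W)
    (bZ : Bnd a σ s β (Ioc T (T + 1)) M Z) :
    ∃ δ ∈ Ioc (0 : ℝ) 1, ∃ H : ℝ → E3 → C3 × ℂ, StronglyMeasurable (Function.uncurry H) ∧
      (∀ t ∉ Ioc T (T + δ), ∀ ξ, H t ξ = 0) ∧ (∀ t, Herm (H t)) ∧
      ∫⁻ t in Ioc T (T + δ), fnorm a σ s (H t) < ⊤ ∧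
      ∀ᵐ t ∂(volume.restrict (Ioc T (T + δ))), H t =ᵐ[volume]
        force (W t + duhInt α (fun t ξ => (H t ξ).1) t)
          (Z t + duhInt β (fun t ξ => (H t ξ).2) t) := by
  have hs := hP.hs
  have hα := hP.hα
  have hβ := hP.hβ
  set κ := min (1 - 1 / (2 * α) - -s / (2 * α))
    (min (1 - 1 / (2 * α) - -s / (2 * β)) (1 - 1 / (2 * β) - -s / (2 * α))) with hκd
  have hκ : 0 < κ := by
    have h1 := hP.h₁
    have h2 := hP.h₂
    have h3 := hP.h₃
    refine lt_min (by linarith) (lt_min (by linarith) (by linarith))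
  have k1 : κ ≤ 1 - 1 / (2 * α) - -s / (2 * α) := min_le_left _ _
  have k2 : κ ≤ 1 - 1 / (2 * α) - -s / (2 * β) := (min_le_right _ _).trans (min_le_left _ _)
  have k3 : κ ≤ 1 - 1 / (2 * β) - -s / (2 * α) := (min_le_right _ _).trans (min_le_right _ _)
  have hκ1 : κ ≤ 1 := by
    have h1 : 0 < 1 / (2 * α) := by positivity
    have h2 : 0 ≤ -s / (2 * α) := div_nonneg (by linarith [hs.2]) (by positivity)
    linarith
  obtain ⟨δ, hδ, hstep⟩ := exists_time_step (R := M + 1) hκ hκ1 le_add_self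
    (ENNReal.add_lt_top.2 ⟨hM, ENNReal.one_lt_top⟩)
  set R := M + 1 with hR
  have hRt : R < ⊤ := ENNReal.add_lt_top.2 ⟨hM, ENNReal.one_lt_top⟩
  have hstep' : 12 * ENNReal.ofReal (δ ^ κ) * R + 2 * ENNReal.ofReal δ ≤ 2⁻¹ :=
    le_trans (le_mul_of_one_le_right' (le_add_self : (1 : ℝ≥0∞) ≤ M + 1)) hstep
  set I := Ioc T (T + δ) with hIdef
  have hIm : MeasurableSet I := measurableSet_Ioc
  have hIv : volume I ≤ ENNReal.ofReal δ := by rw [hIdef, Real.volume_Ioc]; simp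
  have hTT : T ≤ T + δ := by linarith [hδ.1]
  have hIs : I ⊆ Ioc T (T + 1) := Ioc_subset_Ioc_right (by linarith [hδ.2])
  set u : (ℝ × E3 → C3 × ℂ) → ℝ → E3 → C3 :=
    fun H => W + duhInt α (fun t ξ => (H (t, ξ)).1) with hu
  set θ : (ℝ × E3 → C3 × ℂ) → ℝ → E3 → ℂ :=
    fun H => Z + duhInt β (fun t ξ => (H (t, ξ)).2) with hθ
  have m1 : ∀ {H}, PicardClass a σ s I H →
      StronglyMeasurable (Function.uncurry fun t ξ => (H (t, ξ)).1) := fun h => h.meas.fst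
  have m2 : ∀ {H}, PicardClass a σ s I H →
      StronglyMeasurable (Function.uncurry fun t ξ => (H (t, ξ)).2) := fun h => h.meas.snd
  have mu : ∀ {H}, PicardClass a σ s I H → StronglyMeasurable (Function.uncurry (u H)) :=
    fun h => hW.add (stronglyMeasurable_duhInt α (m1 h))
  have mθ : ∀ {H}, PicardClass a σ s I H → StronglyMeasurable (Function.uncurry (θ H)) :=
    fun h => hZ.add (stronglyMeasurable_duhInt β (m2 h))
  have i1 : ∀ {H : ℝ × E3 → C3 × ℂ}, StronglyMeasurable H →
      ∫⁻ t in I, fnorm a σ s (fun ξ => (H (t, ξ)).1) ≤ ∫⁻ p, ‖H p‖ₑ ∂(spaceTime a σ s I) :=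
    fun h => by
      rw [lintegral_enorm_spaceTime h]
      exact lintegral_mono fun t => fnorm_fst_le _
  have i2 : ∀ {H : ℝ × E3 → C3 × ℂ}, StronglyMeasurable H →
      ∫⁻ t in I, fnorm a σ s (fun ξ => (H (t, ξ)).2) ≤ ∫⁻ p, ‖H p‖ₑ ∂(spaceTime a σ s I) :=
    fun h => by
      rw [lintegral_enorm_spaceTime h]
      exact lintegral_mono fun t => fnorm_snd_le _
  have f1 : ∀ {H}, PicardClass a σ s I H →
      ∫⁻ t in I, fnorm a σ s (fun ξ => (H (t, ξ)).1) ≤ 1 := fun h => (i1 h.meas).trans h.le_one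
  have f2 : ∀ {H}, PicardClass a σ s I H →
      ∫⁻ t in I, fnorm a σ s (fun ξ => (H (t, ξ)).2) ≤ 1 := fun h => (i2 h.meas).trans h.le_one
  have s1 : ∀ {H}, PicardClass a σ s I H → ∀ t ∉ I, ∀ ξ, (H (t, ξ)).1 = 0 :=
    fun h t ht ξ => by rw [h.supp t ht, Prod.fst_zero]
  have s2 : ∀ {H}, PicardClass a σ s I H → ∀ t ∉ I, ∀ ξ, (H (t, ξ)).2 = 0 :=
    fun h t ht ξ => by rw [h.supp t ht, Prod.snd_zero]
  have bu : ∀ {H}, PicardClass a σ s I H → Bnd a σ s α I R (u H) := fun h =>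
    (bW.mono hIs le_rfl).add hW ((bnd_duhInt hT hTT (m1 h) (s1 h)
      ((f1 h).trans_lt ENNReal.one_lt_top)).mono subset_rfl (f1 h))
  have bθ : ∀ {H}, PicardClass a σ s I H → Bnd a σ s β I R (θ H) := fun h =>
    (bZ.mono hIs le_rfl).add hZ ((bnd_duhInt hT hTT (m2 h) (s2 h)
      ((f2 h).trans_lt ENNReal.one_lt_top)).mono subset_rfl (f2 h))
  have hSm : MeasurableSet {p : ℝ × E3 | p.1 ∈ I} := measurable_fst hIm
  have hPm : ∀ {H}, PicardClass a σ s I H → StronglyMeasurable (picard α β I W Z H) :=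
    fun h => (stronglyMeasurable_force (mu h) (mθ h)).indicator hSm
  have hPI : ∀ (H : ℝ × E3 → C3 × ℂ) (t : ℝ), t ∈ I → ∀ ξ,
      picard α β I W Z H (t, ξ) = force (u H t) (θ H t) ξ := fun H t ht ξ =>
    indicator_of_mem (show (t, ξ) ∈ {p : ℝ × E3 | p.1 ∈ I} from ht) _
  have hPn : ∀ (H : ℝ × E3 → C3 × ℂ) (t : ℝ), t ∉ I → ∀ ξ,
      picard α β I W Z H (t, ξ) = 0 := fun H t ht ξ =>
    indicator_of_notMem (show (t, ξ) ∉ {p : ℝ × E3 | p.1 ∈ I} from ht) _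
  have hdiff : ∀ {H K}, PicardClass a σ s I H → PicardClass a σ s I K →
      ∫⁻ x, ‖picard α β I W Z H x - picard α β I W Z K x‖ₑ ∂(spaceTime a σ s I) ≤
        2⁻¹ * ∫⁻ x, ‖H x - K x‖ₑ ∂(spaceTime a σ s I) := by
    intro H K hH hK
    have hsub : StronglyMeasurable fun x => H x - K x := hH.meas.sub hK.meas
    have e1 : ∫⁻ t in I, fnorm a σ s
        (((fun t ξ => (H (t, ξ)).1) - fun t ξ => (K (t, ξ)).1 : ℝ → E3 → C3) t) ≤
        ∫⁻ x, ‖H x - K x‖ₑ ∂(spaceTime a σ s I) := by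
      refine le_trans (le_of_eq ?_) (i1 hsub)
      refine lintegral_congr fun t => congrArg _ (funext fun ξ => ?_)
      rw [Pi.sub_apply, Pi.sub_apply, Prod.fst_sub]
    have e2 : ∫⁻ t in I, fnorm a σ s
        (((fun t ξ => (H (t, ξ)).2) - fun t ξ => (K (t, ξ)).2 : ℝ → E3 → ℂ) t) ≤
        ∫⁻ x, ‖H x - K x‖ₑ ∂(spaceTime a σ s I) := by
      refine le_trans (le_of_eq ?_) (i2 hsub)
      refine lintegral_congr fun t => congrArg _ (funext fun ξ => ?_)
      rw [Pi.sub_apply, Pi.sub_apply, Prod.snd_sub]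
    have du : Bnd a σ s α I (∫⁻ x, ‖H x - K x‖ₑ ∂(spaceTime a σ s I)) (u H - u K) := by
      have e : u H - u K = duhInt α (fun t ξ => (H (t, ξ)).1) - duhInt α (fun t ξ => (K (t, ξ)).1) :=
        add_sub_add_left_eq_sub _ _ _
      rw [e]
      exact (bnd_duhInt_sub hT hTT (m1 hH) (m1 hK) (s1 hH) (s1 hK)
        ((f1 hH).trans_lt ENNReal.one_lt_top) ((f1 hK).trans_lt ENNReal.one_lt_top)).mono
        subset_rfl e1
    have dθ : Bnd a σ s β I (∫⁻ x, ‖H x - K x‖ₑ ∂(spaceTime a σ s I)) (θ H - θ K) := by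
      have e : θ H - θ K = duhInt β (fun t ξ => (H (t, ξ)).2) - duhInt β (fun t ξ => (K (t, ξ)).2) :=
        add_sub_add_left_eq_sub _ _ _
      rw [e]
      exact (bnd_duhInt_sub hT hTT (m2 hH) (m2 hK) (s2 hH) (s2 hK)
        ((f2 hH).trans_lt ENNReal.one_lt_top) ((f2 hK).trans_lt ENNReal.one_lt_top)).mono
        subset_rfl e2
    refine le_trans ?_ (mul_le_mul_left hstep' _)
    refine le_trans (le_of_eq ?_) (lintegral_fnorm_force_sub_le ha hσ hP hκ k1 k2 k3 hδ hIv hIm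
      hRt (mu hH) (mθ hH) (mu hK) (mθ hK) (bu hH) (bθ hH) (bu hK) (bθ hK) du dθ)
    have hPs : StronglyMeasurable fun x => picard α β I W Z H x - picard α β I W Z K x :=
      (hPm hH).sub (hPm hK)
    rw [lintegral_enorm_spaceTime hPs]
    refine setLIntegral_congr_fun hIm fun t ht => congrArg _ (funext fun ξ => ?_)
    change picard α β I W Z H (t, ξ) - picard α β I W Z K (t, ξ) = _
    rw [hPI H t ht, hPI K t ht, Pi.sub_apply]
  have hself : ∀ H, PicardClass a σ s I H → PicardClass a σ s I (picard α β I W Z H) := by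
    intro H hH
    refine ⟨hPm hH, hPn H, fun t => ?_, ?_⟩
    · by_cases ht : t ∈ I
      · have e : (fun ξ => picard α β I W Z H (t, ξ)) = force (u H t) (θ H t) :=
          funext (hPI H t ht)
        rw [e]
        have h1 : ∀ τ, Herm fun ξ => (H (τ, ξ)).1 := fun τ => (hH.herm τ).fst
        have h2 : ∀ τ, Herm fun ξ => (H (τ, ξ)).2 := fun τ => (hH.herm τ).snd
        exact ((hWh t).add (Herm.duhInt h1 t)).force ((hZh t).add (Herm.duhInt h2 t))
      · have e : (fun ξ => picard α β I W Z H (t, ξ)) = fun _ => 0 := funext (hPn H t ht)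
        rw [e]
        exact herm_zero
    · refine le_trans ?_ (hstep.trans (by norm_num))
      refine le_trans (le_of_eq ?_) (lintegral_fnorm_force_sub_le ha hσ hP hκ k1 k2 k3 hδ hIv hIm
        hRt (mu hH) (mθ hH) stronglyMeasurable_zero stronglyMeasurable_zero (bu hH) (bθ hH)
        (bnd_zero a σ s α I R) (bnd_zero a σ s β I R) (U' := 0) (Θ' := 0)
        (by rw [sub_zero]; exact bu hH) (by rw [sub_zero]; exact bθ hH))
      rw [lintegral_enorm_spaceTime (hPm hH)]
      refine setLIntegral_congr_fun hIm fun t ht => congrArg _ (funext fun ξ => ?_)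
      change picard α β I W Z H (t, ξ) = _
      rw [hPI H t ht, Pi.zero_apply, Pi.zero_apply, force_zero, sub_zero]
  have hint : ∀ H, PicardClass a σ s I H → Integrable H (spaceTime a σ s I) := fun H hH =>
    ⟨hH.meas.aestronglyMeasurable, hH.le_one.trans_lt ENNReal.one_lt_top⟩
  have hzero : PicardClass a σ s I 0 :=
    ⟨stronglyMeasurable_zero, fun _ _ _ => rfl, fun _ => herm_zero, by simp⟩
  obtain ⟨H, hH, hfix⟩ := exists_fixedPoint (ν := spaceTime a σ s I) (picard α β I W Z)
    (PicardClass a σ s I) hself hint hzero (fun H K hH hK => hdiff hH hK)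
    fun v f hv hf hlim => PicardClass.exists_of_tendsto hIm hv hf hlim
  refine ⟨δ, hδ, Function.curry H, hH.meas, hH.supp, hH.herm, ?_, ?_⟩
  · rw [← lintegral_enorm_spaceTime hH.meas]
    exact hH.le_one.trans_lt ENNReal.one_lt_top
  · filter_upwards [ae_ae_of_ae_spaceTime hfix, ae_restrict_mem hIm] with t ht htI
    filter_upwards [ht] with ξ hξ
    rw [hPI H t htI] at hξ
    exact hξ.symm

end LocalForcing

section APriori

/-- The integrand of the blow-up criterion. -/
def crit (α β s : ℝ) (x y : ℝ≥0∞) : ℝ≥0∞ :=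
  x ^ (2 * α / (2 * α + s - 1)) +
    x ^ (β * (s + 2 * α) / (β * (s + 2 * α) - α)) * y ^ (-s * β / (β * (s + 2 * α) - α)) +
    x ^ (-s * α / (α * (s + 2 * β) - β)) * y ^ (α * (s + 2 * β) / (α * (s + 2 * β) - β))

theorem rpow_mul_rpow_rpow {p r k l m : ℝ} (hk : 0 ≤ k) (hm : 0 ≤ m)
    (h1 : (1 - p) * m = 1 + k) (h2 : (1 - r) * m = l) (x y : ℝ≥0∞) :
    (x ^ (1 - p) * y ^ (1 - r)) ^ m = x * (x ^ k * y ^ l) := by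
  rw [ENNReal.mul_rpow_of_nonneg _ _ hm, ← ENNReal.rpow_mul, ← ENNReal.rpow_mul, h1, h2,
    ENNReal.rpow_add_of_nonneg _ _ zero_le_one hk, ENNReal.rpow_one, mul_assoc]

theorem Subcritical.denominators {α β s : ℝ} (hP : Subcritical α β s) :
    0 < 2 * α + s - 1 ∧ 0 < β * (s + 2 * α) - α ∧ 0 < α * (s + 2 * β) - β := by
  have hα : 0 < α := by linarith [hP.hα]
  have hβ : 0 < β := by linarith [hP.hβ]
  have h1 := hP.h₁
  have h2 := hP.h₂
  have h3 := hP.h₃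
  rw [← add_div, div_lt_one (by positivity)] at h1
  rw [div_add_div _ _ (by positivity) (by positivity), div_lt_one (by positivity)] at h2 h3
  exact ⟨by linarith, by linarith, by linarith⟩

theorem exists_fnorm_force_le {α β s : ℝ} (hP : Subcritical α β s) :
    ∃ C : ℝ, 0 < C ∧ ∀ a σ : ℝ, 0 ≤ a → 1 ≤ σ → ∀ (U : E3 → C3) (Θ : E3 → ℂ),
      AEStronglyMeasurable U → AEStronglyMeasurable Θ →
      fnorm a σ s U < ⊤ → fnorm a σ s Θ < ⊤ →
      fnorm a σ s (fun ξ => (force U Θ ξ).1) + fnorm a σ s (fun ξ => (force U Θ ξ).2) ≤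
        2⁻¹ * (fnorm a σ (s + 2 * α) U + fnorm a σ (s + 2 * β) Θ) +
        ENNReal.ofReal C * ((1 + crit α β s (fnorm a σ s U) (fnorm a σ s Θ)) *
          (fnorm a σ s U + fnorm a σ s Θ)) := by
  have hs := hP.hs
  have hα := hP.hα
  have hβ := hP.hβ
  have hα0 : 0 < α := by linarith
  have hβ0 : 0 < β := by linarith
  obtain ⟨d1, d2, d3⟩ := hP.denominators
  have hs0 : 0 ≤ -s := by linarith [hs.2]
  have hp : 0 ≤ 1 / (2 * α) := by positivity
  have hp' : 0 ≤ 1 / (2 * β) := by positivity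
  have hr : 0 ≤ -s / (2 * α) := by positivity
  have hr' : 0 ≤ -s / (2 * β) := by positivity
  have r1 : -s / (2 * α) ≤ 1 := by linarith [hP.h₁]
  have r2 : -s / (2 * β) ≤ 1 := by linarith [hP.h₂]
  have q1 : 1 / (2 * α) ≤ 1 := by linarith [hP.h₁]
  have q2 : 1 / (2 * β) ≤ 1 := by linarith [hP.h₃]
  have e1 : 1 / (1 - 1 / (2 * α) - -s / (2 * α)) = 2 * α / (2 * α + s - 1) := by
    have : 1 - 1 / (2 * α) - -s / (2 * α) = (2 * α + s - 1) / (2 * α) := by field_simp; ring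
    rw [this, one_div_div]
  have e2 : 1 / (1 - 1 / (2 * β) - -s / (2 * α)) = 2 * α * β / (β * (s + 2 * α) - α) := by
    have : 1 - 1 / (2 * β) - -s / (2 * α) = (β * (s + 2 * α) - α) / (2 * α * β) := by
      field_simp; ring
    rw [this, one_div_div]
  have e3 : 1 / (1 - 1 / (2 * α) - -s / (2 * β)) = 2 * α * β / (α * (s + 2 * β) - β) := by
    have : 1 - 1 / (2 * α) - -s / (2 * β) = (α * (s + 2 * β) - β) / (2 * α * β) := by
      field_simp; ring
    rw [this, one_div_div]
  have hε : (0 : ℝ) < 1 / 20 := by norm_num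
  set C1 := ((1 / 20 : ℝ) ^ (-(1 / (2 * α) + -s / (2 * α)))) ^
    (1 / (1 - 1 / (2 * α) - -s / (2 * α))) with hC1
  set C2 := ((1 / 20 : ℝ) ^ (-(1 / (2 * β) + -s / (2 * α)))) ^
    (1 / (1 - 1 / (2 * β) - -s / (2 * α))) with hC2
  set C3 := ((1 / 20 : ℝ) ^ (-(1 / (2 * α) + -s / (2 * β)))) ^
    (1 / (1 - 1 / (2 * α) - -s / (2 * β))) with hC3
  have hC1p : 0 ≤ C1 := by positivity
  have hC2p : 0 ≤ C2 := by positivity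
  have hC3p : 0 ≤ C3 := by positivity
  refine ⟨4 * C1 + C2 + C3 + 2, by positivity, fun a σ ha hσ U Θ hU hΘ fU fΘ => ?_⟩
  set x := fnorm a σ s U with hx
  set y := fnorm a σ s Θ with hy
  set X := fnorm a σ (s + 2 * α) U with hX
  set Y := fnorm a σ (s + 2 * β) Θ with hY
  have b1 := fnorm_bil_le_interpolated ha hσ hs hα hα r1 r1 hU hU
  have b2 := fnorm_bil_le_interpolated ha hσ hs hα hβ r2 r1 hU hΘ
  rw [← hx, ← hX] at b1
  rw [← hx, ← hX, ← hy, ← hY] at b2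
  have fin : ∀ {z w : ℝ≥0∞} {k l : ℝ}, z < ⊤ → w < ⊤ → k ≤ 1 → l ≤ 1 →
      z ^ (1 - k) * w ^ (1 - l) ≠ ⊤ := fun hz hw hk hl =>
    ENNReal.mul_ne_top (ENNReal.rpow_lt_top_of_nonneg (by linarith) hz.ne).ne
      (ENNReal.rpow_lt_top_of_nonneg (by linarith) hw.ne).ne
  have y1 := young_ennreal hp hr hP.h₁ hε X X (x ^ (1 - 1 / (2 * α)) * x ^ (1 - -s / (2 * α)))
    (fin fU fU q1 r1)
  have y2 := young_ennreal hp' hr hP.h₃ hε Y X (y ^ (1 - 1 / (2 * β)) * x ^ (1 - -s / (2 * α)))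
    (fin fΘ fU q2 r1)
  have y3 := young_ennreal hp hr' hP.h₂ hε X Y (x ^ (1 - 1 / (2 * α)) * y ^ (1 - -s / (2 * β)))
    (fin fU fΘ q1 r2)
  rw [← hC1, e1] at y1
  rw [← hC2, e2, rpow_mul_rpow_rpow (k := -s * β / (β * (s + 2 * α) - α))
    (l := β * (s + 2 * α) / (β * (s + 2 * α) - α)) (by positivity)
    (by positivity) (by field_simp; ring)
    (by field_simp; ring)] at y2
  rw [← hC3, e3, rpow_mul_rpow_rpow (k := -s * α / (α * (s + 2 * β) - β))
    (l := α * (s + 2 * β) / (α * (s + 2 * β) - β)) (by positivity)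
    (by positivity) (by field_simp; ring)
    (by field_simp; ring)] at y3
  have y1' : (x ^ (1 - 1 / (2 * α)) * x ^ (1 - -s / (2 * α))) ^ (2 * α / (2 * α + s - 1)) =
      x * x ^ (2 * α / (2 * α + s - 1)) := by
    rw [← ENNReal.rpow_add_of_nonneg _ _ (by linarith) (by linarith), ← ENNReal.rpow_mul]
    have : (1 - 1 / (2 * α) + (1 - -s / (2 * α))) * (2 * α / (2 * α + s - 1)) =
        1 + 2 * α / (2 * α + s - 1) := by field_simp; ring
    rw [this, ENNReal.rpow_add_of_nonneg _ _ zero_le_one (by positivity), ENNReal.rpow_one]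
  rw [y1'] at y1
  set E := ENNReal.ofReal (1 / 20) with hE
  set G := crit α β s x y with hG
  have g1 : x ^ (2 * α / (2 * α + s - 1)) ≤ G := le_self_add.trans le_self_add
  have g2 : y ^ (-s * β / (β * (s + 2 * α) - α)) * x ^ (β * (s + 2 * α) / (β * (s + 2 * α) - α)) ≤
      G := by
    rw [mul_comm]
    exact le_add_self.trans le_self_add
  have g3 : x ^ (-s * α / (α * (s + 2 * β) - β)) * y ^ (α * (s + 2 * β) / (α * (s + 2 * β) - β)) ≤
      G := le_add_self
  have t1 : fnorm a σ s (bil U U) ≤ 2 * (E * (X + X) + ENNReal.ofReal C1 * (x * G)) := by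
    refine b1.trans ?_
    have h : E * (X + X) + ENNReal.ofReal C1 * (x * x ^ (2 * α / (2 * α + s - 1))) ≤
        E * (X + X) + ENNReal.ofReal C1 * (x * G) := by gcongr
    rw [two_mul (E * (X + X) + _)]
    exact add_le_add (y1.trans h) (y1.trans h)
  have t2 : fnorm a σ s (bil U Θ) ≤ (E * (X + Y) + ENNReal.ofReal C3 * (x * G)) +
      (E * (Y + X) + ENNReal.ofReal C2 * (y * G)) :=
    b2.trans (add_le_add (y3.trans (by gcongr)) (y2.trans (by gcongr)))
  have n1 : fnorm a σ s (fun ξ => (force U Θ ξ).1) ≤ 2 * (fnorm a σ s (bil U U) + y) := by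
    refine (fnorm_mono (h := bil U U + fun ξ => vert (-Θ ξ)) 2 (by simp)
      (Eventually.of_forall fun ξ => ?_)).trans (mul_le_mul' le_rfl ?_)
    · have : (force U Θ ξ).1 = -lerayAt ξ (bil U U ξ + vert (-Θ ξ)) := by
        change -lerayAt ξ (bil U U ξ) + lerayAt ξ (vert (Θ ξ)) = _
        rw [lerayAt_add, map_neg, lerayAt_neg]
        abel
      rw [this, enorm_neg]
      exact enorm_lerayAt_le _ _
    · refine (fnorm_add_le (aestronglyMeasurable_bil hU hU)).trans (add_le_add le_rfl ?_)
      refine fnorm_mono_one (Eventually.of_forall fun ξ => ?_)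
      rw [enorm_vert, enorm_neg]
  have n2 : fnorm a σ s (fun ξ => (force U Θ ξ).2) ≤ fnorm a σ s (bil U Θ) := by
    refine fnorm_mono_one (Eventually.of_forall fun ξ => ?_)
    change ‖-bil U Θ ξ‖ₑ ≤ _
    rw [enorm_neg]
  have hE10 : 10 * E = 2⁻¹ := by
    rw [hE, show (10 : ℝ≥0∞) = ENNReal.ofReal 10 by simp, ← ENNReal.ofReal_mul (by norm_num)]
    rw [show (10 * (1 / 20) : ℝ) = 2⁻¹ by norm_num, ENNReal.ofReal_inv_of_pos (by norm_num)]
    simp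
  have hE2 : 2 * E ≤ 2⁻¹ := by
    rw [← hE10]
    gcongr
    norm_num
  calc _ ≤ 2 * (2 * (E * (X + X) + ENNReal.ofReal C1 * (x * G)) + y) +
        ((E * (X + Y) + ENNReal.ofReal C3 * (x * G)) +
          (E * (Y + X) + ENNReal.ofReal C2 * (y * G))) :=
        add_le_add (n1.trans (by gcongr)) (n2.trans t2)
    _ = (10 * E * X + 2 * E * Y) + (4 * ENNReal.ofReal C1 * (x * G) + ENNReal.ofReal C3 * (x * G) +
        ENNReal.ofReal C2 * (y * G) + 2 * y) := by ring
    _ ≤ (2⁻¹ * X + 2⁻¹ * Y) + (4 * ENNReal.ofReal C1 * ((1 + G) * (x + y)) +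
        ENNReal.ofReal C3 * ((1 + G) * (x + y)) +
        ENNReal.ofReal C2 * ((1 + G) * (x + y)) + 2 * ((1 + G) * (x + y))) := by
        have i1 : x * G ≤ (1 + G) * (x + y) := by
          rw [mul_comm]; exact mul_le_mul' le_add_self le_self_add
        have i2 : y * G ≤ (1 + G) * (x + y) := by
          rw [mul_comm]; exact mul_le_mul' le_add_self le_add_self
        have i3 : y ≤ (1 + G) * (x + y) := by
          rw [← one_mul y]
          exact mul_le_mul' le_self_add (by rw [one_mul]; exact le_add_self)
        gcongr
        exact hE10.le
    _ = _ := by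
        rw [ENNReal.ofReal_add (by positivity) (by positivity),
          ENNReal.ofReal_add (by positivity) (by positivity),
          ENNReal.ofReal_add (by positivity) (by positivity), ENNReal.ofReal_mul (by positivity)]
        simp only [ENNReal.ofReal_ofNat]
        ring

end APriori

section Duhamel

theorem lintegral_fnorm_force_lt_top {a σ s α β : ℝ} (ha : 0 ≤ a) (hσ : 1 ≤ σ)
    (hP : Subcritical α β s) {I : Set ℝ} (hI : volume I < ⊤) (hIm : MeasurableSet I)
    {U : ℝ → E3 → C3} {Θ : ℝ → E3 → ℂ} (hU : StronglyMeasurable (Function.uncurry U))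
    (hΘ : StronglyMeasurable (Function.uncurry Θ)) {M : ℝ≥0∞} (hM : M < ⊤)
    (bU : Bnd a σ s α I M U) (bΘ : Bnd a σ s β I M Θ) :
    ∫⁻ t in I, fnorm a σ s (fun ξ => (force (U t) (Θ t) ξ).1) < ⊤ ∧
      ∫⁻ t in I, fnorm a σ s (fun ξ => (force (U t) (Θ t) ξ).2) < ⊤ := by
  obtain ⟨C, -, hC⟩ := exists_fnorm_force_le hP
  obtain ⟨d1, d2, d3⟩ := hP.denominators
  have hα : 0 < α := by linarith [hP.hα]
  have hβ : 0 < β := by linarith [hP.hβ]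
  have hs0 : 0 ≤ -s := by linarith [hP.hs.2]
  set K := ENNReal.ofReal C * ((1 + crit α β s M M) * (M + M)) with hK
  have p1 : 0 ≤ 2 * α / (2 * α + s - 1) := by positivity
  have p2 : 0 ≤ β * (s + 2 * α) / (β * (s + 2 * α) - α) := div_nonneg (by linarith) d2.le
  have p3 : 0 ≤ -s * β / (β * (s + 2 * α) - α) := by positivity
  have p4 : 0 ≤ -s * α / (α * (s + 2 * β) - β) := by positivity
  have p5 : 0 ≤ α * (s + 2 * β) / (α * (s + 2 * β) - β) := div_nonneg (by linarith) d3.le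
  have hcrit : crit α β s M M < ⊤ := by
    have f : ∀ {p : ℝ}, 0 ≤ p → M ^ p < ⊤ := fun hp => ENNReal.rpow_lt_top_of_nonneg hp hM.ne
    exact ENNReal.add_lt_top.2 ⟨ENNReal.add_lt_top.2 ⟨f p1, ENNReal.mul_lt_top (f p2) (f p3)⟩,
      ENNReal.mul_lt_top (f p4) (f p5)⟩
  have hKt : K < ⊤ := ENNReal.mul_lt_top ENNReal.ofReal_lt_top (ENNReal.mul_lt_top
    (ENNReal.add_lt_top.2 ⟨ENNReal.one_lt_top, hcrit⟩) (ENNReal.add_lt_top.2 ⟨hM, hM⟩))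
  have hpt : ∀ t ∈ I, fnorm a σ s (fun ξ => (force (U t) (Θ t) ξ).1) +
      fnorm a σ s (fun ξ => (force (U t) (Θ t) ξ).2) ≤
      2⁻¹ * (fnorm a σ (s + 2 * α) (U t) + fnorm a σ (s + 2 * β) (Θ t)) + K := by
    intro t ht
    have f1 := bU.1 t ht
    have f2 := bΘ.1 t ht
    refine (hC a σ ha hσ (U t) (Θ t) (StronglyMeasurable.slice hU t).aestronglyMeasurable
      (StronglyMeasurable.slice hΘ t).aestronglyMeasurable (f1.trans_lt hM)
      (f2.trans_lt hM)).trans ?_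
    refine add_le_add le_rfl ?_
    rw [hK, crit, crit]
    gcongr
  have hmm : Measurable fun t => 2⁻¹ * (fnorm a σ (s + 2 * α) (U t) +
      fnorm a σ (s + 2 * β) (Θ t)) :=
    ((measurable_fnorm hU).add (measurable_fnorm hΘ)).const_mul _
  have hsum : ∫⁻ t in I, (fnorm a σ s (fun ξ => (force (U t) (Θ t) ξ).1) +
      fnorm a σ s (fun ξ => (force (U t) (Θ t) ξ).2)) < ⊤ := by
    refine (setLIntegral_mono' hIm hpt).trans_lt ?_
    rw [lintegral_add_left hmm, lintegral_const_mul' _ _ (by simp),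
      lintegral_add_left (measurable_fnorm hU)]
    refine ENNReal.add_lt_top.2 ⟨ENNReal.mul_lt_top (by simp) (ENNReal.add_lt_top.2
      ⟨bU.2.trans_lt hM, bΘ.2.trans_lt hM⟩), ?_⟩
    rw [lintegral_const, Measure.restrict_apply_univ]
    exact ENNReal.mul_lt_top hKt hI
  exact ⟨(lintegral_mono fun t => le_self_add).trans_lt hsum,
    (lintegral_mono fun t => le_add_self).trans_lt hsum⟩

theorem duhInt_congr_ae {V : Type*} [NormedAddCommGroup V] [NormedSpace ℂ V] {γ t : ℝ}
    {G G' : ℝ → E3 → V} (hG : StronglyMeasurable (Function.uncurry G))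
    (hG' : StronglyMeasurable (Function.uncurry G'))
    (h : ∀ᵐ τ ∂(volume.restrict (Ioc 0 t)), G τ =ᵐ[volume] G' τ) :
    duhInt γ G t =ᵐ[volume] duhInt γ G' t := by
  have hm : MeasurableSet {p : ℝ × E3 | G p.1 p.2 = G' p.1 p.2} :=
    hG.measurableSet_eq_fun hG'
  have := (Measure.ae_ae_comm hm).1 h
  filter_upwards [this] with ξ hξ
  refine integral_congr_ae ?_
  filter_upwards [hξ] with τ hτ
  rw [hτ]

theorem HasFourierFn.duhamel_iff [CompleteSpace F] {f f₀ d : 𝓢'(E3, F)} {v v₀ D : E3 → F}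
    (hf : HasFourierFn f v) (h₀ : HasFourierFn f₀ v₀) (hd : HasFourierFn d D) :
    (∀ φ : 𝓢(E3, ℂ), f φ = f₀ φ - d φ) ↔ v =ᵐ[volume] v₀ - D := by
  constructor
  · intro h
    have e : f = f₀ - d := by
      ext φ
      exact h φ
    exact (e ▸ hf).ae_eq (h₀.sub hd)
  · intro h φ
    have e : f = f₀ - d := (hf.congr h).unique (h₀.sub hd)
    rw [e]
    rfl

theorem exists_duhInt_distribution [CompleteSpace F] {a σ s γ t : ℝ} (ha : 0 ≤ a)
    (hs : s ∈ Icc (-1 : ℝ) 0) (ht : 0 ≤ t) {A : ℝ → E3 → F}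
    (hA : StronglyMeasurable (Function.uncurry A))
    (hfin : ∫⁻ τ in Ioc 0 t, fnorm a σ s (A τ) < ⊤) {k : ℝ → 𝓢'(E3, F)}
    (hk : ∀ᵐ τ ∂(volume.restrict (Ioc 0 t)), HasFourierFn (k τ) (A τ)) :
    ∃ d : 𝓢'(E3, F), HasFourierFn d (Boussinesq.duhInt γ A t) ∧
      ∀ φ : 𝓢(E3, ℂ), d φ = ∫ τ in (0 : ℝ)..t, Boussinesq.heat γ (t - τ) (k τ) φ := by
  obtain ⟨d, hd⟩ := exists_hasFourierFn ha hs
    (StronglyMeasurable.slice (stronglyMeasurable_duhInt γ hA) t).aestronglyMeasurable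
    ((fnorm_duhInt_le ht hA).trans_lt hfin)
  exact ⟨d, hd, hd.duhInt_apply ha hs ht hA hfin hk⟩

variable {a σ s α β t : ℝ}

theorem ae_fnorm_bil_lt_top {V : Type*} [NormedAddCommGroup V] [NormedSpace ℂ V] {γ : ℝ}
    (ha : 0 ≤ a) (hσ : 1 ≤ σ) (hs : s ∈ Icc (-1 : ℝ) 0) (hα : 1 / 2 < α) (hγ : 1 / 2 < γ)
    (h1 : -s / (2 * γ) ≤ 1) (h2 : -s / (2 * α) ≤ 1) {I : Set ℝ} (hI : MeasurableSet I)
    {U : ℝ → E3 → C3} {f : ℝ → E3 → V}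
    (hU : StronglyMeasurable (Function.uncurry U)) (hf : StronglyMeasurable (Function.uncurry f))
    {M : ℝ≥0∞} (hM : M < ⊤) (bU : Bnd a σ s α I M U) (bf : Bnd a σ s γ I M f) :
    ∀ᵐ t ∂(volume.restrict I), fnorm a σ s (bil (U t) (f t)) < ⊤ := by
  filter_upwards [ae_restrict_mem hI, ae_fnorm_lt_top hM hU bU, ae_fnorm_lt_top hM hf bf]
    with t ht t1 t2
  have f1 := (bU.1 t ht).trans_lt hM
  have f2 := (bf.1 t ht).trans_lt hM
  have n1 := (StronglyMeasurable.slice hU t).aestronglyMeasurable (μ := volume)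
  have n2 := (StronglyMeasurable.slice hf t).aestronglyMeasurable (μ := volume)
  refine (fnorm_bil_le ha hσ hs n1 n2).trans_lt (ENNReal.add_lt_top.2 ⟨ENNReal.mul_lt_top ?_ ?_,
    ENNReal.mul_lt_top ?_ ?_⟩)
  · exact fnorm_add_one_lt_top hα n1 f1 t1
  · exact fnorm_zero_lt_top hs.2 hγ h1 n2 f2 t2
  · exact fnorm_zero_lt_top hs.2 hα h2 n1 f1 t1
  · exact fnorm_add_one_lt_top hγ n2 f2 t2

/-- Duhamel's formula for the velocity, in terms of distributions and of Fourier transforms. -/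
theorem mild_velocity_iff (ha : 0 ≤ a) (hσ : 1 ≤ σ) (hP : Subcritical α β s) (ht : 0 ≤ t)
    {U : ℝ → E3 → C3} {Θ : ℝ → E3 → ℂ} (hU : StronglyMeasurable (Function.uncurry U))
    (hΘ : StronglyMeasurable (Function.uncurry Θ)) {M : ℝ≥0∞} (hM : M < ⊤)
    (bU : Bnd a σ s α (Ioc 0 t) M U) (bΘ : Bnd a σ s β (Ioc 0 t) M Θ)
    {u : ℝ → 𝓢'(E3, C3)} {θ : ℝ → 𝓢'(E3, ℂ)} (hu : ∀ τ ∈ Icc 0 t, HasFourierFn (u τ) (U τ))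
    (hθ : ∀ τ ∈ Icc 0 t, HasFourierFn (θ τ) (Θ τ))
    (hdiv : ∀ τ ∈ Icc 0 t, ∀ᵐ ξ : E3, ∑ i, (ξ i : ℂ) * U τ ξ i = 0)
    {u₀ : 𝓢'(E3, C3)} {w : E3 → C3} (hw : HasFourierFn u₀ w) (fw : fnorm a σ s w < ⊤) :
    (∀ φ : 𝓢(E3, ℂ), u t φ = heat α t u₀ φ
      - (∫ τ in (0 : ℝ)..t, heat α (t - τ) (leray (transport (u τ) (u τ))) φ)
      + ∫ τ in (0 : ℝ)..t, heat α (t - τ) (leray (buoyancy (θ τ))) φ) ↔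
    U t =ᵐ[volume] duh α w (fun τ ξ => (force (U τ) (Θ τ) ξ).1) t := by
  have hs := hP.hs
  have hα := hP.hα
  have r1 : -s / (2 * α) ≤ 1 := by
    have : 0 < 1 / (2 * α) := by positivity
    linarith [hP.h₁]
  have hIv : volume (Ioc 0 t) < ⊤ := by simp
  have hIm : MeasurableSet (Ioc 0 t) := measurableSet_Ioc
  have hF1 := (lintegral_fnorm_force_lt_top ha hσ hP hIv hIm hU hΘ hM bU bΘ).1
  set A : ℝ → E3 → C3 := fun τ ξ => lerayAt ξ (bil (U τ) (U τ) ξ) with hA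
  set B : ℝ → E3 → C3 := fun τ ξ => lerayAt ξ (vert (Θ τ ξ)) with hB
  have hAm : StronglyMeasurable (Function.uncurry A) :=
    stronglyMeasurable_leray (stronglyMeasurable_bil hU hU)
  have hBm : StronglyMeasurable (Function.uncurry B) :=
    stronglyMeasurable_leray (U := fun t ξ => vert (Θ t ξ))
      (vert.continuous.comp_stronglyMeasurable hΘ)
  have hBle : ∀ τ, fnorm a σ s (B τ) ≤ 2 * fnorm a σ s (Θ τ) := fun τ =>
    fnorm_mono 2 (by simp) (Eventually.of_forall fun ξ => by
      rw [← enorm_vert (Θ τ ξ)]; exact enorm_lerayAt_le _ _)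
  have hBf : ∫⁻ τ in Ioc 0 t, fnorm a σ s (B τ) < ⊤ := by
    refine (setLIntegral_mono' hIm fun τ hτ => (hBle τ).trans
      (mul_le_mul' le_rfl (bΘ.1 τ hτ))).trans_lt ?_
    rw [lintegral_const, Measure.restrict_apply_univ]
    exact ENNReal.mul_lt_top (ENNReal.mul_lt_top (by simp) hM) hIv
  have hAf : ∫⁻ τ in Ioc 0 t, fnorm a σ s (A τ) < ⊤ := by
    refine lt_of_le_of_lt ?_ (ENNReal.add_lt_top.2 ⟨hBf, hF1⟩)
    rw [← lintegral_add_left (measurable_fnorm hBm)]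
    refine lintegral_mono fun τ => ?_
    refine le_trans (fnorm_mono_one (h := B τ + fun ξ => -(force (U τ) (Θ τ) ξ).1) ?_)
      ((fnorm_add_le (StronglyMeasurable.slice hBm τ).aestronglyMeasurable).trans
        (add_le_add le_rfl (fnorm_mono_one ?_)))
    · refine Eventually.of_forall fun ξ => le_of_eq (congrArg _ ?_)
      change lerayAt ξ (bil (U τ) (U τ) ξ) = lerayAt ξ (vert (Θ τ ξ)) +
        -(-lerayAt ξ (bil (U τ) (U τ) ξ) + lerayAt ξ (vert (Θ τ ξ)))
      abel
    · exact Eventually.of_forall fun ξ => (enorm_neg _).le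
  obtain ⟨dA, hdA, eA⟩ := exists_duhInt_distribution (γ := α) ha hs ht hAm hAf
    (k := fun τ => leray (transport (u τ) (u τ))) (by
      filter_upwards [ae_restrict_mem hIm,
        ae_fnorm_bil_lt_top ha hσ hs hα hα r1 r1 hIm hU hU hM bU bU] with τ hτ hb
      have h := hu τ (Ioc_subset_Icc_self hτ)
      exact (h.transport h (hdiv τ (Ioc_subset_Icc_self hτ)) ha hs hb).leray ha hs hb)
  obtain ⟨dB, hdB, eB⟩ := exists_duhInt_distribution (γ := α) ha hs ht hBm hBf
    (k := fun τ => leray (buoyancy (θ τ))) (by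
      filter_upwards [ae_restrict_mem hIm] with τ hτ
      refine (hθ τ (Ioc_subset_Icc_self hτ)).buoyancy.leray ha hs (σ := σ) ?_
      refine (fnorm_mono_one (h := Θ τ) (Eventually.of_forall fun ξ => ?_)).trans_lt
        ((bΘ.1 τ hτ).trans_lt hM)
      rw [enorm_vert])
  have key := (hu t (right_mem_Icc.2 ht)).duhamel_iff (hw.heat ha hs fw α ht) (hdA.sub hdB)
  have hsplit : duhInt α (fun τ ξ => (force (U τ) (Θ τ) ξ).1) t =ᵐ[volume]
      duhInt α B t - duhInt α A t := by
    have e : (fun τ ξ => (force (U τ) (Θ τ) ξ).1) = B - A := by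
      funext τ ξ
      change -lerayAt ξ (bil (U τ) (U τ) ξ) + lerayAt ξ (vert (Θ τ ξ)) =
        lerayAt ξ (vert (Θ τ ξ)) - lerayAt ξ (bil (U τ) (U τ) ξ)
      abel
    rw [e]
    exact (duhInt_sub hBm hAm hBf hAf).symm
  have hduh : duh α w (fun τ ξ => (force (U τ) (Θ τ) ξ).1) t =ᵐ[volume]
      (fun ξ => heatSymbol α t ξ • w ξ) - (duhInt α A t - duhInt α B t) := by
    filter_upwards [hsplit] with ξ hξ
    rw [duh, hξ, Pi.sub_apply, Pi.sub_apply, Pi.sub_apply]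
    abel
  constructor
  · intro h
    refine (key.1 fun φ => ?_).trans hduh.symm
    rw [h φ, ← eA, ← eB]
    change _ = heat α t u₀ φ - (dA φ - dB φ)
    abel
  · intro h φ
    rw [key.2 (h.trans hduh) φ, ← eA, ← eB]
    change heat α t u₀ φ - (dA φ - dB φ) = _
    abel

/-- Duhamel's formula for the temperature, in terms of distributions and of Fourier transforms. -/
theorem mild_temperature_iff (ha : 0 ≤ a) (hσ : 1 ≤ σ) (hP : Subcritical α β s) (ht : 0 ≤ t)
    {U : ℝ → E3 → C3} {Θ : ℝ → E3 → ℂ} (hU : StronglyMeasurable (Function.uncurry U))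
    (hΘ : StronglyMeasurable (Function.uncurry Θ)) {M : ℝ≥0∞} (hM : M < ⊤)
    (bU : Bnd a σ s α (Ioc 0 t) M U) (bΘ : Bnd a σ s β (Ioc 0 t) M Θ)
    {u : ℝ → 𝓢'(E3, C3)} {θ : ℝ → 𝓢'(E3, ℂ)} (hu : ∀ τ ∈ Icc 0 t, HasFourierFn (u τ) (U τ))
    (hθ : ∀ τ ∈ Icc 0 t, HasFourierFn (θ τ) (Θ τ))
    (hdiv : ∀ τ ∈ Icc 0 t, ∀ᵐ ξ : E3, ∑ i, (ξ i : ℂ) * U τ ξ i = 0)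
    {θ₀ : 𝓢'(E3, ℂ)} {z : E3 → ℂ} (hz : HasFourierFn θ₀ z) (fz : fnorm a σ s z < ⊤) :
    (∀ φ : 𝓢(E3, ℂ), θ t φ = heat β t θ₀ φ
      - ∫ τ in (0 : ℝ)..t, heat β (t - τ) (transport (u τ) (θ τ)) φ) ↔
    Θ t =ᵐ[volume] duh β z (fun τ ξ => (force (U τ) (Θ τ) ξ).2) t := by
  have hs := hP.hs
  have r1 : -s / (2 * α) ≤ 1 := by
    have := hP.hα
    have : 0 < 1 / (2 * α) := by positivity
    linarith [hP.h₁]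
  have r2 : -s / (2 * β) ≤ 1 := by
    have := hP.hα
    have : 0 < 1 / (2 * α) := by positivity
    linarith [hP.h₂]
  have hIv : volume (Ioc 0 t) < ⊤ := by simp
  have hIm : MeasurableSet (Ioc 0 t) := measurableSet_Ioc
  have hF2 := (lintegral_fnorm_force_lt_top ha hσ hP hIv hIm hU hΘ hM bU bΘ).2
  set A : ℝ → E3 → ℂ := fun τ => bil (U τ) (Θ τ) with hA
  have hAm : StronglyMeasurable (Function.uncurry A) := stronglyMeasurable_bil hU hΘ
  have hAf : ∫⁻ τ in Ioc 0 t, fnorm a σ s (A τ) < ⊤ := by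
    refine lt_of_le_of_lt (lintegral_mono fun τ => ?_) hF2
    refine fnorm_mono_one (Eventually.of_forall fun ξ => ?_)
    change _ ≤ ‖-bil (U τ) (Θ τ) ξ‖ₑ
    rw [enorm_neg]
  obtain ⟨dA, hdA, eA⟩ := exists_duhInt_distribution (γ := β) ha hs ht hAm hAf
    (k := fun τ => transport (u τ) (θ τ)) (by
      filter_upwards [ae_restrict_mem hIm,
        ae_fnorm_bil_lt_top ha hσ hs hP.hα hP.hβ r2 r1 hIm hU hΘ hM bU bΘ] with τ hτ hb
      have h := Ioc_subset_Icc_self hτ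
      exact (hu τ h).transport (hθ τ h) (hdiv τ h) ha hs hb)
  have key := (hθ t (right_mem_Icc.2 ht)).duhamel_iff (hz.heat ha hs fz β ht) hdA
  have hduh : duh β z (fun τ ξ => (force (U τ) (Θ τ) ξ).2) t =
      (fun ξ => heatSymbol β t ξ • z ξ) - duhInt β A t := by
    funext ξ
    rw [duh, Pi.sub_apply, sub_eq_add_neg]
    congr 1
    rw [duhInt, duhInt, ← integral_neg]
    refine integral_congr_ae (Eventually.of_forall fun τ => ?_)
    exact smul_neg _ _
  rw [hduh, ← key]
  simp only [eA]

end Duhamel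

section Reality

theorem HasFourierFn.real_vector_iff {u : 𝓢'(E3, C3)} {g : E3 → C3} (h : HasFourierFn u g) :
    IsRealVector u ↔ ∀ᵐ ξ : E3, g (-ξ) = HasConj.cj (g ξ) := by
  have key := fun i : Fin 3 => h.real_iff (EuclideanSpace.proj i)
  constructor
  · intro hu
    have := ae_all_iff.2 fun i => (key i).1 fun φ hφ => hu φ hφ i
    filter_upwards [this] with ξ hξ
    ext i
    exact hξ i
  · intro hg φ hφ i
    refine (key i).2 ?_ φ hφ
    filter_upwards [hg] with ξ hξ
    rw [hξ]
    rfl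

theorem HasFourierFn.real_scalar_iff {θ : 𝓢'(E3, ℂ)} {g : E3 → ℂ} (h : HasFourierFn θ g) :
    IsRealScalar θ ↔ ∀ᵐ ξ : E3, g (-ξ) = HasConj.cj (g ξ) :=
  h.real_iff (ContinuousLinearMap.id ℂ ℂ)

theorem exists_herm_version {V : Type*} [NormedAddCommGroup V] [NormedSpace ℂ V] [CompleteSpace V]
    [SecondCountableTopology V] [HasConj V] {a σ s T : ℝ} {f : ℝ → 𝓢'(E3, V)}
    (hc : ContinuousInto a σ s T f)
    (hr : ∀ t ∈ Ico 0 T, ∀ g, HasFourierFn (f t) g → ∀ᵐ ξ : E3, g (-ξ) = HasConj.cj (g ξ)) :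
    ∃ G : ℝ → E3 → V, StronglyMeasurable (Function.uncurry G) ∧ (∀ t, Herm (G t)) ∧
      ∀ t ∈ Ico 0 T, HasFourierFn (f t) (G t) := by
  have hf : ∀ t ∈ Ico 0 T, HasFourierFn (f t) (fourierFn (f t)) := fun t ht =>
    exists_of_leiLinNorm_lt_top (hc t ht).1
  obtain ⟨G, hG, hGf⟩ := exists_version (a := a) (σ := σ) (s := s) (T := T)
    (g := fun t => fourierFn (f t)) (fun t ht => (hf t ht).aestronglyMeasurable)
    (fun t ht => by rw [← leiLinNorm_eq_fnorm (hf t ht)]; exact (hc t ht).1)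
    (fun t ht => by
      refine (hc t ht).2.congr' ?_
      filter_upwards [self_mem_nhdsWithin] with τ hτ
      exact ((hf τ hτ).sub (hf t ht)).leiLinNorm_eq a σ s)
  refine ⟨fun t => hermPart (G t), stronglyMeasurable_hermPart hG, fun t => herm_hermPart _,
    fun t ht => ?_⟩
  have h1 : HasFourierFn (f t) (G t) := (hf t ht).congr (hGf t ht).symm
  exact h1.congr (hermPart_ae_eq (hr t ht _ h1)).symm

theorem continuousInto_const {V : Type*} [NormedAddCommGroup V] [NormedSpace ℂ V] [CompleteSpace V]
    {a σ s T : ℝ} {f : 𝓢'(E3, V)} (hf : f ∈ LeiLinGevrey a σ s) :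
    ContinuousInto a σ s T fun _ => f := by
  refine fun t _ => ⟨hf, ?_⟩
  have h := exists_of_leiLinNorm_lt_top hf
  have : leiLinNorm a σ s (f - f) = 0 := by
    rw [(h.sub h).leiLinNorm_eq, sub_self]
    simp [fnorm]
  simp only [this]
  exact tendsto_const_nhds

end Reality

section FourierSolution

/-- Initial data on the Fourier side. -/
structure FourierData (a σ s : ℝ) (w : E3 → C3) (z : E3 → ℂ) : Prop where
  meas_w : StronglyMeasurable w
  meas_z : StronglyMeasurable z
  fin_w : fnorm a σ s w < ⊤
  fin_z : fnorm a σ s z < ⊤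
  herm_w : Herm w
  herm_z : Herm z
  div_w : ∀ᵐ ξ : E3, ∑ i, (ξ i : ℂ) * w ξ i = 0

/-- The velocity produced by a forcing. -/
def velocity (α : ℝ) (w : E3 → C3) (G : ℝ → E3 → C3 × ℂ) : ℝ → E3 → C3 :=
  duh α w fun τ ξ => (G τ ξ).1

/-- The temperature produced by a forcing. -/
def temperature (β : ℝ) (z : E3 → ℂ) (G : ℝ → E3 → C3 × ℂ) : ℝ → E3 → ℂ :=
  duh β z fun τ ξ => (G τ ξ).2

/-- A solution of the system on the Fourier side, given by its forcing. -/
structure FourierSolution (a σ s α β : ℝ) (w : E3 → C3) (z : E3 → ℂ) (T : ℝ)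
    (G : ℝ → E3 → C3 × ℂ) : Prop where
  meas : StronglyMeasurable (Function.uncurry G)
  herm : ∀ t, Herm (G t)
  fin : ∀ t ∈ Ico 0 T, ∫⁻ τ in Ioc 0 t, fnorm a σ s (G τ) < ⊤
  eq : ∀ᵐ t ∂(volume.restrict (Ioo 0 T)),
    G t =ᵐ[volume] force (velocity α w G t) (temperature β z G t)

theorem Herm.duh {V : Type*} [NormedAddCommGroup V] [NormedSpace ℂ V] [CompleteSpace V]
    [HasConj V] {γ : ℝ} {w : E3 → V} (hw : Herm w) {G : ℝ → E3 → V} (h : ∀ t, Herm (G t)) (t : ℝ) :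
    Herm (duh γ w G t) :=
  (hw.heat γ t).add (Herm.duhInt h t)

theorem fnorm_duh_le {V : Type*} [NormedAddCommGroup V] [NormedSpace ℂ V] {a σ s γ t τ : ℝ}
    (hτ : τ ∈ Icc 0 t) {w : E3 → V} {G : ℝ → E3 → V} (hw : StronglyMeasurable w)
    (hG : StronglyMeasurable (Function.uncurry G)) (h : ∫⁻ r in Ioc 0 t, fnorm a σ s (G r) < ⊤) :
    fnorm a σ s (duh γ w G τ) + ∫⁻ r in Ioc 0 τ, fnorm a σ (s + 2 * γ) (duh γ w G r) ≤
      fnorm a σ s w + ∫⁻ r in Ioc 0 t, fnorm a σ s (G r) := by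
  have hle := lintegral_mono_set (μ := volume) (f := fun r => fnorm a σ s (G r))
    (Ioc_subset_Ioc_right hτ.2 : Ioc 0 τ ⊆ Ioc 0 t)
  have := duh_energy (γ := γ) le_rfl hτ.1 hw hG (hle.trans_lt h)
  rw [duh_zero] at this
  exact this.trans (add_le_add le_rfl hle)

theorem bnd_duh {V : Type*} [NormedAddCommGroup V] [NormedSpace ℂ V] {a σ s γ t : ℝ} (ht : 0 ≤ t)
    {w : E3 → V} {G : ℝ → E3 → V} (hw : StronglyMeasurable w)
    (hG : StronglyMeasurable (Function.uncurry G)) (h : ∫⁻ r in Ioc 0 t, fnorm a σ s (G r) < ⊤) :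
    Bnd a σ s γ (Ioc 0 t) (fnorm a σ s w + ∫⁻ r in Ioc 0 t, fnorm a σ s (G r)) (duh γ w G) :=
  ⟨fun _ hτ => le_self_add.trans (fnorm_duh_le (Ioc_subset_Icc_self hτ) hw hG h),
    le_add_self.trans (fnorm_duh_le (right_mem_Icc.2 ht) hw hG h)⟩

variable {a σ s α β T : ℝ} {w : E3 → C3} {z : E3 → ℂ} {G : ℝ → E3 → C3 × ℂ}

theorem stronglyMeasurable_uncurry_fst (hG : StronglyMeasurable (Function.uncurry G)) :
    StronglyMeasurable (Function.uncurry fun τ ξ => (G τ ξ).1) := hG.fst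

theorem stronglyMeasurable_uncurry_snd (hG : StronglyMeasurable (Function.uncurry G)) :
    StronglyMeasurable (Function.uncurry fun τ ξ => (G τ ξ).2) := hG.snd

theorem lintegral_fnorm_fst_lt_top {I : Set ℝ} (h : ∫⁻ τ in I, fnorm a σ s (G τ) < ⊤) :
    ∫⁻ τ in I, fnorm a σ s (fun ξ => (G τ ξ).1) < ⊤ :=
  (lintegral_mono fun _ => fnorm_fst_le _).trans_lt h

theorem lintegral_fnorm_snd_lt_top {I : Set ℝ} (h : ∫⁻ τ in I, fnorm a σ s (G τ) < ⊤) :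
    ∫⁻ τ in I, fnorm a σ s (fun ξ => (G τ ξ).2) < ⊤ :=
  (lintegral_mono fun _ => fnorm_snd_le _).trans_lt h

theorem FourierData.stronglyMeasurable_velocity (hD : FourierData a σ s w z)
    (hG : StronglyMeasurable (Function.uncurry G)) (α : ℝ) :
    StronglyMeasurable (Function.uncurry (velocity α w G)) :=
  stronglyMeasurable_duh α hD.meas_w hG.fst

theorem FourierData.stronglyMeasurable_temperature (hD : FourierData a σ s w z)
    (hG : StronglyMeasurable (Function.uncurry G)) (β : ℝ) :
    StronglyMeasurable (Function.uncurry (temperature β z G)) :=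
  stronglyMeasurable_duh β hD.meas_z hG.snd

theorem FourierData.bnd (hD : FourierData a σ s w z) (hG : StronglyMeasurable (Function.uncurry G))
    {t : ℝ} (ht : 0 ≤ t) (h : ∫⁻ r in Ioc 0 t, fnorm a σ s (G r) < ⊤) (α β : ℝ) :
    ∃ M < ⊤, Bnd a σ s α (Ioc 0 t) M (velocity α w G) ∧
      Bnd a σ s β (Ioc 0 t) M (temperature β z G) := by
  have h1 := lintegral_fnorm_fst_lt_top h
  have h2 := lintegral_fnorm_snd_lt_top h
  refine ⟨_, ENNReal.add_lt_top.2 ⟨ENNReal.add_lt_top.2 ⟨hD.fin_w, h1⟩,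
    ENNReal.add_lt_top.2 ⟨hD.fin_z, h2⟩⟩, (bnd_duh ht hD.meas_w (stronglyMeasurable_uncurry_fst hG) h1).mono subset_rfl
    le_self_add, (bnd_duh ht hD.meas_z (stronglyMeasurable_uncurry_snd hG) h2).mono subset_rfl le_add_self⟩

/-- The divergence on the Fourier side. -/
def divAt (ξ : E3) : C3 →L[ℂ] ℂ := ∑ i, (ξ i : ℂ) • EuclideanSpace.proj i

theorem divAt_apply (ξ : E3) (v : C3) : divAt ξ v = ∑ i, (ξ i : ℂ) * v i := by
  simp [divAt]

theorem FourierSolution.div_velocity (hD : FourierData a σ s w z)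
    (h : FourierSolution a σ s α β w z T G) {t : ℝ} (ht : t ∈ Ico 0 T) :
    ∀ᵐ ξ : E3, ∑ i, (ξ i : ℂ) * velocity α w G t ξ i = 0 := by
  have hG1 := stronglyMeasurable_uncurry_fst h.meas
  have h1 : ∀ᵐ τ ∂(volume.restrict (Ioc 0 t)), ∀ᵐ ξ : E3, divAt ξ (G τ ξ).1 = 0 := by
    have hsub : Ioc 0 t ⊆ Ioo 0 T := fun τ hτ => ⟨hτ.1, hτ.2.trans_lt ht.2⟩
    filter_upwards [ae_restrict_of_ae_restrict_of_subset hsub h.eq] with τ hτ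
    filter_upwards [hτ] with ξ hξ
    rw [hξ]
    change divAt ξ (-lerayAt ξ _ + lerayAt ξ _) = 0
    rw [map_add, map_neg, divAt_apply, divAt_apply, sum_mul_lerayAt, sum_mul_lerayAt, neg_zero,
      add_zero]
  have hm : MeasurableSet {p : ℝ × E3 | divAt p.2 (G p.1 p.2).1 = 0} := by
    have : Measurable fun p : ℝ × E3 => divAt p.2 (G p.1 p.2).1 := by
      simp only [divAt_apply]
      have hc : ∀ i : Fin 3, Measurable fun p : ℝ × E3 => (G p.1 p.2).1 i := fun i =>
        (EuclideanSpace.proj (𝕜 := ℂ) i).continuous.measurable.comp hG1.measurable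
      have hx : ∀ i : Fin 3, Measurable fun p : ℝ × E3 => p.2 i := fun i =>
        (EuclideanSpace.proj (𝕜 := ℝ) i).continuous.measurable.comp measurable_snd
      exact Finset.measurable_sum _ fun i _ =>
        (Complex.measurable_ofReal.comp (hx i)).mul (hc i)
    exact this (measurableSet_singleton 0)
  filter_upwards [(Measure.ae_ae_comm hm).1 h1, hD.div_w,
    ae_integrableOn_of_fnorm hG1 (lintegral_fnorm_fst_lt_top (h.fin t ht))] with ξ hξ hw hi
  rw [← divAt_apply] at hw ⊢
  rw [velocity, duh, map_add, map_smul, hw, smul_zero, zero_add, duhInt,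
    ← (divAt ξ).integral_comp_comm
      (integrableOn_duhamel (G := fun τ ξ => (G τ ξ).1) Ioc_subset_Iic_self measurableSet_Ioc hi)]
  refine integral_eq_zero_of_ae ?_
  filter_upwards [hξ] with τ hτ
  rw [map_smul, hτ, smul_zero]
  rfl

end FourierSolution

section Correspondence

variable {a σ s α β T : ℝ} {w : E3 → C3} {z : E3 → ℂ} {G : ℝ → E3 → C3 × ℂ}
  {u₀ : 𝓢'(E3, C3)} {θ₀ : 𝓢'(E3, ℂ)} {u : ℝ → 𝓢'(E3, C3)} {θ : ℝ → 𝓢'(E3, ℂ)}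

theorem continuousInto_duh [CompleteSpace F] {γ : ℝ} {w : E3 → F} {G : ℝ → E3 → F}
    {f : ℝ → 𝓢'(E3, F)} (hw : StronglyMeasurable w) (hG : StronglyMeasurable (Function.uncurry G))
    (fw : fnorm a σ s w < ⊤) (h : ∀ t ∈ Ico 0 T, ∫⁻ τ in Ioc 0 t, fnorm a σ s (G τ) < ⊤)
    (hf : ∀ t ∈ Ico 0 T, HasFourierFn (f t) (duh γ w G t)) : ContinuousInto a σ s T f := by
  refine fun t ht => ⟨?_, ?_⟩
  · change leiLinNorm a σ s (f t) < ⊤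
    rw [(hf t ht).leiLinNorm_eq]
    exact (le_self_add.trans (fnorm_duh_le (right_mem_Icc.2 ht.1) hw hG (h t ht))).trans_lt
      (ENNReal.add_lt_top.2 ⟨fw, h t ht⟩)
  · refine (tendsto_fnorm_duh_sub (γ := γ) ht hw hG fw
      fun T' hT' => h T' ⟨hT'.1.le, hT'.2⟩).congr' ?_
    filter_upwards [self_mem_nhdsWithin] with τ hτ
    exact (((hf τ hτ).sub (hf t ht)).leiLinNorm_eq a σ s).symm

theorem locallyL1Into_duh [CompleteSpace F] {γ : ℝ} {w : E3 → F} {G : ℝ → E3 → F}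
    {f : ℝ → 𝓢'(E3, F)} (hw : StronglyMeasurable w) (hG : StronglyMeasurable (Function.uncurry G))
    (fw : fnorm a σ s w < ⊤) (h : ∀ t ∈ Ico 0 T, ∫⁻ τ in Ioc 0 t, fnorm a σ s (G τ) < ⊤)
    (hf : ∀ t ∈ Ico 0 T, HasFourierFn (f t) (duh γ w G t)) :
    LocallyL1Into a σ (s + 2 * γ) T f := by
  intro T' hT'
  have hT0 : T' ∈ Ico 0 T := ⟨hT'.1.le, hT'.2⟩
  rw [← setLIntegral_congr Ioc_ae_eq_Icc,
    setLIntegral_congr_fun (g := fun t => fnorm a σ (s + 2 * γ) (duh γ w G t)) measurableSet_Ioc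
      fun t ht => (hf t ⟨ht.1.le, ht.2.trans_lt hT'.2⟩).leiLinNorm_eq a σ _]
  exact (le_add_self.trans (fnorm_duh_le (right_mem_Icc.2 hT'.1.le) hw hG (h T' hT0))).trans_lt
    (ENNReal.add_lt_top.2 ⟨fw, h T' hT0⟩)

theorem FourierSolution.isMildSolution (ha : 0 ≤ a) (hσ : 1 ≤ σ) (hP : Subcritical α β s)
    (hD : FourierData a σ s w z) (h : FourierSolution a σ s α β w z T G)
    (hw : HasFourierFn u₀ w) (hz : HasFourierFn θ₀ z)
    (hu : ∀ t ∈ Ico 0 T, HasFourierFn (u t) (velocity α w G t))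
    (hθ : ∀ t ∈ Ico 0 T, HasFourierFn (θ t) (temperature β z G t)) :
    IsMildSolution a σ s α β u₀ θ₀ T u θ := by
  have m1 := stronglyMeasurable_uncurry_fst h.meas
  have m2 := stronglyMeasurable_uncurry_snd h.meas
  have mU := hD.stronglyMeasurable_velocity h.meas α
  have mΘ := hD.stronglyMeasurable_temperature h.meas β
  have mF := stronglyMeasurable_force mU mΘ
  have i1 := fun t ht => lintegral_fnorm_fst_lt_top (h.fin t ht)
  have i2 := fun t ht => lintegral_fnorm_snd_lt_top (h.fin t ht)
  have hdiv := fun t ht => h.div_velocity hD (t := t) ht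
  have hsub : ∀ t ∈ Ico 0 T, Ioc 0 t ⊆ Ioo 0 T := fun t ht τ hτ => ⟨hτ.1, hτ.2.trans_lt ht.2⟩
  have hIco : ∀ t ∈ Ico 0 T, ∀ τ ∈ Icc 0 t, τ ∈ Ico 0 T := fun t ht τ hτ =>
    ⟨hτ.1, hτ.2.trans_lt ht.2⟩
  refine ⟨fun t ht => ?_, fun t ht => ?_, fun t ht => ?_, ?_, ?_, ?_, ?_, fun t ht => ?_,
    fun t ht => ?_⟩
  · exact (hu t ht).real_vector_iff.2 (Eventually.of_forall
      (hD.herm_w.duh (fun τ => (h.herm τ).fst) t))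
  · exact (hθ t ht).real_scalar_iff.2 (Eventually.of_forall
      (hD.herm_z.duh (fun τ => (h.herm τ).snd) t))
  · exact (hu t ht).divFree_iff.2 (hdiv t ht)
  · exact continuousInto_duh hD.meas_w m1 hD.fin_w i1 hu
  · exact continuousInto_duh hD.meas_z m2 hD.fin_z i2 hθ
  · exact locallyL1Into_duh hD.meas_w m1 hD.fin_w i1 hu
  · exact locallyL1Into_duh hD.meas_z m2 hD.fin_z i2 hθ
  · obtain ⟨M, hM, bU, bΘ⟩ := hD.bnd h.meas ht.1 (h.fin t ht) α β
    refine (mild_velocity_iff ha hσ hP ht.1 mU mΘ hM bU bΘ (fun τ hτ => hu τ (hIco t ht τ hτ))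
      (fun τ hτ => hθ τ (hIco t ht τ hτ)) (fun τ hτ => hdiv τ (hIco t ht τ hτ)) hw hD.fin_w).2 ?_
    have := duhInt_congr_ae (γ := α) (t := t) m1 (stronglyMeasurable_uncurry_fst mF) (by
      filter_upwards [ae_restrict_of_ae_restrict_of_subset (hsub t ht) h.eq] with τ hτ
      filter_upwards [hτ] with ξ hξ
      rw [hξ])
    filter_upwards [this] with ξ hξ
    rw [velocity, duh, hξ, duh]
    rfl
  · obtain ⟨M, hM, bU, bΘ⟩ := hD.bnd h.meas ht.1 (h.fin t ht) α β
    refine (mild_temperature_iff ha hσ hP ht.1 mU mΘ hM bU bΘ (fun τ hτ => hu τ (hIco t ht τ hτ))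
      (fun τ hτ => hθ τ (hIco t ht τ hτ)) (fun τ hτ => hdiv τ (hIco t ht τ hτ)) hz hD.fin_z).2 ?_
    have := duhInt_congr_ae (γ := β) (t := t) m2 (stronglyMeasurable_uncurry_snd mF) (by
      filter_upwards [ae_restrict_of_ae_restrict_of_subset (hsub t ht) h.eq] with τ hτ
      filter_upwards [hτ] with ξ hξ
      rw [hξ])
    filter_upwards [this] with ξ hξ
    rw [temperature, duh, hξ, duh]
    rfl

theorem exists_fourierData (hu : u₀ ∈ LeiLinGevrey a σ s) (hθ : θ₀ ∈ LeiLinGevrey a σ s)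
    (ru : IsRealVector u₀) (rθ : IsRealScalar θ₀) (du : DivFree u₀) :
    ∃ w z, FourierData a σ s w z ∧ HasFourierFn u₀ w ∧ HasFourierFn θ₀ z := by
  have h0 : (0 : ℝ) ∈ Ico (0 : ℝ) 1 := ⟨le_rfl, one_pos⟩
  obtain ⟨W, mW, hW, fW⟩ := exists_herm_version (T := 1) (continuousInto_const hu)
    fun t _ g hg => hg.real_vector_iff.1 ru
  obtain ⟨Z, mZ, hZ, fZ⟩ := exists_herm_version (T := 1) (continuousInto_const hθ)
    fun t _ g hg => hg.real_scalar_iff.1 rθ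
  refine ⟨W 0, Z 0, ⟨StronglyMeasurable.slice mW 0, StronglyMeasurable.slice mZ 0, ?_, ?_, hW 0,
    hZ 0, (fW 0 h0).divFree_iff.1 du⟩, fW 0 h0, fZ 0 h0⟩
  · rw [← (fW 0 h0).leiLinNorm_eq]; exact hu
  · rw [← (fZ 0 h0).leiLinNorm_eq]; exact hθ

theorem fnorm_le_add_fnorm_sub {V : Type*} [NormedAddCommGroup V] {r : ℝ} {f g : E3 → V}
    (hg : AEStronglyMeasurable g) : fnorm a σ r f ≤ fnorm a σ r g + fnorm a σ r (f - g) := by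
  have := aemeasurable_wt_mul (a := a) (σ := σ) (r := r) hg
  rw [fnorm, fnorm, fnorm, ← lintegral_add_left' this]
  refine lintegral_mono fun ξ => ?_
  rw [← mul_add]
  gcongr
  have := enorm_add_le (g ξ) (f ξ - g ξ)
  simpa using this

theorem ContinuousInto.continuousOn [CompleteSpace F] {f : ℝ → 𝓢'(E3, F)}
    (h : ContinuousInto a σ s T f) : ContinuousOn (fun t => leiLinNorm a σ s (f t)) (Ico 0 T) := by
  have hf : ∀ t ∈ Ico 0 T, HasFourierFn (f t) (fourierFn (f t)) := fun t ht =>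
    exists_of_leiLinNorm_lt_top (h t ht).1
  intro t ht
  have hlim := (h t ht).2
  have e1 : ∀ τ ∈ Ico 0 T, leiLinNorm a σ s (f τ) ≤
      leiLinNorm a σ s (f t) + leiLinNorm a σ s (f τ - f t) := by
    intro τ hτ
    rw [(hf τ hτ).leiLinNorm_eq, (hf t ht).leiLinNorm_eq,
      ((hf τ hτ).sub (hf t ht)).leiLinNorm_eq]
    exact fnorm_le_add_fnorm_sub (hf t ht).aestronglyMeasurable
  have e2 : ∀ τ ∈ Ico 0 T, leiLinNorm a σ s (f t) ≤
      leiLinNorm a σ s (f τ) + leiLinNorm a σ s (f τ - f t) := by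
    intro τ hτ
    rw [(hf τ hτ).leiLinNorm_eq, (hf t ht).leiLinNorm_eq,
      ((hf τ hτ).sub (hf t ht)).leiLinNorm_eq]
    refine (fnorm_le_add_fnorm_sub (hf τ hτ).aestronglyMeasurable).trans (add_le_add le_rfl (fnorm_mono_one
        (Eventually.of_forall fun ξ => ?_)))
    rw [Pi.sub_apply, Pi.sub_apply, enorm_sub_rev]
  refine tendsto_of_tendsto_of_tendsto_of_le_of_le'
    (g := fun τ => leiLinNorm a σ s (f t) - leiLinNorm a σ s (f τ - f t))
    (h := fun τ => leiLinNorm a σ s (f t) + leiLinNorm a σ s (f τ - f t)) ?_ ?_ ?_ ?_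
  · simpa using ENNReal.Tendsto.sub tendsto_const_nhds hlim (Or.inl (h t ht).1.ne)
  · simpa using hlim.const_add (leiLinNorm a σ s (f t))
  · filter_upwards [self_mem_nhdsWithin] with τ hτ using tsub_le_iff_right.2 (e2 τ hτ)
  · filter_upwards [self_mem_nhdsWithin] with τ hτ using e1 τ hτ

/-- A uniform bound for a solution on a compact time interval. -/
theorem exists_bnd [CompleteSpace F] {γ t : ℝ} (ht : t ∈ Ico 0 T) {f : ℝ → 𝓢'(E3, F)}
    (h : ContinuousInto a σ s T f) (hi : LocallyL1Into a σ (s + 2 * γ) T f) {U : ℝ → E3 → F}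
    (hU : ∀ t ∈ Ico 0 T, HasFourierFn (f t) (U t)) :
    ∃ M < ⊤, Bnd a σ s γ (Ioc 0 t) M U := by
  have hsub : Icc 0 t ⊆ Ico 0 T := fun τ hτ => ⟨hτ.1, hτ.2.trans_lt ht.2⟩
  obtain ⟨x, hx, hmax⟩ := isCompact_Icc.exists_isMaxOn (nonempty_Icc.2 ht.1)
    (h.continuousOn.mono hsub)
  have hfin : ∫⁻ τ in Ioc 0 t, fnorm a σ (s + 2 * γ) (U τ) < ⊤ := by
    rcases ht.1.eq_or_lt with h0 | h0
    · simp [← h0]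
    · rw [setLIntegral_congr_fun (g := fun τ => leiLinNorm a σ (s + 2 * γ) (f τ)) measurableSet_Ioc
        fun τ hτ => ((hU τ (hsub (Ioc_subset_Icc_self hτ))).leiLinNorm_eq a σ _).symm,
        setLIntegral_congr Ioc_ae_eq_Icc]
      exact hi t ⟨h0, ht.2⟩
  refine ⟨_, ENNReal.add_lt_top.2 ⟨(h x (hsub hx)).1, hfin⟩, fun τ hτ => ?_, le_add_self⟩
  rw [← (hU τ (hsub (Ioc_subset_Icc_self hτ))).leiLinNorm_eq]
  exact (hmax (Ioc_subset_Icc_self hτ)).trans le_self_add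

theorem IsMildSolution.exists_fourierSolution (ha : 0 ≤ a) (hσ : 1 ≤ σ) (hP : Subcritical α β s)
    (hD : FourierData a σ s w z) (hw : HasFourierFn u₀ w) (hz : HasFourierFn θ₀ z)
    (h : IsMildSolution a σ s α β u₀ θ₀ T u θ) :
    ∃ G, FourierSolution a σ s α β w z T G ∧
      (∀ t ∈ Ico 0 T, HasFourierFn (u t) (velocity α w G t)) ∧
      ∀ t ∈ Ico 0 T, HasFourierFn (θ t) (temperature β z G t) := by
  obtain ⟨U, mU, hU, fU⟩ := exists_herm_version h.cont_u
    fun t ht g hg => hg.real_vector_iff.1 (h.real_u t ht)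
  obtain ⟨Θ, mΘ, hΘ, fΘ⟩ := exists_herm_version h.cont_θ
    fun t ht g hg => hg.real_scalar_iff.1 (h.real_θ t ht)
  have hIco : ∀ t ∈ Ico 0 T, ∀ τ ∈ Icc 0 t, τ ∈ Ico 0 T := fun t ht τ hτ =>
    ⟨hτ.1, hτ.2.trans_lt ht.2⟩
  have hdiv : ∀ t ∈ Ico 0 T, ∀ᵐ ξ : E3, ∑ i, (ξ i : ℂ) * U t ξ i = 0 := fun t ht =>
    (fU t ht).divFree_iff.1 (h.div_u t ht)
  set G : ℝ → E3 → C3 × ℂ := fun t => force (U t) (Θ t) with hG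
  have hb : ∀ t ∈ Ico 0 T, ∃ M < ⊤, Bnd a σ s α (Ioc 0 t) M U ∧ Bnd a σ s β (Ioc 0 t) M Θ := by
    intro t ht
    obtain ⟨M, hM, b⟩ := exists_bnd ht h.cont_u h.int_u fU
    obtain ⟨M', hM', b'⟩ := exists_bnd ht h.cont_θ h.int_θ fΘ
    exact ⟨M + M', ENNReal.add_lt_top.2 ⟨hM, hM'⟩, b.mono subset_rfl le_self_add,
      b'.mono subset_rfl le_add_self⟩
  have mG : StronglyMeasurable (Function.uncurry G) := stronglyMeasurable_force mU mΘ
  have e1 : ∀ t ∈ Ico 0 T, U t =ᵐ[volume] velocity α w G t := by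
    intro t ht
    obtain ⟨M, hM, bU, bΘ⟩ := hb t ht
    exact (mild_velocity_iff ha hσ hP ht.1 mU mΘ hM bU bΘ (fun τ hτ => fU τ (hIco t ht τ hτ))
      (fun τ hτ => fΘ τ (hIco t ht τ hτ)) (fun τ hτ => hdiv τ (hIco t ht τ hτ)) hw hD.fin_w).1
      (h.eq_u t ht)
  have e2 : ∀ t ∈ Ico 0 T, Θ t =ᵐ[volume] temperature β z G t := by
    intro t ht
    obtain ⟨M, hM, bU, bΘ⟩ := hb t ht
    exact (mild_temperature_iff ha hσ hP ht.1 mU mΘ hM bU bΘ (fun τ hτ => fU τ (hIco t ht τ hτ))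
      (fun τ hτ => fΘ τ (hIco t ht τ hτ)) (fun τ hτ => hdiv τ (hIco t ht τ hτ)) hz hD.fin_z).1
      (h.eq_θ t ht)
  refine ⟨G, ⟨mG, fun t => (hU t).force (hΘ t), fun t ht => ?_, ?_⟩,
    fun t ht => (fU t ht).congr (e1 t ht), fun t ht => (fΘ t ht).congr (e2 t ht)⟩
  · obtain ⟨M, hM, bU, bΘ⟩ := hb t ht
    have hfin := lintegral_fnorm_force_lt_top ha hσ hP (I := Ioc 0 t) (by simp) measurableSet_Ioc
      mU mΘ hM bU bΘ
    refine lt_of_le_of_lt ?_ (ENNReal.add_lt_top.2 hfin)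
    rw [← lintegral_add_left (measurable_fnorm (stronglyMeasurable_uncurry_fst mG))]
    exact lintegral_mono fun τ =>
      fnorm_prod_le (StronglyMeasurable.slice mG τ).aestronglyMeasurable
  · filter_upwards [ae_restrict_mem measurableSet_Ioo] with t ht
    have ht' := Ioo_subset_Ico_self ht
    exact force_congr (e1 t ht') (e2 t ht')

end Correspondence

section Extension

variable {a σ s α β T : ℝ} {w : E3 → C3} {z : E3 → ℂ} {G : ℝ → E3 → C3 × ℂ}

theorem duh_congr_of_eq {V : Type*} [NormedAddCommGroup V] [NormedSpace ℂ V] {γ t : ℝ} {w : E3 → V}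
    {G G' : ℝ → E3 → V} (h : ∀ τ ∈ Ioc 0 t, G τ = G' τ) : duh γ w G t = duh γ w G' t := by
  funext ξ
  rw [duh, duh, duhInt, duhInt]
  congr 1
  exact setIntegral_congr_fun measurableSet_Ioc fun τ hτ => by simp only [h τ hτ]

theorem duh_add {V : Type*} [NormedAddCommGroup V] [NormedSpace ℂ V] {γ t : ℝ} {w : E3 → V}
    {G G' : ℝ → E3 → V} (hG : StronglyMeasurable (Function.uncurry G))
    (hG' : StronglyMeasurable (Function.uncurry G'))
    (h : ∫⁻ τ in Ioc 0 t, fnorm a σ s (G τ) < ⊤) (h' : ∫⁻ τ in Ioc 0 t, fnorm a σ s (G' τ) < ⊤) :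
    duh γ w (G + G') t =ᵐ[volume] duh γ w G t + duhInt γ G' t := by
  filter_upwards [ae_integrableOn_of_fnorm hG h, ae_integrableOn_of_fnorm hG' h'] with ξ i1 i2
  rw [Pi.add_apply, duh, duh, add_assoc]
  congr 1
  rw [duhInt, duhInt, duhInt, ← integral_add
    (integrableOn_duhamel Ioc_subset_Iic_self measurableSet_Ioc i1)
    (integrableOn_duhamel Ioc_subset_Iic_self measurableSet_Ioc i2)]
  refine integral_congr_ae (Eventually.of_forall fun τ => ?_)
  exact smul_add _ _ _

theorem FourierSolution.exists_extension (ha : 0 ≤ a) (hσ : 1 ≤ σ) (hP : Subcritical α β s)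
    (hT : 0 ≤ T) (hD : FourierData a σ s w z) (h : FourierSolution a σ s α β w z T G)
    (hfin : ∫⁻ τ in Ioc 0 T, fnorm a σ s (G τ) < ⊤) :
    ∃ T' > T, ∃ G', FourierSolution a σ s α β w z T' G' ∧ ∀ t ∈ Ico 0 T,
      velocity α w G' t = velocity α w G t ∧ temperature β z G' t = temperature β z G t := by
  set K : ℝ → E3 → C3 × ℂ := (Iio T).indicator G with hK
  have mK : StronglyMeasurable (Function.uncurry K) := by
    have : Function.uncurry K = (Prod.fst ⁻¹' Iio T).indicator (Function.uncurry G) := by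
      funext p
      by_cases hp : p.1 < T
      · rw [indicator_of_mem (show p ∈ Prod.fst ⁻¹' Iio T from hp), Function.uncurry_def]
        simp only [hK]
        rw [indicator_of_mem (show p.1 ∈ Iio T from hp)]
        rfl
      · rw [indicator_of_notMem (show p ∉ Prod.fst ⁻¹' Iio T from hp), Function.uncurry_def]
        simp only [hK]
        rw [indicator_of_notMem (show p.1 ∉ Iio T from hp)]
        rfl
    rw [this]
    exact h.meas.indicator (measurable_fst measurableSet_Iio)
  have hKh : ∀ t, Herm (K t) := by
    intro t
    by_cases ht : t < T
    · rw [hK, indicator_of_mem (show t ∈ Iio T from ht)]; exact h.herm t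
    · rw [hK, indicator_of_notMem (show t ∉ Iio T from ht)]; exact herm_zero
  have hKle : ∀ A : Set ℝ, A ⊆ Ioi 0 → ∫⁻ τ in A, fnorm a σ s (K τ) < ⊤ := by
    intro A hA
    refine lt_of_le_of_lt ?_ hfin
    have e : ∀ τ, fnorm a σ s (K τ) = (Iio T).indicator (fun τ => fnorm a σ s (G τ)) τ := by
      intro τ
      by_cases ht : τ < T
      · rw [hK, indicator_of_mem (show τ ∈ Iio T from ht), indicator_of_mem (show τ ∈ Iio T from ht)]
      · rw [hK, indicator_of_notMem (show τ ∉ Iio T from ht),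
          indicator_of_notMem (show τ ∉ Iio T from ht)]
        simp [fnorm]
    simp only [e]
    rw [setLIntegral_indicator measurableSet_Iio]
    exact lintegral_mono_set fun τ hτ => ⟨hA hτ.2, le_of_lt hτ.1⟩
  have hT1 : 0 ≤ T + 1 := by linarith
  have hI : Ioc 0 (T + 1) ⊆ Ioi (0 : ℝ) := fun _ hτ => hτ.1
  have hI' : ∀ t : ℝ, Ioc 0 t ⊆ Ioi (0 : ℝ) := fun _ _ hτ => hτ.1
  obtain ⟨M, hM, bW, bZ⟩ := hD.bnd mK hT1 (hKle _ hI) α β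
  have hsub : Ioc T (T + 1) ⊆ Ioc 0 (T + 1) := Ioc_subset_Ioc_left hT
  obtain ⟨δ, hδ, H, mH, sH, hH, fH, eH⟩ := exists_local_forcing ha hσ hP hT
    (hD.stronglyMeasurable_velocity mK α) (hD.stronglyMeasurable_temperature mK β)
    (fun t => hD.herm_w.duh (fun τ => (hKh τ).fst) t)
    (fun t => hD.herm_z.duh (fun τ => (hKh τ).snd) t) hM (bW.mono hsub le_rfl)
    (bZ.mono hsub le_rfl)
  have mKH : StronglyMeasurable (Function.uncurry (K + H)) := mK.add mH
  have hold : ∀ t < T, (K + H) t = G t := by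
    intro t ht
    rw [Pi.add_apply, hK, indicator_of_mem (show t ∈ Iio T from ht)]
    funext ξ
    rw [Pi.add_apply, sH t (fun h => h.1.not_gt ht), add_zero]
  have hnew : ∀ t, T ≤ t → (K + H) t = H t := by
    intro t ht
    rw [Pi.add_apply, hK, indicator_of_notMem (show t ∉ Iio T from not_lt.2 ht), zero_add]
  have fH' : ∀ t, ∫⁻ τ in Ioc 0 t, fnorm a σ s (H τ) < ⊤ := fun t =>
    (lintegral_Ioc_of_support sH).trans_lt fH
  have ev : ∀ t ∈ Ico 0 T, velocity α w (K + H) t = velocity α w G t := fun t ht =>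
    duh_congr_of_eq fun τ hτ => by rw [hold τ (hτ.2.trans_lt ht.2)]
  have et : ∀ t ∈ Ico 0 T, temperature β z (K + H) t = temperature β z G t := fun t ht =>
    duh_congr_of_eq fun τ hτ => by rw [hold τ (hτ.2.trans_lt ht.2)]
  refine ⟨T + δ, lt_add_of_pos_right _ hδ.1, K + H, ⟨mKH, fun t => (hKh t).add (hH t),
    fun t _ => ?_, ?_⟩, fun t ht => ⟨ev t ht, et t ht⟩⟩
  · refine lt_of_le_of_lt ?_ (ENNReal.add_lt_top.2 ⟨hKle _ (hI' t), fH' t⟩)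
    rw [← lintegral_add_left (measurable_fnorm mK)]
    exact lintegral_mono fun τ => fnorm_add_le (StronglyMeasurable.slice mK τ).aestronglyMeasurable
  · have hcover : Ioo 0 (T + δ) ⊆ Ioo 0 T ∪ ({T} ∪ Ioc T (T + δ)) := by
      intro t ht
      rcases lt_trichotomy t T with h1 | h1 | h1
      · exact Or.inl ⟨ht.1, h1⟩
      · exact Or.inr (Or.inl h1)
      · exact Or.inr (Or.inr ⟨h1, ht.2.le⟩)
    refine ae_restrict_of_ae_restrict_of_subset hcover ?_
    rw [ae_restrict_union_iff, ae_restrict_union_iff]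
    refine ⟨?_, ?_, ?_⟩
    · filter_upwards [h.eq, ae_restrict_mem measurableSet_Ioo] with t h1 h2
      rw [hold t h2.2, ev t ⟨h2.1.le, h2.2⟩, et t ⟨h2.1.le, h2.2⟩]
      exact h1
    · rw [Measure.restrict_eq_zero.2 (by simp)]
      simp
    · filter_upwards [eH, ae_restrict_mem measurableSet_Ioc] with t h1 h2
      rw [hnew t h2.1.le]
      refine h1.trans (force_congr ?_ ?_)
      · exact (duh_add (stronglyMeasurable_uncurry_fst mK) (stronglyMeasurable_uncurry_fst mH)
          (lintegral_fnorm_fst_lt_top (hKle _ (hI' t))) (lintegral_fnorm_fst_lt_top (fH' t))).symm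
      · exact (duh_add (stronglyMeasurable_uncurry_snd mK) (stronglyMeasurable_uncurry_snd mH)
          (lintegral_fnorm_snd_lt_top (hKle _ (hI' t))) (lintegral_fnorm_snd_lt_top (fH' t))).symm

end Extension

section Gronwall

variable {t₀ T : ℝ}

theorem hasDerivAt_primitive {g : ℝ → ℝ} (hg : ContinuousOn g (Ico t₀ T)) {τ : ℝ}
    (hτ : τ ∈ Ioo t₀ T) : HasDerivAt (fun t => ∫ r in t₀..t, g r) (g τ) τ := by
  refine intervalIntegral.integral_hasDerivAt_right ?_ ?_ ?_
  · refine (hg.mono ?_).intervalIntegrable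
    rw [uIcc_of_le hτ.1.le]
    exact fun r hr => ⟨hr.1, hr.2.trans_lt hτ.2⟩
  · exact (hg.mono Ioo_subset_Ico_self).stronglyMeasurableAtFilter isOpen_Ioo τ hτ
  · exact hg.continuousAt (Ico_mem_nhds hτ.1 hτ.2)

theorem continuousOn_primitive {g : ℝ → ℝ} (hg : ContinuousOn g (Ico t₀ T)) :
    ContinuousOn (fun t => ∫ r in t₀..t, g r) (Ico t₀ T) := by
  intro τ hτ
  obtain ⟨T', h1, h2⟩ := exists_between hτ.2
  have hle : t₀ ≤ T' := hτ.1.trans h1.le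
  have hi : IntegrableOn g (uIcc t₀ T') := by
    rw [uIcc_of_le hle]
    exact (hg.mono fun r hr => ⟨hr.1, hr.2.trans_lt h2⟩).integrableOn_Icc
  have hc := intervalIntegral.continuousOn_primitive_interval hi
  rw [uIcc_of_le hle] at hc
  refine (hc τ ⟨hτ.1, h1.le⟩).mono_of_mem_nhdsWithin ?_
  filter_upwards [self_mem_nhdsWithin, mem_nhdsWithin_of_mem_nhds (Iio_mem_nhds h1)] with r h3 h4
  exact ⟨h3.1, le_of_lt h4⟩

theorem gronwall {n k : ℝ → ℝ} (hn : ContinuousOn n (Ico t₀ T)) (hk : ContinuousOn k (Ico t₀ T))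
    (hk0 : ∀ t ∈ Ico t₀ T, 0 ≤ k t)
    (h : ∀ t ∈ Ico t₀ T, n t ≤ n t₀ + ∫ τ in t₀..t, k τ * n τ) {t : ℝ} (ht : t ∈ Ico t₀ T) :
    n t ≤ n t₀ * Real.exp (∫ τ in t₀..t, k τ) := by
  have hkn : ContinuousOn (fun t => k t * n t) (Ico t₀ T) := hk.mul hn
  set φ : ℝ → ℝ := fun t => (n t₀ + ∫ τ in t₀..t, k τ * n τ) * Real.exp (-∫ τ in t₀..t, k τ)
    with hφ
  have hd : ∀ τ ∈ Ioo t₀ T, HasDerivAt φ ((k τ * n τ) * Real.exp (-∫ τ in t₀..τ, k τ) +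
      (n t₀ + ∫ τ in t₀..τ, k τ * n τ) * (Real.exp (-∫ τ in t₀..τ, k τ) * -k τ)) τ := fun τ hτ =>
    ((hasDerivAt_primitive hkn hτ).const_add _).mul (hasDerivAt_primitive hk hτ).neg.exp
  have hanti : AntitoneOn φ (Ico t₀ T) := by
    refine antitoneOn_of_deriv_nonpos (convex_Ico _ _) ?_ ?_ ?_
    · exact (continuousOn_const.add (continuousOn_primitive hkn)).mul
        (Real.continuous_exp.comp_continuousOn (continuousOn_primitive hk).neg)
    · rw [interior_Ico]
      exact fun τ hτ => (hd τ hτ).differentiableAt.differentiableWithinAt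
    · rw [interior_Ico]
      intro τ hτ
      rw [(hd τ hτ).deriv]
      have h1 := h τ (Ioo_subset_Ico_self hτ)
      have h2 := hk0 τ (Ioo_subset_Ico_self hτ)
      have h3 := Real.exp_pos (-∫ τ in t₀..τ, k τ)
      nlinarith [mul_nonneg (mul_nonneg h2 h3.le) (sub_nonneg.2 h1)]
  have h0 : t₀ ∈ Ico t₀ T := ⟨le_rfl, ht.1.trans_lt ht.2⟩
  have := hanti h0 ht ht.1
  simp only [hφ, intervalIntegral.integral_same, add_zero, Real.exp_neg,
    Real.exp_zero, inv_one, mul_one] at this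
  rw [mul_inv_le_iff₀ (Real.exp_pos _)] at this
  exact (h t ht).trans this

/-- A continuous function that grows at most like the exponential of its own primitive cannot
become unbounded too early. -/
theorem exists_bound_of_small {P : ℝ → ℝ} {c : ℝ} (hP : ContinuousOn P (Ico t₀ T)) (hT : t₀ < T)
    (hc : 0 < c) (hP0 : ∀ t ∈ Ico t₀ T, 0 ≤ P t)
    (h : ∀ t ∈ Ico t₀ T, P t ≤ P t₀ * Real.exp (c * ∫ τ in t₀..t, (1 + P τ)))
    (hsmall : P t₀ * (Real.exp (c * (T - t₀)) - 1) < 1) : ∃ B, ∀ t ∈ Ico t₀ T, P t ≤ B := by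
  have h0 : t₀ ∈ Ico t₀ T := ⟨le_rfl, hT⟩
  have hQ : ContinuousOn (fun t => 1 + P t) (Ico t₀ T) := continuousOn_const.add hP
  set E : ℝ → ℝ := fun t => Real.exp (-(c * ∫ τ in t₀..t, (1 + P τ))) with hE
  set φ : ℝ → ℝ := fun t => (E t + P t₀) * Real.exp (c * (t - t₀)) with hφ
  have hEd : ∀ τ ∈ Ioo t₀ T, HasDerivAt E (E τ * -(c * (1 + P τ))) τ := fun τ hτ =>
    ((hasDerivAt_primitive hQ hτ).const_mul c).neg.exp
  have hd : ∀ τ ∈ Ioo t₀ T, HasDerivAt φ ((E τ * -(c * (1 + P τ))) * Real.exp (c * (τ - t₀)) +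
      (E τ + P t₀) * (Real.exp (c * (τ - t₀)) * (c * 1))) τ := fun τ hτ =>
    ((hEd τ hτ).add_const _).mul (((hasDerivAt_id τ).sub_const t₀).const_mul c).exp
  have hEP : ∀ τ ∈ Ico t₀ T, E τ * P τ ≤ P t₀ := by
    intro τ hτ
    have := mul_le_mul_of_nonneg_left (h τ hτ) (Real.exp_pos (-(c * ∫ τ in t₀..τ, (1 + P τ)))).le
    rwa [mul_left_comm, ← Real.exp_add, neg_add_cancel, Real.exp_zero, mul_one] at this
  have hmono : MonotoneOn φ (Ico t₀ T) := by
    refine monotoneOn_of_deriv_nonneg (convex_Ico _ _) ?_ ?_ ?_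
    · refine ((Real.continuous_exp.comp_continuousOn
        (continuousOn_const.mul (continuousOn_primitive hQ)).neg).add continuousOn_const).mul ?_
      fun_prop
    · rw [interior_Ico]
      exact fun τ hτ => (hd τ hτ).differentiableAt.differentiableWithinAt
    · rw [interior_Ico]
      intro τ hτ
      rw [(hd τ hτ).deriv]
      have h1 := hEP τ (Ioo_subset_Ico_self hτ)
      have h2 := Real.exp_pos (c * (τ - t₀))
      have : E τ * -(c * (1 + P τ)) * Real.exp (c * (τ - t₀)) +
          (E τ + P t₀) * (Real.exp (c * (τ - t₀)) * (c * 1)) =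
          (c * Real.exp (c * (τ - t₀))) * (P t₀ - E τ * P τ) := by ring
      rw [this]
      exact mul_nonneg (mul_pos hc h2).le (sub_nonneg.2 h1)
  set e := Real.exp (c * (T - t₀)) with he
  have hep : 0 < e := Real.exp_pos _
  set d := (1 + P t₀) / e - P t₀ with hd'
  have hdp : 0 < d := by
    rw [hd', sub_pos, lt_div_iff₀ hep]
    linarith
  refine ⟨P t₀ / d, fun τ hτ => ?_⟩
  have h1 : 1 + P t₀ ≤ (E τ + P t₀) * e := by
    have := hmono h0 hτ hτ.1
    simp only [hφ, hE, intervalIntegral.integral_same, mul_zero, neg_zero, Real.exp_zero,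
      sub_self, mul_one] at this
    refine this.trans (mul_le_mul_of_nonneg_left ?_ (add_nonneg (Real.exp_pos _).le (hP0 t₀ h0)))
    exact Real.exp_le_exp.2 (mul_le_mul_of_nonneg_left (by linarith [hτ.2]) hc.le)
  have h2 : d ≤ E τ := by
    rw [hd', sub_le_iff_le_add, div_le_iff₀ hep]
    exact h1
  rw [le_div_iff₀ hdp, mul_comm]
  exact (mul_le_mul_of_nonneg_right h2 (hP0 τ hτ)).trans (hEP τ hτ)

end Gronwall

section Energy

variable {α β s : ℝ}

theorem exists_energy_constant (hP : Subcritical α β s) : ∃ C : ℝ, 0 < C ∧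
    ∀ (a σ : ℝ), 0 ≤ a → 1 ≤ σ → ∀ (w : E3 → C3) (z : E3 → ℂ) (T : ℝ) (G : ℝ → E3 → C3 × ℂ),
      FourierData a σ s w z → FourierSolution a σ s α β w z T G →
      ∀ (N J : ℝ → ℝ≥0∞),
      (∀ t, N t = fnorm a σ s (velocity α w G t) + fnorm a σ s (temperature β z G t)) →
      (∀ t, J t = (1 + crit α β s (fnorm a σ s (velocity α w G t))
        (fnorm a σ s (temperature β z G t))) * N t) →
      ∀ t₀ t : ℝ, 0 ≤ t₀ → t₀ ≤ t → t < T →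
        N t ≤ N t₀ + ENNReal.ofReal C * ∫⁻ τ in Ioc t₀ t, J τ ∧
        ∫⁻ τ in Ioc t₀ t, fnorm a σ s (G τ) ≤
          N t₀ + 2 * (ENNReal.ofReal C * ∫⁻ τ in Ioc t₀ t, J τ) := by
  obtain ⟨C, hC0, hC⟩ := exists_fnorm_force_le hP
  refine ⟨C, hC0, fun a σ ha hσ w z T G hD h N J hN hJ t₀ t h0 h1 h2 => ?_⟩
  have ht : t ∈ Ico 0 T := ⟨h0.trans h1, h2⟩
  set U := velocity α w G with hU
  set Θ := temperature β z G with hΘ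
  have mU : StronglyMeasurable (Function.uncurry U) := hD.stronglyMeasurable_velocity h.meas α
  have mΘ : StronglyMeasurable (Function.uncurry Θ) := hD.stronglyMeasurable_temperature h.meas β
  have m1 := stronglyMeasurable_uncurry_fst h.meas
  have m2 := stronglyMeasurable_uncurry_snd h.meas
  have i1 := lintegral_fnorm_fst_lt_top (h.fin t ht)
  have i2 := lintegral_fnorm_snd_lt_top (h.fin t ht)
  have eU := duh_energy (γ := α) h0 h1 hD.meas_w m1 i1
  have eΘ := duh_energy (γ := β) h0 h1 hD.meas_z m2 i2
  obtain ⟨M, hM, bU, bΘ⟩ := hD.bnd h.meas ht.1 (h.fin t ht) α β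
  set X := ∫⁻ r in Ioc t₀ t, fnorm a σ (s + 2 * α) (U r) with hX
  set Y := ∫⁻ r in Ioc t₀ t, fnorm a σ (s + 2 * β) (Θ r) with hY
  have hsub : Ioc t₀ t ⊆ Ioc 0 t := Ioc_subset_Ioc_left h0
  have hXf : X ≠ ⊤ := ((lintegral_mono_set hsub).trans (bU.2)).trans_lt hM |>.ne
  have hYf : Y ≠ ⊤ := ((lintegral_mono_set hsub).trans (bΘ.2)).trans_lt hM |>.ne
  set S := ∫⁻ τ in Ioc t₀ t, (fnorm a σ s (fun ξ => (G τ ξ).1) +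
    fnorm a σ s (fun ξ => (G τ ξ).2)) with hS
  set K := ENNReal.ofReal C * ∫⁻ τ in Ioc t₀ t, J τ with hK
  have hSle : S ≤ 2⁻¹ * (X + Y) + K := by
    have mX := measurable_fnorm (a := a) (σ := σ) (r := s + 2 * α) mU
    have mD : Measurable fun τ => 2⁻¹ * (fnorm a σ (s + 2 * α) (U τ) +
        fnorm a σ (s + 2 * β) (Θ τ)) := (mX.add (measurable_fnorm mΘ)).const_mul _
    rw [hX, hY, hK, ← lintegral_add_left mX, ← lintegral_const_mul' _ _ (by simp),
      ← lintegral_const_mul' _ _ ENNReal.ofReal_ne_top, ← lintegral_add_left mD]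
    refine lintegral_mono_ae ?_
    have hsub' : Ioc t₀ t ⊆ Ioo 0 T := fun τ hτ => ⟨h0.trans_lt hτ.1, hτ.2.trans_lt h2⟩
    filter_upwards [ae_restrict_of_ae_restrict_of_subset hsub' h.eq,
      ae_restrict_mem measurableSet_Ioc] with τ e1 e2
    have c1 : fnorm a σ s (fun ξ => (G τ ξ).1) =
        fnorm a σ s (fun ξ => (force (U τ) (Θ τ) ξ).1) :=
      fnorm_congr (by filter_upwards [e1] with ξ hξ; rw [hξ])
    have c2 : fnorm a σ s (fun ξ => (G τ ξ).2) =
        fnorm a σ s (fun ξ => (force (U τ) (Θ τ) ξ).2) :=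
      fnorm_congr (by filter_upwards [e1] with ξ hξ; rw [hξ])
    rw [c1, c2, hJ, hN]
    exact hC a σ ha hσ _ _ (StronglyMeasurable.slice mU τ).aestronglyMeasurable
      (StronglyMeasurable.slice mΘ τ).aestronglyMeasurable
      ((bU.1 τ (hsub e2)).trans_lt hM) ((bΘ.1 τ (hsub e2)).trans_lt hM)
  have hen : N t + (X + Y) ≤ N t₀ + S := by
    rw [hS, lintegral_add_left (measurable_fnorm m1), hN, hN]
    calc _ = (fnorm a σ s (U t) + X) + (fnorm a σ s (Θ t) + Y) := by ring
      _ ≤ _ := add_le_add eU eΘ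
      _ = _ := by rw [hU, hΘ, velocity, temperature]; ring
  have hhalf : (X + Y) = 2⁻¹ * (X + Y) + 2⁻¹ * (X + Y) := by
    rw [← two_mul, ← mul_assoc, ENNReal.mul_inv_cancel (by simp) (by simp), one_mul]
  have hZf : 2⁻¹ * (X + Y) ≠ ⊤ := ENNReal.mul_ne_top (by simp) (ENNReal.add_ne_top.2 ⟨hXf, hYf⟩)
  have hmain : N t + 2⁻¹ * (X + Y) ≤ N t₀ + K := by
    refine (ENNReal.add_le_add_iff_right hZf).1 ?_
    calc N t + 2⁻¹ * (X + Y) + 2⁻¹ * (X + Y) = N t + (X + Y) := by rw [add_assoc, ← hhalf]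
      _ ≤ N t₀ + S := hen
      _ ≤ N t₀ + (2⁻¹ * (X + Y) + K) := by gcongr
      _ = _ := by ring
  refine ⟨le_self_add.trans hmain, ?_⟩
  have hG : ∫⁻ τ in Ioc t₀ t, fnorm a σ s (G τ) ≤ S := lintegral_mono fun τ =>
    fnorm_prod_le (StronglyMeasurable.slice h.meas τ).aestronglyMeasurable
  calc _ ≤ S := hG
    _ ≤ 2⁻¹ * (X + Y) + K := hSle
    _ ≤ (N t₀ + K) + K := add_le_add (le_add_self.trans hmain) le_rfl
    _ = _ := by ring

end Energy

section Powers

/-- The real form of the integrand of the blow-up criterion. -/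
def critReal (α β s X Y : ℝ) : ℝ :=
  X ^ (2 * α / (2 * α + s - 1)) +
    X ^ (β * (s + 2 * α) / (β * (s + 2 * α) - α)) * Y ^ (-s * β / (β * (s + 2 * α) - α)) +
    X ^ (-s * α / (α * (s + 2 * β) - β)) * Y ^ (α * (s + 2 * β) / (α * (s + 2 * β) - β))

/-- The sum of powers in the lower bound for the blow-up rate. -/
def powSum (α β s n : ℝ) : ℝ :=
  n ^ (2 * α / (2 * α + s - 1)) + n ^ (2 * α * β / (2 * α * β + s * β - α)) +
    n ^ (2 * α * β / (2 * α * β + s * α - β))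

variable {α β s : ℝ}

theorem Subcritical.exponents_nonneg (hP : Subcritical α β s) :
    0 ≤ 2 * α / (2 * α + s - 1) ∧ 0 ≤ β * (s + 2 * α) / (β * (s + 2 * α) - α) ∧
      0 ≤ -s * β / (β * (s + 2 * α) - α) ∧ 0 ≤ -s * α / (α * (s + 2 * β) - β) ∧
      0 ≤ α * (s + 2 * β) / (α * (s + 2 * β) - β) := by
  obtain ⟨d1, d2, d3⟩ := hP.denominators
  have hα : 0 < α := by linarith [hP.hα]
  have hβ : 0 < β := by linarith [hP.hβ]
  have hs0 : 0 ≤ -s := by linarith [hP.hs.2]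
  exact ⟨by positivity, div_nonneg (by linarith) d2.le, by positivity, by positivity,
    div_nonneg (by linarith) d3.le⟩

theorem Subcritical.powers (hP : Subcritical α β s) :
    1 ≤ 2 * α / (2 * α + s - 1) ∧ 0 < 2 * α * β / (2 * α * β + s * β - α) ∧
      0 < 2 * α * β / (2 * α * β + s * α - β) := by
  obtain ⟨d1, d2, d3⟩ := hP.denominators
  have hα : 0 < α := by linarith [hP.hα]
  have hβ : 0 < β := by linarith [hP.hβ]
  refine ⟨?_, div_pos (by positivity) (by linarith), div_pos (by positivity) (by linarith)⟩
  rw [one_le_div d1]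
  linarith [hP.hs.2]

theorem crit_ofReal (hP : Subcritical α β s) {X Y : ℝ} (hX : 0 ≤ X) (hY : 0 ≤ Y) :
    crit α β s (ENNReal.ofReal X) (ENNReal.ofReal Y) = ENNReal.ofReal (critReal α β s X Y) := by
  obtain ⟨p1, p2, p3, p4, p5⟩ := hP.exponents_nonneg
  rw [crit, critReal, ENNReal.ofReal_rpow_of_nonneg hX p1, ENNReal.ofReal_rpow_of_nonneg hX p2,
    ENNReal.ofReal_rpow_of_nonneg hY p3, ENNReal.ofReal_rpow_of_nonneg hX p4,
    ENNReal.ofReal_rpow_of_nonneg hY p5, ← ENNReal.ofReal_mul (by positivity),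
    ← ENNReal.ofReal_mul (by positivity), ← ENNReal.ofReal_add (by positivity) (by positivity),
    ← ENNReal.ofReal_add (by positivity) (by positivity)]

theorem critReal_nonneg {X Y : ℝ} (hX : 0 ≤ X) (hY : 0 ≤ Y) : 0 ≤ critReal α β s X Y := by
  unfold critReal; positivity

theorem continuous_critReal (hP : Subcritical α β s) :
    Continuous fun p : ℝ × ℝ => critReal α β s p.1 p.2 := by
  obtain ⟨p1, p2, p3, p4, p5⟩ := hP.exponents_nonneg
  exact ((continuous_fst.rpow_const fun _ => Or.inr p1).add
    ((continuous_fst.rpow_const fun _ => Or.inr p2).mul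
      (continuous_snd.rpow_const fun _ => Or.inr p3))).add
    ((continuous_fst.rpow_const fun _ => Or.inr p4).mul
      (continuous_snd.rpow_const fun _ => Or.inr p5))

theorem continuous_powSum (hP : Subcritical α β s) : Continuous (powSum α β s) := by
  obtain ⟨p1, p2, p3⟩ := hP.powers
  exact ((continuous_id.rpow_const fun _ => Or.inr (zero_le_one.trans p1)).add
    (continuous_id.rpow_const fun _ => Or.inr p2.le)).add
    (continuous_id.rpow_const fun _ => Or.inr p3.le)

theorem powSum_nonneg {n : ℝ} (hn : 0 ≤ n) : 0 ≤ powSum α β s n := by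
  unfold powSum; positivity

theorem critReal_le_powSum (hP : Subcritical α β s) {X Y : ℝ} (hX : 0 ≤ X) (hY : 0 ≤ Y) :
    critReal α β s X Y ≤ powSum α β s (X + Y) := by
  obtain ⟨p1, p2, p3, p4, p5⟩ := hP.exponents_nonneg
  obtain ⟨d1, d2, d3⟩ := hP.denominators
  have hn : 0 ≤ X + Y := add_nonneg hX hY
  have x1 : X ≤ X + Y := by linarith
  have y1 : Y ≤ X + Y := by linarith
  have e2 : β * (s + 2 * α) / (β * (s + 2 * α) - α) + -s * β / (β * (s + 2 * α) - α) =
      2 * α * β / (2 * α * β + s * β - α) := by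
    rw [← add_div]; congr 1 <;> ring
  have e3 : -s * α / (α * (s + 2 * β) - β) + α * (s + 2 * β) / (α * (s + 2 * β) - β) =
      2 * α * β / (2 * α * β + s * α - β) := by
    rw [← add_div]; congr 1 <;> ring
  rw [critReal, powSum, ← e2, ← e3, Real.rpow_add_of_nonneg hn p2 p3,
    Real.rpow_add_of_nonneg hn p4 p5]
  gcongr

theorem powSum_mul_exp_le (hP : Subcritical α β s) {m n n₀ I : ℝ} (hn : 0 ≤ n) (hn₀ : 0 ≤ n₀)
    (hI : 0 ≤ I) (h : n ≤ n₀ * Real.exp I) (m1 : 2 * α / (2 * α + s - 1) ≤ m)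
    (m2 : 2 * α * β / (2 * α * β + s * β - α) ≤ m)
    (m3 : 2 * α * β / (2 * α * β + s * α - β) ≤ m) :
    powSum α β s n ≤ powSum α β s n₀ * Real.exp (m * I) := by
  obtain ⟨p1, p2, p3⟩ := hP.powers
  have key : ∀ {p : ℝ}, 0 ≤ p → p ≤ m → n ^ p ≤ n₀ ^ p * Real.exp (m * I) := by
    intro p hp hpm
    refine (Real.rpow_le_rpow hn h hp).trans ?_
    rw [Real.mul_rpow hn₀ (Real.exp_pos _).le, ← Real.exp_mul, mul_comm I]
    gcongr
  rw [powSum, powSum, add_mul, add_mul]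
  exact add_le_add (add_le_add (key (zero_le_one.trans p1) m1) (key p2.le m2)) (key p3.le m3)

theorem le_one_add_powSum (hP : Subcritical α β s) {n : ℝ} (hn : 0 ≤ n) :
    n ≤ 1 + powSum α β s n := by
  obtain ⟨p1, p2, p3⟩ := hP.powers
  rcases le_total n 1 with h | h
  · exact h.trans (le_add_of_nonneg_right (powSum_nonneg hn))
  · have h1 := Real.rpow_le_rpow_of_exponent_le h p1
    rw [Real.rpow_one] at h1
    have h2 : 0 ≤ n ^ (2 * α * β / (2 * α * β + s * β - α)) := by positivity
    have h3 : 0 ≤ n ^ (2 * α * β / (2 * α * β + s * α - β)) := by positivity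
    rw [powSum]
    linarith

end Powers

section Maximal

variable {a σ s α β T : ℝ} {w : E3 → C3} {z : E3 → ℂ} {G : ℝ → E3 → C3 × ℂ}
  {u₀ : 𝓢'(E3, C3)} {θ₀ : 𝓢'(E3, ℂ)} {u : ℝ → 𝓢'(E3, C3)} {θ : ℝ → 𝓢'(E3, ℂ)}

/-- The forcing of a maximal solution is not integrable up to the maximal time. -/
theorem IsMaximalSolution.lintegral_forcing (ha : 0 ≤ a) (hσ : 1 ≤ σ) (hP : Subcritical α β s)
    (hm : IsMaximalSolution a σ s α β u₀ θ₀ T u θ)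
    (hD : FourierData a σ s w z) (h : FourierSolution a σ s α β w z T G)
    (hw : HasFourierFn u₀ w) (hz : HasFourierFn θ₀ z)
    (hu : ∀ t ∈ Ico 0 T, HasFourierFn (u t) (velocity α w G t))
    (hθ : ∀ t ∈ Ico 0 T, HasFourierFn (θ t) (temperature β z G t)) :
    ∫⁻ τ in Ioc 0 T, fnorm a σ s (G τ) = ⊤ := by
  by_contra hne
  obtain ⟨T', hT', G', h', heq⟩ := h.exists_extension ha hσ hP hm.1.le hD
    (lt_top_iff_ne_top.2 hne)
  have m1 := stronglyMeasurable_uncurry_fst h'.meas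
  have m2 := stronglyMeasurable_uncurry_snd h'.meas
  have hv : ∀ t ∈ Ico 0 T', HasFourierFn (ofFourier (velocity α w G' t)) (velocity α w G' t) := by
    intro t ht
    have i := lintegral_fnorm_fst_lt_top (h'.fin t ht)
    exact hasFourierFn_ofFourier (exists_hasFourierFn ha hP.hs
      (StronglyMeasurable.slice (hD.stronglyMeasurable_velocity h'.meas α) t).aestronglyMeasurable
      ((le_self_add.trans (fnorm_duh_le (right_mem_Icc.2 ht.1) hD.meas_w m1 i)).trans_lt
        (ENNReal.add_lt_top.2 ⟨hD.fin_w, i⟩)))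
  have hψ : ∀ t ∈ Ico 0 T',
      HasFourierFn (ofFourier (temperature β z G' t)) (temperature β z G' t) := by
    intro t ht
    have i := lintegral_fnorm_snd_lt_top (h'.fin t ht)
    exact hasFourierFn_ofFourier (exists_hasFourierFn ha hP.hs
      (StronglyMeasurable.slice
        (hD.stronglyMeasurable_temperature h'.meas β) t).aestronglyMeasurable
      ((le_self_add.trans (fnorm_duh_le (right_mem_Icc.2 ht.1) hD.meas_z m2 i)).trans_lt
        (ENNReal.add_lt_top.2 ⟨hD.fin_z, i⟩)))
  refine hm.2.2 ⟨T', hT', fun t => ofFourier (velocity α w G' t),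
    fun t => ofFourier (temperature β z G' t), h'.isMildSolution ha hσ hP hD hw hz hv hψ,
    fun t ht => ?_⟩
  have ht' : t ∈ Ico 0 T' := ⟨ht.1, ht.2.trans hT'⟩
  obtain ⟨e1, e2⟩ := heq t ht
  exact ⟨(hv t ht').unique (by rw [e1]; exact hu t ht),
    (hψ t ht').unique (by rw [e2]; exact hθ t ht)⟩

theorem lintegral_Ioo_le_of_forall {f : ℝ → ℝ≥0∞} {t₀ T : ℝ} {L : ℝ≥0∞}
    (h : ∀ t ∈ Ico t₀ T, ∫⁻ τ in Ioc t₀ t, f τ ≤ L) : ∫⁻ τ in Ioo t₀ T, f τ ≤ L := by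
  rcases le_or_gt T t₀ with hT | hT
  · simp [Ioo_eq_empty (not_lt.2 hT)]
  obtain ⟨v, hv, hvT, hlim⟩ := exists_seq_strictMono_tendsto' hT
  have hU : Ioo t₀ T = ⋃ n, Ioc t₀ (v n) := by
    ext τ
    simp only [mem_iUnion, mem_Ioc, mem_Ioo]
    constructor
    · rintro ⟨h1, h2⟩
      obtain ⟨n, hn⟩ := (hlim.eventually (lt_mem_nhds h2)).exists
      exact ⟨n, h1, hn.le⟩
    · rintro ⟨n, h1, h2⟩
      exact ⟨h1, h2.trans_lt (hvT n).2⟩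
  rw [hU, setLIntegral_iUnion_of_directed]
  · exact iSup_le fun n => h _ ⟨(hvT n).1.le, (hvT n).2⟩
  · exact (monotone_nat_of_le_succ fun n =>
      Ioc_subset_Ioc_right (hv n.lt_succ_self).le).directed_le

end Maximal

section BlowUp

variable {s α β : ℝ}

/-- The exponential bound and the integral criterion for maximal solutions. -/
theorem exists_blowup_constant (hP : Subcritical α β s) : ∃ C : ℝ, 0 < C ∧
    ∀ (a σ : ℝ), 0 ≤ a → 1 ≤ σ → ∀ (u₀ : 𝓢'(E3, C3)) (θ₀ : 𝓢'(E3, ℂ)),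
      u₀ ∈ LeiLinGevrey a σ s → θ₀ ∈ LeiLinGevrey a σ s →
      IsRealVector u₀ → IsRealScalar θ₀ → DivFree u₀ →
      ∀ (T : ℝ) (u : ℝ → 𝓢'(E3, C3)) (θ : ℝ → 𝓢'(E3, ℂ)),
        IsMaximalSolution a σ s α β u₀ θ₀ T u θ →
      ∃ X Y : ℝ → ℝ, ContinuousOn X (Ico 0 T) ∧ ContinuousOn Y (Ico 0 T) ∧
        (∀ t, 0 ≤ X t) ∧ (∀ t, 0 ≤ Y t) ∧
        (∀ t ∈ Ico 0 T, leiLinNorm a σ s (u t) = ENNReal.ofReal (X t)) ∧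
        (∀ t ∈ Ico 0 T, leiLinNorm a σ s (θ t) = ENNReal.ofReal (Y t)) ∧
        ∀ t₀ ∈ Ico 0 T,
          (∀ t ∈ Ico t₀ T, X t + Y t ≤ (X t₀ + Y t₀) *
            Real.exp (∫ τ in t₀..t, C * (1 + critReal α β s (X τ) (Y τ)))) ∧
          ∫⁻ τ in Ico t₀ T, ENNReal.ofReal (critReal α β s (X τ) (Y τ)) = ⊤ := by
  obtain ⟨C, hC0, hC⟩ := exists_energy_constant hP
  refine ⟨C, hC0, fun a σ ha hσ u₀ θ₀ hu₀ hθ₀ ru rθ du T u θ hm => ?_⟩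
  obtain ⟨w, z, hD, hw, hz⟩ := exists_fourierData hu₀ hθ₀ ru rθ du
  obtain ⟨G, hG, hu, hθ⟩ := hm.2.1.exists_fourierSolution ha hσ hP hD hw hz
  have htop := hm.lintegral_forcing ha hσ hP hD hG hw hz hu hθ
  have fx : ∀ t ∈ Ico 0 T, leiLinNorm a σ s (u t) ≠ ⊤ := fun t ht => (hm.2.1.cont_u t ht).1.ne
  have fy : ∀ t ∈ Ico 0 T, leiLinNorm a σ s (θ t) ≠ ⊤ := fun t ht => (hm.2.1.cont_θ t ht).1.ne
  set X : ℝ → ℝ := fun t => (leiLinNorm a σ s (u t)).toReal with hX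
  set Y : ℝ → ℝ := fun t => (leiLinNorm a σ s (θ t)).toReal with hY
  have cX : ContinuousOn X (Ico 0 T) :=
    ENNReal.continuousOn_toReal.comp hm.2.1.cont_u.continuousOn fx
  have cY : ContinuousOn Y (Ico 0 T) :=
    ENNReal.continuousOn_toReal.comp hm.2.1.cont_θ.continuousOn fy
  have X0 : ∀ t, 0 ≤ X t := fun t => ENNReal.toReal_nonneg
  have Y0 : ∀ t, 0 ≤ Y t := fun t => ENNReal.toReal_nonneg
  have eX : ∀ t ∈ Ico 0 T, leiLinNorm a σ s (u t) = ENNReal.ofReal (X t) := fun t ht =>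
    (ENNReal.ofReal_toReal (fx t ht)).symm
  have eY : ∀ t ∈ Ico 0 T, leiLinNorm a σ s (θ t) = ENNReal.ofReal (Y t) := fun t ht =>
    (ENNReal.ofReal_toReal (fy t ht)).symm
  refine ⟨X, Y, cX, cY, X0, Y0, eX, eY, fun t₀ ht₀ => ?_⟩
  set c : ℝ → ℝ := fun τ => critReal α β s (X τ) (Y τ) with hc
  have c0 : ∀ τ, 0 ≤ c τ := fun τ => critReal_nonneg (X0 τ) (Y0 τ)
  have hsub : Ico t₀ T ⊆ Ico 0 T := Ico_subset_Ico_left ht₀.1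
  have cc : ContinuousOn c (Ico t₀ T) :=
    (continuous_critReal hP).comp_continuousOn ((cX.prodMk cY).mono hsub)
  have ck : ContinuousOn (fun τ => C * (1 + c τ)) (Ico t₀ T) :=
    continuousOn_const.mul (continuousOn_const.add cc)
  have cn : ContinuousOn (fun τ => X τ + Y τ) (Ico t₀ T) := (cX.add cY).mono hsub
  set N : ℝ → ℝ≥0∞ := fun t =>
    fnorm a σ s (velocity α w G t) + fnorm a σ s (temperature β z G t) with hN
  set J : ℝ → ℝ≥0∞ := fun t => (1 + crit α β s (fnorm a σ s (velocity α w G t))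
        (fnorm a σ s (temperature β z G t))) * N t with hJ
  have vX : ∀ t ∈ Ico 0 T, fnorm a σ s (velocity α w G t) = ENNReal.ofReal (X t) := fun t ht => by
    rw [← (hu t ht).leiLinNorm_eq, eX t ht]
  have vY : ∀ t ∈ Ico 0 T, fnorm a σ s (temperature β z G t) = ENNReal.ofReal (Y t) :=
    fun t ht => by rw [← (hθ t ht).leiLinNorm_eq, eY t ht]
  have eN : ∀ t ∈ Ico 0 T, N t = ENNReal.ofReal (X t + Y t) := fun t ht => by
    simp only [hN]
    rw [vX t ht, vY t ht, ENNReal.ofReal_add (X0 t) (Y0 t)]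
  have eJ : ∀ t ∈ Ico 0 T, J t = ENNReal.ofReal ((1 + c t) * (X t + Y t)) := fun t ht => by
    simp only [hJ]
    rw [eN t ht, vX t ht, vY t ht, crit_ofReal hP (X0 t) (Y0 t),
      ENNReal.ofReal_mul (add_nonneg zero_le_one (c0 t)),
      ENNReal.ofReal_add zero_le_one (c0 t), ENNReal.ofReal_one]
  have hen := fun t (ht : t ∈ Ico t₀ T) => hC a σ ha hσ w z T G hD hG N J (fun _ => rfl)
    (fun _ => rfl) t₀ t ht₀.1 ht.1 ht.2
  have hIoc : ∀ t ∈ Ico t₀ T, Ioc t₀ t ⊆ Ico 0 T := fun t ht τ hτ =>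
    ⟨ht₀.1.trans hτ.1.le, hτ.2.trans_lt ht.2⟩
  have hIcc : ∀ t ∈ Ico t₀ T, Icc t₀ t ⊆ Ico t₀ T := fun t ht τ hτ =>
    ⟨hτ.1, hτ.2.trans_lt ht.2⟩
  have hgr : ∀ t ∈ Ico t₀ T, X t + Y t ≤ (X t₀ + Y t₀) *
      Real.exp (∫ τ in t₀..t, C * (1 + c τ)) := by
    intro t ht
    refine gronwall (n := fun τ => X τ + Y τ) cn ck
      (fun τ _ => mul_nonneg hC0.le (add_nonneg zero_le_one (c0 τ))) (fun t ht => ?_) ht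
    have hpos : ∀ τ, 0 ≤ C * (1 + c τ) * (X τ + Y τ) := fun τ =>
      mul_nonneg (mul_nonneg hC0.le (add_nonneg zero_le_one (c0 τ))) (add_nonneg (X0 τ) (Y0 τ))
    have h1 := (hen t ht).1
    have hi : IntegrableOn (fun τ => C * (1 + c τ) * (X τ + Y τ)) (Ioc t₀ t) :=
      (((ck.mul cn).mono (hIcc t ht)).integrableOn_Icc).mono_set Ioc_subset_Icc_self
    have h2 : ENNReal.ofReal C * ∫⁻ τ in Ioc t₀ t, J τ =
        ENNReal.ofReal (∫ τ in t₀..t, C * (1 + c τ) * (X τ + Y τ)) := by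
      rw [intervalIntegral.integral_of_le ht.1,
        ofReal_integral_eq_lintegral_ofReal hi (Eventually.of_forall hpos),
        ← lintegral_const_mul' _ _ ENNReal.ofReal_ne_top]
      refine setLIntegral_congr_fun measurableSet_Ioc fun τ hτ => ?_
      rw [eJ τ (hIoc t ht hτ), ← ENNReal.ofReal_mul hC0.le, mul_assoc]
    have h3 : 0 ≤ ∫ τ in t₀..t, C * (1 + c τ) * (X τ + Y τ) :=
      intervalIntegral.integral_nonneg ht.1 fun τ _ => hpos τ
    rw [h2, eN t (hsub ht), eN t₀ ht₀, ← ENNReal.ofReal_add (add_nonneg (X0 _) (Y0 _)) h3,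
      ENNReal.ofReal_le_ofReal_iff (add_nonneg (add_nonneg (X0 _) (Y0 _)) h3)] at h1
    exact h1
  refine ⟨hgr, ?_⟩
  by_contra hne
  set κ := ∫⁻ τ in Ico t₀ T, ENNReal.ofReal (c τ) with hκ
  have hone : ∫⁻ τ in Ico t₀ T, ENNReal.ofReal (1 + c τ) = ENNReal.ofReal (T - t₀) + κ := by
    simp only [ENNReal.ofReal_add zero_le_one (c0 _), ENNReal.ofReal_one]
    rw [lintegral_add_left measurable_const, lintegral_const, Measure.restrict_apply_univ,
      Real.volume_Ico, one_mul]
  set k := ENNReal.ofReal (T - t₀) + κ with hk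
  have hkt : k ≠ ⊤ := ENNReal.add_ne_top.2 ⟨ENNReal.ofReal_ne_top, hne⟩
  set B := (X t₀ + Y t₀) * Real.exp (C * k.toReal) with hB
  have hnB : ∀ t ∈ Ico t₀ T, X t + Y t ≤ B := by
    intro t ht
    refine (hgr t ht).trans (mul_le_mul_of_nonneg_left (Real.exp_le_exp.2 ?_)
      (add_nonneg (X0 _) (Y0 _)))
    rw [intervalIntegral.integral_const_mul]
    refine mul_le_mul_of_nonneg_left ?_ hC0.le
    have hi : IntegrableOn (fun τ => 1 + c τ) (Ioc t₀ t) :=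
      (((continuousOn_const.add cc).mono (hIcc t ht)).integrableOn_Icc).mono_set
        Ioc_subset_Icc_self
    refine (ENNReal.ofReal_le_iff_le_toReal hkt).1 ?_
    rw [intervalIntegral.integral_of_le ht.1, ofReal_integral_eq_lintegral_ofReal hi
      (Eventually.of_forall fun τ => add_nonneg zero_le_one (c0 τ)), ← hone]
    exact lintegral_mono_set fun τ hτ => ⟨hτ.1.le, hτ.2.trans_lt ht.2⟩
  have hJle : ∀ t ∈ Ico t₀ T, ∫⁻ τ in Ioc t₀ t, J τ ≤ k * ENNReal.ofReal B := by
    intro t ht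
    calc ∫⁻ τ in Ioc t₀ t, J τ
        ≤ ∫⁻ τ in Ioc t₀ t, ENNReal.ofReal (1 + c τ) * ENNReal.ofReal B := by
          refine setLIntegral_mono' measurableSet_Ioc fun τ hτ => ?_
          rw [eJ τ (hIoc t ht hτ), ENNReal.ofReal_mul (add_nonneg zero_le_one (c0 τ))]
          gcongr
          exact hnB τ ⟨hτ.1.le, hτ.2.trans_lt ht.2⟩
      _ = (∫⁻ τ in Ioc t₀ t, ENNReal.ofReal (1 + c τ)) * ENNReal.ofReal B :=
          lintegral_mul_const' _ _ ENNReal.ofReal_ne_top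
      _ ≤ k * ENNReal.ofReal B := by
          rw [← hone]
          gcongr
          exact fun τ hτ => ⟨hτ.1.le, hτ.2.trans_lt ht.2⟩
  have hfin : ∫⁻ τ in Ioo t₀ T, fnorm a σ s (G τ) < ⊤ := by
    refine (lintegral_Ioo_le_of_forall (L := ENNReal.ofReal (X t₀ + Y t₀) +
      2 * (ENNReal.ofReal C * (k * ENNReal.ofReal B))) fun t ht => ?_).trans_lt ?_
    · refine (hen t ht).2.trans ?_
      rw [eN t₀ ht₀]
      gcongr
      exact hJle t ht
    · exact (ENNReal.add_ne_top.2 ⟨ENNReal.ofReal_ne_top, ENNReal.mul_ne_top (by simp)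
        (ENNReal.mul_ne_top ENNReal.ofReal_ne_top
          (ENNReal.mul_ne_top hkt ENNReal.ofReal_ne_top))⟩).lt_top
  have hlt : ∫⁻ τ in Ioc 0 T, fnorm a σ s (G τ) < ⊤ := by
    have hU : Ioc 0 T = Ioc 0 t₀ ∪ Ioc t₀ T := (Ioc_union_Ioc_eq_Ioc ht₀.1 ht₀.2.le).symm
    rw [hU]
    refine (lintegral_union_le _ _ _).trans_lt (ENNReal.add_lt_top.2 ⟨hG.fin t₀ ht₀, ?_⟩)
    rwa [← setLIntegral_congr Ioo_ae_eq_Ioc]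
  exact hlt.ne htop

/-- A solution whose norm stays bounded has a finite blow-up integral. -/
theorem lintegral_critReal_lt_top (hP : Subcritical α β s) {X Y : ℝ → ℝ} (hX : ∀ t, 0 ≤ X t)
    (hY : ∀ t, 0 ≤ Y t) {t₀ T B : ℝ} (h : ∀ t ∈ Ico t₀ T, X t + Y t ≤ B) :
    ∫⁻ τ in Ico t₀ T, ENNReal.ofReal (critReal α β s (X τ) (Y τ)) < ⊤ := by
  obtain ⟨p1, p2, p3⟩ := hP.powers
  refine (setLIntegral_mono' (g := fun _ => ENNReal.ofReal (powSum α β s B)) measurableSet_Ico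
    fun τ hτ => ENNReal.ofReal_le_ofReal ?_).trans_lt ?_
  · refine (critReal_le_powSum hP (hX τ) (hY τ)).trans ?_
    have h0 := add_nonneg (hX τ) (hY τ)
    have h1 := h τ hτ
    have p1' := zero_le_one.trans p1
    rw [powSum, powSum]
    gcongr
  · rw [lintegral_const, Measure.restrict_apply_univ, Real.volume_Ico]
    exact ENNReal.mul_lt_top ENNReal.ofReal_lt_top ENNReal.ofReal_lt_top

end BlowUp

end Boussinesq

end

open Boussinesq in
theorem theorem1p3 (α β s : ℝ) (hα : 1 / 2 < α) (hβ : 1 / 2 < β)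
    (hs : s ∈ Set.Icc (-1 : ℝ) 0) (hq : Boussinesq.q α β < s) :
    ∃ C : ℝ, 0 < C ∧
      ∀ (a σ : ℝ), 0 ≤ a → 1 ≤ σ →
      ∀ (u₀ : 𝓢'(Boussinesq.E3, Boussinesq.C3)) (θ₀ : 𝓢'(Boussinesq.E3, ℂ)),
        u₀ ∈ Boussinesq.LeiLinGevrey a σ s → θ₀ ∈ Boussinesq.LeiLinGevrey a σ s →
        Boussinesq.IsRealVector u₀ → Boussinesq.IsRealScalar θ₀ → Boussinesq.DivFree u₀ →
      ∀ (T : ℝ) (u : ℝ → 𝓢'(Boussinesq.E3, Boussinesq.C3)) (θ : ℝ → 𝓢'(Boussinesq.E3, ℂ)),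
        Boussinesq.IsMaximalSolution a σ s α β u₀ θ₀ T u θ →
        Filter.limsup (fun t => Boussinesq.pairNorm a σ s (u t) (θ t)) (𝓝[<] T) = ⊤ ∧
        ∀ t ∈ Set.Ico 0 T,
          (∫⁻ τ in Set.Ico t T,
            (Boussinesq.leiLinNorm a σ s (u τ) ^ (2 * α / (2 * α + s - 1))
              + Boussinesq.leiLinNorm a σ s (u τ)
                    ^ (β * (s + 2 * α) / (β * (s + 2 * α) - α))
                * Boussinesq.leiLinNorm a σ s (θ τ)
                    ^ (-s * β / (β * (s + 2 * α) - α))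
              + Boussinesq.leiLinNorm a σ s (u τ)
                    ^ (-s * α / (α * (s + 2 * β) - β))
                * Boussinesq.leiLinNorm a σ s (θ τ)
                    ^ (α * (s + 2 * β) / (α * (s + 2 * β) - β)))) = ⊤ ∧
          ENNReal.ofReal ((Real.exp (C * (T - t)) - 1)⁻¹) ≤
            Boussinesq.pairNorm a σ s (u t) (θ t) ^ (2 * α / (2 * α + s - 1))
              + Boussinesq.pairNorm a σ s (u t) (θ t)
                  ^ (2 * α * β / (2 * α * β + s * β - α))
              + Boussinesq.pairNorm a σ s (u t) (θ t)
                  ^ (2 * α * β / (2 * α * β + s * α - β)) := by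
  have hP := Subcritical.of_q_lt hα hβ hs hq
  obtain ⟨C, hC0, hC⟩ := exists_blowup_constant hP
  obtain ⟨p1, p2, p3⟩ := hP.powers
  set m := max (2 * α / (2 * α + s - 1)) (max (2 * α * β / (2 * α * β + s * β - α))
    (2 * α * β / (2 * α * β + s * α - β))) with hm
  have hm1 : 2 * α / (2 * α + s - 1) ≤ m := le_max_left _ _
  have hm2 : 2 * α * β / (2 * α * β + s * β - α) ≤ m := (le_max_left _ _).trans (le_max_right _ _)
  have hm3 : 2 * α * β / (2 * α * β + s * α - β) ≤ m :=
    (le_max_right _ _).trans (le_max_right _ _)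
  have hm0 : 0 < m := p2.trans_le hm2
  refine ⟨m * C, mul_pos hm0 hC0, fun a σ ha hσ u₀ θ₀ hu₀ hθ₀ ru rθ du T u θ hmax => ?_⟩
  obtain ⟨X, Y, cX, cY, X0, Y0, eX, eY, key⟩ := hC a σ ha hσ u₀ θ₀ hu₀ hθ₀ ru rθ du T u θ hmax
  have hT : 0 < T := hmax.1
  have n0 : ∀ t, 0 ≤ X t + Y t := fun t => add_nonneg (X0 t) (Y0 t)
  have eN : ∀ t ∈ Ico 0 T, pairNorm a σ s (u t) (θ t) = ENNReal.ofReal (X t + Y t) :=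
    fun t ht => by rw [pairNorm, eX t ht, eY t ht, ENNReal.ofReal_add (X0 t) (Y0 t)]
  have hunb : ∀ t₀ ∈ Ico 0 T, ∀ B : ℝ, ¬ ∀ t ∈ Ico t₀ T, X t + Y t ≤ B := fun t₀ ht₀ B hB =>
    (lintegral_critReal_lt_top hP X0 Y0 hB).ne (key t₀ ht₀).2
  refine ⟨?_, fun t ht => ⟨?_, ?_⟩⟩
  · by_contra hne
    obtain ⟨B, hB1, hB2⟩ := exists_between (lt_top_iff_ne_top.2 hne)
    have hev := eventually_lt_of_limsup_lt hB1
    obtain ⟨t₁, ht₁, hsub⟩ := (mem_nhdsLT_iff_exists_Ioo_subset).1 hev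
    have hmx : max t₁ 0 < T := max_lt ht₁ hT
    obtain ⟨t₀, h1, h2⟩ := exists_between hmx
    have h3 := (le_max_left _ _).trans_lt h1
    have h4 := (le_max_right t₁ 0).trans h1.le
    refine hunb t₀ ⟨h4, h2⟩ B.toReal fun t ht => ?_
    have h5 : pairNorm a σ s (u t) (θ t) < B := hsub ⟨h3.trans_le ht.1, ht.2⟩
    rw [eN t ⟨h4.trans ht.1, ht.2⟩] at h5
    exact (ENNReal.ofReal_le_iff_le_toReal hB2.ne).1 h5.le
  · rw [← (key t ht).2]
    refine setLIntegral_congr_fun measurableSet_Ico fun τ hτ => ?_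
    have hτ' : τ ∈ Ico 0 T := ⟨ht.1.trans hτ.1, hτ.2⟩
    rw [← crit_ofReal hP (X0 τ) (Y0 τ), eX τ hτ', eY τ hτ', crit]
  · rw [eN t ht, ENNReal.ofReal_rpow_of_nonneg (n0 t) (zero_le_one.trans p1),
      ENNReal.ofReal_rpow_of_nonneg (n0 t) p2.le, ENNReal.ofReal_rpow_of_nonneg (n0 t) p3.le,
      ← ENNReal.ofReal_add (Real.rpow_nonneg (n0 t) _) (Real.rpow_nonneg (n0 t) _),
      ← ENNReal.ofReal_add (add_nonneg (Real.rpow_nonneg (n0 t) _) (Real.rpow_nonneg (n0 t) _))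
        (Real.rpow_nonneg (n0 t) _)]
    refine ENNReal.ofReal_le_ofReal ?_
    change _ ≤ powSum α β s (X t + Y t)
    set e := Real.exp (m * C * (T - t)) with he
    have he1 : 0 < e - 1 := by
      rw [sub_pos, he, Real.one_lt_exp_iff]
      exact mul_pos (mul_pos hm0 hC0) (sub_pos.2 ht.2)
    rw [inv_le_iff_one_le_mul₀ he1]
    by_contra hsmall
    have hsub : Ico t T ⊆ Ico 0 T := Ico_subset_Ico_left ht.1
    have cc : ContinuousOn (fun τ => critReal α β s (X τ) (Y τ)) (Ico t T) :=
      (continuous_critReal hP).comp_continuousOn ((cX.prodMk cY).mono hsub)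
    have cP : ContinuousOn (fun τ => powSum α β s (X τ + Y τ)) (Ico t T) :=
      (continuous_powSum hP).comp_continuousOn ((cX.add cY).mono hsub)
    have hgrow : ∀ τ ∈ Ico t T, powSum α β s (X τ + Y τ) ≤ powSum α β s (X t + Y t) *
        Real.exp (m * C * ∫ r in t..τ, (1 + powSum α β s (X r + Y r))) := by
      intro τ hτ
      have hI : ∫ r in t..τ, C * (1 + critReal α β s (X r) (Y r)) ≤
          C * ∫ r in t..τ, (1 + powSum α β s (X r + Y r)) := by
        rw [← intervalIntegral.integral_const_mul]
        have hIcc : uIcc t τ ⊆ Ico t T := by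
          rw [uIcc_of_le hτ.1]
          exact fun r hr => ⟨hr.1, hr.2.trans_lt hτ.2⟩
        refine intervalIntegral.integral_mono_on hτ.1 ?_ ?_ fun r _ => ?_
        · exact ((continuousOn_const.mul (continuousOn_const.add cc)).mono hIcc).intervalIntegrable
        · exact ((continuousOn_const.mul (continuousOn_const.add cP)).mono hIcc).intervalIntegrable
        · have := critReal_le_powSum hP (X0 r) (Y0 r)
          gcongr
      have hI0 : 0 ≤ C * ∫ r in t..τ, (1 + powSum α β s (X r + Y r)) :=
        mul_nonneg hC0.le (intervalIntegral.integral_nonneg hτ.1 fun r _ =>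
          add_nonneg zero_le_one (powSum_nonneg (n0 r)))
      rw [mul_assoc]
      exact powSum_mul_exp_le hP (n0 τ) (n0 t) hI0 (((key t ht).1 τ hτ).trans
        (mul_le_mul_of_nonneg_left (Real.exp_le_exp.2 hI) (n0 t))) hm1 hm2 hm3
    obtain ⟨B, hB⟩ := exists_bound_of_small cP ht.2 (mul_pos hm0 hC0)
      (fun τ _ => powSum_nonneg (n0 τ)) hgrow (not_le.1 hsmall)
    exact hunb t ht (1 + B) fun τ hτ =>
      (le_one_add_powSum hP (n0 τ)).trans (add_le_add le_rfl (hB τ hτ))
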